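/- **Parameters.** Fix $\gamma\in(2,3)$, $\delta\in\mathbb N=\{1,2,\dots\}$, $\zeta\in(0,\frac1{\gamma-1}]$, $\beta\in(1,2)$, an integer $s>\delta$, $\tau\in(\zeta,1)$ and $\xi\in(0,1)$. For $1\le a\le b$, $\mathrm{TPL}(\alpha,a,b)$ is the law on $\{a,\dots,b\}$ that gives $k$ the mass $\int_k^{k+1}x^{-\alpha}dx\big/\int_a^{b+1}x^{-\alpha}dx$. Upper truncation points are rounded down to integers. **Model.** The ABCD graph $G_n$ on $n$ nodes is generated as follows. 1. *Degrees.* Sample $n$ i.i.d. degrees from $\mathrm{TPL}(\gamma,\delta,n^\zeta)$ and sort them, $d_1\ge\dots\ge d_n$. If their sum is odd, decrease $d_1$ by $1$ and sort again (the *parity alteration*). 2. *Communities.* Independently, sample sizes i.i.d. from $\mathrm{TPL}(\beta,s,n^\tau)$ until their sum is at least $n$, say $n+k$. If $k>0$ and the last size $c$ is at least $k+s$, reduce it by $k$; if $c<k+s$, delete it and increase by $1$ the sizes of $c-k$ distinct old communities chosen uniformly at random. This gives communities $\mathbf C_n=(C_1,\dots,C_L)$, $|C_1|\ge\dots\ge|C_L|$,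 with $\sum_j|C_j|=n$; put $\phi=1-n^{-2}\sum_j|C_j|^2$. 3. *Assignment.* For $i=1,\dots,n$, give the degree $d_i$ to a node $u$ chosen uniformly at random among the nodes without a degree whose community $C(u)$ satisfies $d_i\le\frac{|C(u)|-1}{1-\xi\phi}$ (among all nodes without a degree, should there be no such node). The edges are then created with these degrees, which plays no role here. The degree sequence of $C_j$ is $\mathbf c_j=(d_v)_{v\in C_j}$, where $d_v$ is the degree given to $v$. **Comparison sequences.** Let $\epsilon=\epsilon(n)=n^{-(\tau-\zeta)(2-\beta)/2}$. For a community of size $z$ let $\Delta_z=\big\lfloor\min\{\frac{z-1}{1-\xi\phi},n^\zeta\}\big\rfloor$, let $X^-\sim\mathrm{TPL}(\gamma,\delta,\Delta_z)$, and let $X^+$ have on $\{\delta,\dots,\Delta_z\}$ the law $$\mathbb P(X^+=k)=\frac{(1-\epsilon\,\mathbf 1_{k=\delta})\int_k^{k+1}x^{-\gamma}dx}{(1-\epsilon)\int_\delta^{\delta+1}x^{-\gamma}dx+\int_{\delta+1}^{\Delta_z+1}x^{-\gamma}dx}.$$ Let $\mathbf X^-=(X_i^-)_{1\le i\le z}$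 and $\mathbf X^+=(X_i^+)_{1\le i\le z}$ be i.i.d. copies of $X^-$ and of $X^+$. A random vector $\mathbf X$ with values in $\mathbb N_0^z$ is *stochastically bounded from above* by $\mathbf Y$, and $\mathbf Y$ from below by $\mathbf X$, if $\mathbb P(\mathbf X\in U)\le\mathbb P(\mathbf Y\in U)$ for every set $U\subseteq\mathbb N_0^z$ that is upward closed in the coordinatewise order; this holds *up to probability $r$* if $\mathbb P(\mathbf X\in U)\le\mathbb P(\mathbf Y\in U)+r$ for all such $U$. **Theorem.** One has $\epsilon(n)\to0$, and there is a sequence $\eta(n)\to0$ such that the following holds. * For all large $n$, all integers $\Delta\ge k\ge\delta$: with $\Delta$ in the place of $\Delta_z$, $|\mathbb P(X^+=k)-\mathbb P(X^-=k)|\le\eta(n)\,\mathbb P(X^-=k)$; that is, $\mathbb P(X^+=k)=(1+o(1))\,\mathbb P(X^-=k)$ uniformly. * With probability tending to $1$ as $n\to\infty$, the communities $\mathbf C_n$ are such that every community $C_j$, with $z=|C_j|$, satisfies both of the following. 1. In the model without the parity alteration: there is an event $E$ with $\mathbb P(E\mid\mathbf C_n)\ge1-\eta(n)$ such that, conditionally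 on $\mathbf C_n$ and $E$, the sequence $\mathbf c_j$ is stochastically bounded from below by $\mathbf X^-$ and from above by $\mathbf X^+$. Here $E$ may depend on $j$ and is determined by the degrees of all nodes. 2. In the model with the parity alteration: conditionally on $\mathbf C_n$, the sequence $\mathbf c_j$ is stochastically bounded from below by $\mathbf X^-$ and from above by $\mathbf X^+$, both up to probability $\eta(n)$. -/

import Mathlib

open Filter Topology
open scoped ENNReal BigOperators

noncomputable section

/-! ### Truncated power laws -/

/-- `powInt γ a b = ∫_a^b x^{-γ} dx`. -/
def powInt (γ a b : ℝ) : ℝ := ∫ x in a..b, x ^ (-γ)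

theorem powInt_integrable (γ : ℝ) {a b : ℝ} (ha : 0 < a) (hab : a ≤ b) :
    IntervalIntegrable (fun x : ℝ => x ^ (-γ)) MeasureTheory.volume a b := by
  apply intervalIntegral.intervalIntegrable_rpow
  right
  rw [Set.uIcc_of_le hab]
  exact fun h => absurd h.1 (not_le.mpr ha)

theorem powInt_pos (γ : ℝ) {a b : ℝ} (ha : 0 < a) (hab : a < b) : 0 < powInt γ a b :=
  intervalIntegral.intervalIntegral_pos_of_pos_on (powInt_integrable γ ha hab.le)
    (fun _ hx => Real.rpow_pos_of_pos (ha.trans hx.1) _) hab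

theorem powInt_sum (γ : ℝ) {δ Δ : ℕ} (hδ : 0 < δ) (h : δ ≤ Δ) :
    ∑ k ∈ Finset.Icc δ Δ, powInt γ k (k + 1) = powInt γ δ (Δ + 1) := by
  have key := intervalIntegral.sum_integral_adjacent_intervals_Ico
    (f := fun x : ℝ => x ^ (-γ)) (μ := MeasureTheory.volume) (a := fun k : ℕ => (k : ℝ))
    (m := δ) (n := Δ + 1) (by omega) (by
      intro k hk
      have hk0 : 0 < k := lt_of_lt_of_le hδ hk.1
      exact powInt_integrable γ (by exact_mod_cast hk0) (by exact_mod_cast Nat.le_succ k))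
  have hI : Finset.Icc δ Δ = Finset.Ico δ (Δ + 1) := by
    ext k; simp
  rw [hI]
  simpa [powInt] using key

/-- The probability that the truncated power law `TPL(γ, δ, Δ)` gives to `k`. -/
def tplProb (γ : ℝ) (δ Δ k : ℕ) : ℝ :=
  if k ∈ Finset.Icc δ Δ then powInt γ k (k + 1) / powInt γ δ (Δ + 1) else 0

/-- The same with the mass of the minimum `δ` reduced by the factor `1 - ε` (and renormalised). -/
def perturbedProb (γ : ℝ) (δ Δ : ℕ) (ε : ℝ) (k : ℕ) : ℝ :=
  if k ∈ Finset.Icc δ Δ then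
    ((1 - if k = δ then ε else 0) * powInt γ k (k + 1)) /
      ((1 - ε) * powInt γ δ (δ + 1) + powInt γ (δ + 1) (Δ + 1))
  else 0

theorem tplProb_sum (γ : ℝ) {δ Δ : ℕ} (hδ : 0 < δ) (h : δ ≤ Δ) :
    ∑ k ∈ Finset.Icc δ Δ, ENNReal.ofReal (tplProb γ δ Δ k) = 1 := by
  have hpos : 0 < powInt γ δ (Δ + 1) :=
    powInt_pos γ (by exact_mod_cast hδ) (by exact_mod_cast Nat.lt_succ_of_le h)
  rw [← ENNReal.ofReal_sum_of_nonneg]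
  · rw [Finset.sum_congr rfl (fun k hk => by rw [tplProb, if_pos hk]), ← Finset.sum_div,
      powInt_sum γ hδ h, div_self hpos.ne', ENNReal.ofReal_one]
  · intro k hk
    have hk0 : 0 < k := lt_of_lt_of_le hδ (Finset.mem_Icc.1 hk).1
    rw [tplProb, if_pos hk]
    exact div_nonneg (powInt_pos γ (by exact_mod_cast hk0) (lt_add_one _)).le hpos.le

theorem perturbedProb_sum (γ : ℝ) {δ Δ : ℕ} {ε : ℝ} (hδ : 0 < δ) (h : δ ≤ Δ)
    (h1 : ε < 1) :
    ∑ k ∈ Finset.Icc δ Δ, ENNReal.ofReal (perturbedProb γ δ Δ ε k) = 1 := by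
  have hδ' : (0 : ℝ) < δ := by exact_mod_cast hδ
  have hA : 0 < powInt γ δ (δ + 1) := powInt_pos γ hδ' (lt_add_one _)
  have hle : ((δ : ℝ) + 1) ≤ Δ + 1 := by
    have : (δ : ℝ) ≤ Δ := by exact_mod_cast h
    linarith
  have hB : 0 ≤ powInt γ (δ + 1) (Δ + 1) := by
    rcases hle.eq_or_lt with he | hl
    · rw [he]; simp [powInt]
    · exact (powInt_pos γ (by linarith) hl).le
  have hadd : powInt γ δ (δ + 1) + powInt γ (δ + 1) (Δ + 1) = powInt γ δ (Δ + 1) :=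
    intervalIntegral.integral_add_adjacent_intervals
      (powInt_integrable γ hδ' (by linarith)) (powInt_integrable γ (by linarith) hle)
  have hpos : 0 < (1 - ε) * powInt γ δ (δ + 1) + powInt γ (δ + 1) (Δ + 1) :=
    add_pos_of_pos_of_nonneg (mul_pos (by linarith) hA) hB
  rw [← ENNReal.ofReal_sum_of_nonneg]
  · rw [Finset.sum_congr rfl (fun k hk => by rw [perturbedProb, if_pos hk]), ← Finset.sum_div]
    have : ∑ k ∈ Finset.Icc δ Δ, ((1 - if k = δ then ε else 0) * powInt γ k (k + 1)) =
        (1 - ε) * powInt γ δ (δ + 1) + powInt γ (δ + 1) (Δ + 1) := by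
      simp only [sub_mul, one_mul, ite_mul, zero_mul, Finset.sum_sub_distrib]
      rw [powInt_sum γ hδ h, Finset.sum_ite_eq' (Finset.Icc δ Δ) δ,
        if_pos (Finset.mem_Icc.2 ⟨le_rfl, h⟩), ← hadd]
      ring
    rw [this, div_self hpos.ne', ENNReal.ofReal_one]
  · intro k hk
    have hk0 : 0 < k := lt_of_lt_of_le hδ (Finset.mem_Icc.1 hk).1
    rw [perturbedProb, if_pos hk]
    refine div_nonneg (mul_nonneg ?_ (powInt_pos γ (by exact_mod_cast hk0) (lt_add_one _)).le)
      hpos.le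
    split_ifs <;> linarith

/-- The truncated power law `TPL(γ, δ, Δ)` on `{δ, …, Δ}` (for `1 ≤ δ ≤ Δ`; the other branch is
a junk value). -/
def tpl (γ : ℝ) (δ Δ : ℕ) : PMF ℕ :=
  if h : 0 < δ ∧ δ ≤ Δ then
    PMF.ofFinset (fun k => ENNReal.ofReal (tplProb γ δ Δ k)) (Finset.Icc δ Δ)
      (tplProb_sum γ h.1 h.2) (fun k hk => by rw [tplProb, if_neg hk, ENNReal.ofReal_zero])
  else PMF.pure δ

/-- The perturbed truncated power law on `{δ, …, Δ}` (for `1 ≤ δ ≤ Δ` and `0 ≤ ε < 1`; the other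
branch is a junk value). -/
def perturbedTPL (γ : ℝ) (δ Δ : ℕ) (ε : ℝ) : PMF ℕ :=
  if h : (0 < δ ∧ δ ≤ Δ) ∧ 0 ≤ ε ∧ ε < 1 then
    PMF.ofFinset (fun k => ENNReal.ofReal (perturbedProb γ δ Δ ε k)) (Finset.Icc δ Δ)
      (perturbedProb_sum γ h.1.1 h.1.2 h.2.2)
      (fun k hk => by rw [perturbedProb, if_neg hk, ENNReal.ofReal_zero])
  else PMF.pure δ

/-! ### I.i.d. sequences and stochastic order -/

/-- The law of an i.i.d. sequence of length `n` with marginal `p`. -/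
def iidPMF (p : PMF ℕ) : (n : ℕ) → PMF (Fin n → ℕ)
  | 0 => PMF.pure Fin.elim0
  | n + 1 => p.bind fun a => (iidPMF p n).map (fun x => Fin.cons a x)

/-- The law `p` is stochastically bounded from above by the law `q` (in the coordinatewise order
of the sequences): every upper set is at least as likely under `q`. For `z = 1` this says
`P(X ≥ t) ≤ P(Y ≥ t)` for all `t`. -/
def StochLE {z : ℕ} (p q : PMF (Fin z → ℕ)) : Prop :=
  ∀ U : Set (Fin z → ℕ), IsUpperSet U → p.toOuterMeasure U ≤ q.toOuterMeasure U

/-- The law `p` is stochastically bounded from above by `q` up to an event of probability `r`. -/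
def StochLEUpTo {z : ℕ} (r : ℝ≥0∞) (p q : PMF (Fin z → ℕ)) : Prop :=
  ∀ U : Set (Fin z → ℕ), IsUpperSet U → p.toOuterMeasure U ≤ q.toOuterMeasure U + r

/-! ### The ABCD model: parameters -/

/-- The parameters of the ABCD model other than the number of nodes `n`. -/
structure ABCDParams where
  /-- exponent of the degree distribution -/
  γ : ℝ
  /-- minimum degree -/
  δ : ℕ
  /-- degrees are at most `n^ζ` -/
  ζ : ℝ
  /-- exponent of the distribution of the community sizes -/
  β : ℝ
  /-- minimum community size -/
  s : ℕ
  /-- sampled community sizes are at most `n^τ` -/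
  τ : ℝ
  /-- level of noise -/
  ξ : ℝ

namespace ABCDParams

variable (P : ABCDParams)

/-- The largest possible degree, `⌊n^ζ⌋`. -/
def maxDeg (n : ℕ) : ℕ := ⌊(n : ℝ) ^ P.ζ⌋₊

/-- The largest possible community size, `⌊n^τ⌋`. -/
def maxSize (n : ℕ) : ℕ := ⌊(n : ℝ) ^ P.τ⌋₊

/-- `ε(n) = n^{-(τ-ζ)(2-β)/2}`. -/
def eps (n : ℕ) : ℝ := (n : ℝ) ^ (-((P.τ - P.ζ) * (2 - P.β) / 2))

/-! ### Phase 1: degrees -/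

/-- `n` i.i.d. samples from `TPL(γ, δ, n^ζ)`, listed in non-increasing order. -/
def rawDegrees (n : ℕ) : PMF (List ℕ) :=
  (iidPMF (tpl P.γ P.δ (P.maxDeg n)) n).map
    fun d => (List.ofFn d).insertionSort (· ≥ ·)

end ABCDParams

/-- If the sum of the (non-increasing) list is odd, decrease its first entry by `1` and sort
again. -/
def parityAdjust (l : List ℕ) : List ℕ :=
  if Even l.sum then l
  else match l with
    | [] => []
    | d :: ds => ((d - 1) :: ds).insertionSort (· ≥ ·)

/-- Phase 1 of the ABCD construction: the degree sequence `d_1 ≥ … ≥ d_n`, with even sum. -/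
def ABCDParams.degrees (P : ABCDParams) (n : ℕ) : PMF (List ℕ) :=
  (P.rawDegrees n).map parityAdjust

/-! ### Phase 2: communities -/

/-- Increase by `1` the entries of `l` at `r` distinct positions chosen uniformly at random
(nothing is done if `l` has fewer than `r` entries). -/
def bumpRandom (r : ℕ) (l : List ℕ) : PMF (List ℕ) :=
  if h : (Finset.powersetCard r (Finset.univ : Finset (Fin l.length))).Nonempty then
    (PMF.uniformOfFinset _ h).map
      fun S => List.ofFn fun i : Fin l.length => l.get i + if i ∈ S then 1 else 0
  else PMF.pure l

/-- Sample sizes from `p` one after the other until `rem` nodes are covered. Here `acc` holds the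
sizes accepted so far, `rem` is the number of nodes they leave uncovered, and the first argument
bounds the number of samples. If the newly sampled size `c` is at least `rem`, the excess is
`k = c - rem`; then `c ≥ k + s` means `s ≤ rem`, in which case `c` is reduced to `c - k = rem`;
otherwise the new community is deleted and `c - k = rem` of the old ones are increased by `1`. -/
def growCommunities (p : PMF ℕ) (s : ℕ) : ℕ → ℕ → List ℕ → PMF (List ℕ)
  | 0, _, acc => PMF.pure acc
  | fuel + 1, rem, acc => p.bind fun c =>
      if c < rem then growCommunities p s fuel (rem - c) (c :: acc)
      else if s ≤ rem then PMF.pure (rem :: acc)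
      else bumpRandom rem acc

/-- Phase 2 of the ABCD construction: the community sizes `|C_1| ≥ … ≥ |C_L|`. As sampled sizes
are positive, `n` samples always suffice. -/
def ABCDParams.communities (P : ABCDParams) (n : ℕ) : PMF (List ℕ) :=
  (growCommunities (tpl P.β P.s (P.maxSize n)) P.s n n []).map
    fun l => l.insertionSort (· ≥ ·)

/-! ### Phase 3: assigning degrees to nodes -/

/-- The nodes, when the community sizes are `C`: the community number `j` consists of the
`C[j]` nodes `⟨j, i⟩`. -/
abbrev Node (C : List ℕ) : Type := Σ j : Fin C.length, Fin (C.get j)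

/-- Process the degrees `d` in the given order: each is assigned to a node chosen uniformly at
random among the unassigned nodes `u ∈ U` with `d ≤ cap u`. (If there is no such node, where the
construction is stuck, the choice is among all unassigned nodes, to have a total definition.)
The function `f` records the degrees assigned so far. -/
def assignDegrees {V : Type} [DecidableEq V] (cap : V → ℝ) :
    List ℕ → Finset V → (V → ℕ) → PMF (V → ℕ)
  | [], _, f => PMF.pure f
  | d :: ds, U, f =>
      if hA : (U.filter fun u => (d : ℝ) ≤ cap u).Nonempty then
        (PMF.uniformOfFinset _ hA).bind fun u =>
          assignDegrees cap ds (U.erase u) (Function.update f u d)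
      else if hU : U.Nonempty then
        (PMF.uniformOfFinset U hU).bind fun u =>
          assignDegrees cap ds (U.erase u) (Function.update f u d)
      else PMF.pure f

/-- `φ = 1 - n^{-2} ∑_j |C_j|²`. -/
def phi (n : ℕ) (C : List ℕ) : ℝ :=
  1 - (1 / (n : ℝ) ^ 2) * ∑ j : Fin C.length, (C.get j : ℝ) ^ 2

namespace ABCDParams

variable (P : ABCDParams)

/-- `(z - 1) / (1 - ξ φ)`: the bound on the degrees admitted in a community of size `z`. -/
def cap (n : ℕ) (C : List ℕ) (z : ℕ) : ℝ := ((z : ℝ) - 1) / (1 - P.ξ * phi n C)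

/-- The law of the degrees `(d_v)` of all nodes, conditionally on the community sizes being `C`,
when the sorted degree sequence has law `D` (independently of the communities). -/
def assignment (n : ℕ) (D : PMF (List ℕ)) (C : List ℕ) : PMF (Node C → ℕ) :=
  D.bind fun d =>
    assignDegrees (fun u : Node C => P.cap n C (C.get u.1)) d Finset.univ (fun _ => 0)

end ABCDParams

/-- The degree sequence `c_j = (d_v, v ∈ C_j)` of the community number `j`. -/
def commDegrees {C : List ℕ} (j : Fin C.length) (f : Node C → ℕ) : Fin (C.get j) → ℕ :=
  fun i => f ⟨j, i⟩

/-! ### The two comparison sequences and the sandwich -/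

namespace ABCDParams

variable (P : ABCDParams)

/-- `Δ_z = min {(z - 1) / (1 - ξ φ), n^ζ}`, rounded down. -/
def deltaZ (n : ℕ) (C : List ℕ) (z : ℕ) : ℕ := ⌊min (P.cap n C z) ((n : ℝ) ^ P.ζ)⌋₊

/-- The law of `(X_i^-, 1 ≤ i ≤ z)`. -/
def lowerSeq (n : ℕ) (C : List ℕ) (z : ℕ) : PMF (Fin z → ℕ) :=
  iidPMF (tpl P.γ P.δ (P.deltaZ n C z)) z

/-- The law of `(X_i^+, 1 ≤ i ≤ z)`. -/
def upperSeq (n : ℕ) (C : List ℕ) (z : ℕ) : PMF (Fin z → ℕ) :=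
  iidPMF (perturbedTPL P.γ P.δ (P.deltaZ n C z) (P.eps n)) z

/-- Degree sequence not altered for parity: there is an event of conditional probability at
least `1 - r`, given the communities `C`, conditionally on which `c_j` is stochastically bounded
from below by `(X_i^-)` and from above by `(X_i^+)`. -/
def SandwichRaw (n : ℕ) (r : ℝ) (C : List ℕ) (j : Fin C.length) : Prop :=
  ∃ (E : Set (Node C → ℕ))
    (hE : ∃ f ∈ E, f ∈ (P.assignment n (P.rawDegrees n) C).support),
    1 - ENNReal.ofReal r ≤ (P.assignment n (P.rawDegrees n) C).toOuterMeasure E ∧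
    StochLE (P.lowerSeq n C (C.get j))
      (((P.assignment n (P.rawDegrees n) C).filter E hE).map (commDegrees j)) ∧
    StochLE (((P.assignment n (P.rawDegrees n) C).filter E hE).map (commDegrees j))
      (P.upperSeq n C (C.get j))

/-- Degree sequence with the parity alteration: given the communities `C`, the sequence `c_j` is
stochastically bounded from below by `(X_i^-)` and from above by `(X_i^+)`, in both cases up to
an event of probability `r`. -/
def SandwichAltered (n : ℕ) (r : ℝ) (C : List ℕ) (j : Fin C.length) : Prop :=
  StochLEUpTo (ENNReal.ofReal r) (P.lowerSeq n C (C.get j))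
      ((P.assignment n (P.degrees n) C).map (commDegrees j)) ∧
    StochLEUpTo (ENNReal.ofReal r) ((P.assignment n (P.degrees n) C).map (commDegrees j))
      (P.upperSeq n C (C.get j))

end ABCDParams

end

/-!
The parity alteration aside, let `cap v` be the largest degree admitted by the node `v`, and let
`V l` be the number of nodes that admit the degree `l`. If the assignment does not get stuck, then
it gives the degrees `f : nodes → ℕ` with probability

`n! * ∏ v, p (f v) / ∏ i < n, (V (d i) - i)`,

where `p` is the truncated power law and `d 0 ≥ d 1 ≥ …` are the values of `f` in order
(`iidAssignment_apply`). So the law of `f` has an explicit density with respect to a product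
measure. Raising the degree of one node raises the list `d` and hence the density, but only
slightly (`choiceProd_anti`, `choiceProd_le_mul_exp`): the total loss `∑ i, V (d i)` is at most the
number of nodes in communities of size at most `n^ζ`, while at least of the order of `n` choices are
left in every step in which a degree above the minimum `δ` is assigned, provided that `δ` is taken
by a positive fraction of the nodes.

Therefore the degree of one node of a community, given the degrees of all the other nodes, has
weights proportional to `p k * r k` with `r` increasing, which makes it stochastically larger than
`X⁻`; and `r` grows in total by a factor that is smaller than the effect of multiplying the weight
of `δ` by `1 - ε`, so the degree is stochastically smaller than `X⁺`
(`exists_weights_iidAssignment_update`, `tpl_mul_tsum_le`, `tsum_le_perturbedTPL_mul`). As this holds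
for all values of the other degrees, revealing the degrees in the community one after the other
gives the sandwich between i.i.d. sequences (`iidPMF_comparison`). All this is true conditionally on
the event `E` that sufficiently many nodes outside of the community have degree `δ`. This event
does not involve the degrees in the community, so conditioning on it is harmless
(`stochLE_iidAssignment`), and it has probability tending to `1` by an exponential moment estimate
(`iidPMF_count_lt_le`).

The parity alteration replaces one entry `D` of the list of degrees by `D - 1` at the same place.
Up to a small probability that entry can be given to the same node in both models, and this node is
not in the community (`parityAssignment_close`).

Finally, the expected number of nodes in communities of size at most `n^ζ` is
`O(n^ζ + ε² n)`, by an optional stopping argument for the sampling of the sizes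
(`tsum_growCommunities_mul_smallMass_le`) and an estimate for means of truncated power laws
(`tsum_tpl_small_le`). By Markov's inequality it is at most a small multiple of `ε n` with
probability tending to `1`, and for such communities `ABCDParams.sandwich_of_bounds` applies.
-/


/-! ### I.i.d. sequences and stochastic domination -/

theorem tsum_fin_cons {n : ℕ} (F : (Fin (n + 1) → ℕ) → ℝ≥0∞) :
    ∑' x, F x = ∑' a : ℕ, ∑' x : Fin n → ℕ, F (Fin.cons a x) := by
  rw [← (Fin.consEquiv (fun _ : Fin (n + 1) => ℕ)).tsum_eq F,
    ENNReal.tsum_prod (f := fun a x => F (Fin.consEquiv (fun _ : Fin (n + 1) => ℕ) (a, x)))]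
  rfl

theorem iidPMF_succ_apply_cons (p : PMF ℕ) (n : ℕ) (a : ℕ) (x : Fin n → ℕ) :
    iidPMF p (n + 1) (Fin.cons a x) = p a * iidPMF p n x := by
  rw [iidPMF, PMF.bind_apply, tsum_eq_single a]
  · rw [PMF.map_apply, tsum_eq_single x]
    · simp
    · intro y hy
      rw [if_neg]
      rw [Fin.cons_inj]
      exact fun h => hy h.2.symm
  · intro b hb
    rw [PMF.map_apply]
    simp only [Fin.cons_inj]
    simp [hb.symm]

theorem iidPMF_apply (p : PMF ℕ) (n : ℕ) (x : Fin n → ℕ) :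
    iidPMF p n x = ∏ i, p (x i) := by
  induction n with
  | zero => simp [iidPMF, Subsingleton.elim x Fin.elim0]
  | succ n ih =>
    rw [← Fin.cons_self_tail x, iidPMF_succ_apply_cons, ih, Fin.prod_univ_succ]
    simp

/-- The expectation of a product of functions of the coordinates of an i.i.d. sequence. -/
theorem tsum_iidPMF_mul_prod (p : PMF ℕ) (g : ℕ → ℝ≥0∞) (n : ℕ) :
    ∑' x, iidPMF p n x * ∏ i, g (x i) = (∑' a, p a * g a) ^ n := by
  induction n with
  | zero =>
    simp only [iidPMF, tsum_fintype, Finset.univ_unique, PMF.pure_apply, Finset.univ_eq_empty,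
      Finset.prod_empty, mul_one, Finset.sum_singleton, pow_zero]
    rw [if_pos (Subsingleton.elim _ _)]
  | succ n ih =>
    rw [tsum_fin_cons, pow_succ', ← ih, ← ENNReal.tsum_mul_right]
    refine tsum_congr fun a => ?_
    rw [← ENNReal.tsum_mul_left]
    refine tsum_congr fun x => ?_
    rw [iidPMF_succ_apply_cons, Fin.prod_univ_succ]
    simp only [Fin.cons_zero, Fin.cons_succ]
    ring

theorem tsum_iidPMF_toOuterMeasure_cons (p : PMF ℕ) (n : ℕ) (U : Set (Fin (n + 1) → ℕ)) :
    (iidPMF p (n + 1)).toOuterMeasure U =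
      ∑' a, p a * (iidPMF p n).toOuterMeasure {x | Fin.cons a x ∈ U} := by
  rw [PMF.toOuterMeasure_apply, tsum_fin_cons]
  refine tsum_congr fun a => ?_
  rw [PMF.toOuterMeasure_apply, ← ENNReal.tsum_mul_left]
  refine tsum_congr fun x => ?_
  by_cases h : (Fin.cons a x : Fin (n + 1) → ℕ) ∈ U
  · rw [Set.indicator_of_mem h, Set.indicator_of_mem (by exact h), iidPMF_succ_apply_cons]
  · rw [Set.indicator_of_notMem h, Set.indicator_of_notMem (by exact h), mul_zero]

theorem isUpperSet_cons_left {n : ℕ} {U : Set (Fin (n + 1) → ℕ)} (hU : IsUpperSet U)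
    (x : Fin n → ℕ) : IsUpperSet {a : ℕ | (Fin.cons a x : Fin (n + 1) → ℕ) ∈ U} :=
  fun _ _ hab ha => hU (Fin.cons_le_cons.2 ⟨hab, le_rfl⟩) ha

theorem isUpperSet_cons_right {n : ℕ} {U : Set (Fin (n + 1) → ℕ)} (hU : IsUpperSet U)
    (a : ℕ) : IsUpperSet {x : Fin n → ℕ | (Fin.cons a x : Fin (n + 1) → ℕ) ∈ U} :=
  fun _ _ hxy hx => hU (Fin.cons_le_cons.2 ⟨le_rfl, hxy⟩) hx

/-- Let `R` be `≤` or `≥`. If the law under the measure `m` of every single coordinate, given all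
the others, is `R`-comparable with `p` on upper sets, then so is `m` with the law of an i.i.d.
sequence. The hypothesis is linear in `m`, so it survives summation over the first coordinate,
and that coordinate can then be replaced by an independent one. -/
theorem iidPMF_comparison {R : ℝ≥0∞ → ℝ≥0∞ → Prop} (hrefl : ∀ a, R a a)
    (htrans : ∀ a b c, R a b → R b c → R a c) (hmul : ∀ a b c, R a b → R (c * a) (c * b))
    (hsum : ∀ (ι : Type) (f g : ι → ℝ≥0∞), (∀ i, R (f i) (g i)) → R (∑' i, f i) (∑' i, g i))
    (p : PMF ℕ) (n : ℕ) (m : (Fin n → ℕ) → ℝ≥0∞)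
    (hm : ∀ x i (A : Set ℕ), IsUpperSet A →
      R (∑' k, A.indicator (fun k => m (Function.update x i k)) k)
        (p.toOuterMeasure A * ∑' k, m (Function.update x i k)))
    (U : Set (Fin n → ℕ)) (hU : IsUpperSet U) :
    R (∑' x, U.indicator m x) ((iidPMF p n).toOuterMeasure U * ∑' x, m x) := by
  induction n with
  | zero =>
    by_cases h : (Fin.elim0 : Fin 0 → ℕ) ∈ U
    · have : U = Set.univ := Set.eq_univ_of_forall fun x => by
        rwa [Subsingleton.elim x Fin.elim0]
      simp only [this, iidPMF, PMF.toOuterMeasure_pure_apply, Set.mem_univ, if_true, one_mul,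
        Set.indicator_univ, hrefl]
    · have : U = ∅ := Set.eq_empty_of_forall_notMem fun x => by
        rwa [Subsingleton.elim x Fin.elim0]
      simp [this, hrefl]
  | succ n ih =>
    have key := fun a => ih (fun x => ∑' k : ℕ, m (Fin.cons k x)) (fun x i A hA => by
      have e : ∀ j k : ℕ, (Fin.cons k (Function.update x i j) : Fin (n + 1) → ℕ) =
          Function.update (Fin.cons k x : Fin (n + 1) → ℕ) i.succ j := fun j k => by
        rw [Fin.cons_update]
      have l : ∑' j, A.indicator (fun j => ∑' k : ℕ, m (Fin.cons k (Function.update x i j))) j =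
          ∑' k : ℕ, ∑' j, A.indicator
            (fun j => m (Function.update (Fin.cons k x : Fin (n + 1) → ℕ) i.succ j)) j := by
        rw [ENNReal.tsum_comm]
        refine tsum_congr fun j => ?_
        by_cases hj : j ∈ A
        · simp [Set.indicator_of_mem hj, e]
        · simp [Set.indicator_of_notMem hj]
      have r : ∑' j, ∑' k : ℕ, m (Fin.cons k (Function.update x i j)) =
          ∑' k : ℕ, ∑' j, m (Function.update (Fin.cons k x : Fin (n + 1) → ℕ) i.succ j) := by
        rw [ENNReal.tsum_comm]
        simp only [e]
      rw [l, r, ← ENNReal.tsum_mul_left]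
      exact hsum _ _ _ fun k => hm _ _ _ hA) _ (isUpperSet_cons_right hU a)
    rw [tsum_iidPMF_toOuterMeasure_cons, tsum_fin_cons m, tsum_fin_cons, ENNReal.tsum_comm,
      ENNReal.tsum_comm (f := fun (a : ℕ) (x : Fin n → ℕ) => m (Fin.cons a x)),
      ← ENNReal.tsum_mul_right]
    have first : R (∑' x : Fin n → ℕ, ∑' a : ℕ, U.indicator m (Fin.cons a x))
        (∑' x : Fin n → ℕ, p.toOuterMeasure {a | (Fin.cons a x : Fin (n + 1) → ℕ) ∈ U} *
            ∑' a : ℕ, m (Fin.cons a x)) := by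
      refine hsum _ _ _ fun x => ?_
      have := hm (Fin.cons 0 x) 0 _ (isUpperSet_cons_left hU x)
      simp only [Fin.update_cons_zero] at this
      exact this
    have swap : ∑' x : Fin n → ℕ, p.toOuterMeasure {a | (Fin.cons a x : Fin (n + 1) → ℕ) ∈ U} *
            ∑' a : ℕ, m (Fin.cons a x) =
        ∑' a, p a * ∑' x : Fin n → ℕ, {x | (Fin.cons a x : Fin (n + 1) → ℕ) ∈ U}.indicator
            (fun x => ∑' k : ℕ, m (Fin.cons k x)) x := by
      simp_rw [← ENNReal.tsum_mul_left (a := p _)]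
      rw [ENNReal.tsum_comm]
      refine tsum_congr fun x => ?_
      rw [PMF.toOuterMeasure_apply, ← ENNReal.tsum_mul_right]
      refine tsum_congr fun a => ?_
      by_cases h : (Fin.cons a x : Fin (n + 1) → ℕ) ∈ U
      · rw [Set.indicator_of_mem (by exact h), Set.indicator_of_mem (by exact h)]
      · rw [Set.indicator_of_notMem (by exact h), Set.indicator_of_notMem (by exact h)]
        simp
    rw [swap] at first
    refine htrans _ _ _ first (hsum _ _ _ fun a => ?_)
    rw [mul_assoc]
    exact hmul _ _ _ (key a)

/-! ### The law of the assignment of a given degree sequence -/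

/-- The product of the factorials of the multiplicities of a multiset. -/
def countFact (s : Multiset ℕ) : ℕ := ∏ k ∈ s.toFinset, (s.count k).factorial

/-- Factors `0! = 1` can be added to the product. -/
theorem countFact_eq_prod_of_subset {s : Multiset ℕ} {T : Finset ℕ} (h : s.toFinset ⊆ T) :
    countFact s = ∏ k ∈ T, (s.count k).factorial := by
  refine Finset.prod_subset h fun k _ hk => ?_
  rw [Multiset.count_eq_zero_of_notMem (by simpa using hk), Nat.factorial_zero]

theorem countFact_cons (a : ℕ) (s : Multiset ℕ) :
    countFact (a ::ₘ s) = (s.count a + 1) * countFact s := by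
  have h : s.toFinset ⊆ (a ::ₘ s).toFinset := by
    rw [Multiset.toFinset_cons]; exact Finset.subset_insert _ _
  have ha : a ∈ (a ::ₘ s).toFinset := by simp
  rw [countFact_eq_prod_of_subset h, countFact, ← Finset.mul_prod_erase _ _ ha,
    ← Finset.mul_prod_erase _ (fun k => (s.count k).factorial) ha, Multiset.count_cons_self,
    Nat.factorial_succ, mul_assoc]
  congr 2
  refine Finset.prod_congr rfl fun k hk => ?_
  rw [Multiset.count_cons_of_ne (Finset.ne_of_mem_erase hk)]

/-- A multiset of `n` numbers has `n! / ∏ (multiplicities)!` orderings. -/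
theorem tsum_orderings_mul_countFact (n : ℕ) (s : Multiset ℕ) (hs : s.card = n) :
    (∑' x : Fin n → ℕ, if (↑(List.ofFn x) : Multiset ℕ) = s then (1 : ℝ≥0∞) else 0) *
      countFact s = n.factorial := by
  induction n generalizing s with
  | zero =>
    obtain rfl := Multiset.card_eq_zero.1 hs
    simp [tsum_fintype, countFact]
  | succ n ih =>
    rw [tsum_fin_cons, tsum_eq_sum (s := s.toFinset), Finset.sum_mul]
    · have step : ∀ a ∈ s.toFinset, (∑' x : Fin n → ℕ,
          if (↑(List.ofFn (Fin.cons a x : Fin (n + 1) → ℕ)) : Multiset ℕ) = s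
            then (1 : ℝ≥0∞) else 0) * countFact s = s.count a * n.factorial := by
        intro a ha
        obtain ⟨t, rfl⟩ := Multiset.exists_cons_of_mem (Multiset.mem_toFinset.1 ha)
        have ht : t.card = n := by simpa using hs
        rw [countFact_cons, ← ih t ht, Multiset.count_cons_self]
        simp only [List.ofFn_cons, ← Multiset.cons_coe, Multiset.cons_inj_right]
        push_cast
        ring
      rw [Finset.sum_congr rfl step, ← Finset.sum_mul, ← Nat.cast_sum,
        Multiset.toFinset_sum_count_eq, hs, Nat.factorial_succ]
      push_cast
      ring
    · intro a ha
      refine ENNReal.tsum_eq_zero.2 fun x => if_neg fun h => ha ?_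
      rw [← h]
      simp

section Assign

variable {V : Type}

/-- The nodes of `U` among which the node that gets the degree `d` is chosen: those that admit `d`,
or all of them if there are none. -/
noncomputable def candidates (cap : V → ℝ) (d : ℕ) (U : Finset V) : Finset V :=
  if (U.filter fun u => (d : ℝ) ≤ cap u).Nonempty then U.filter fun u => (d : ℝ) ≤ cap u else U

theorem candidates_subset (cap : V → ℝ) (d : ℕ) (U : Finset V) : candidates cap d U ⊆ U := by
  unfold candidates
  split_ifs
  · exact Finset.filter_subset _ _
  · exact subset_rfl

theorem candidates_nonempty (cap : V → ℝ) (d : ℕ) {U : Finset V} (hU : U.Nonempty) :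
    (candidates cap d U).Nonempty := by
  unfold candidates
  split_ifs with h
  · exact h
  · exact hU

theorem assignDegrees_cons [DecidableEq V] (cap : V → ℝ) (d : ℕ) (ds : List ℕ) {U : Finset V} (hU : U.Nonempty)
    (g : V → ℕ) :
    assignDegrees cap (d :: ds) U g =
      (PMF.uniformOfFinset _ (candidates_nonempty cap d hU)).bind fun u =>
        assignDegrees cap ds (U.erase u) (Function.update g u d) := by
  rw [assignDegrees]
  by_cases h : (U.filter fun u => (d : ℝ) ≤ cap u).Nonempty
  · rw [dif_pos h]
    congr 1
    congr 1
    rw [candidates, if_pos h]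
  · rw [dif_neg h, dif_pos hU]
    congr 1
    congr 1
    rw [candidates, if_neg h]

theorem nonempty_of_card_eq_cons {U : Finset V} {d : ℕ} {ds : List ℕ}
    (h : U.card = (d :: ds).length) : U.Nonempty :=
  Finset.card_pos.1 (by rw [h]; simp)

theorem card_erase_of_card_eq_cons [DecidableEq V] {U : Finset V} {d : ℕ} {ds : List ℕ} {u : V} (hu : u ∈ U)
    (h : U.card = (d :: ds).length) : (U.erase u).card = ds.length := by
  rw [Finset.card_erase_of_mem hu, h]; simp

/-- The assignment gives exactly the degrees of the list to the nodes of `U`. -/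
theorem map_eq_of_mem_support_assignDegrees [DecidableEq V] (cap : V → ℝ) (ds : List ℕ) :
    ∀ (U : Finset V) (g f : V → ℕ), U.card = ds.length →
      f ∈ (assignDegrees cap ds U g).support →
      (∀ u ∉ U, f u = g u) ∧ U.val.map f = ds := by
  induction ds with
  | nil =>
    intro U g f hU hf
    rw [assignDegrees, PMF.mem_support_pure_iff] at hf
    subst hf
    have : U = ∅ := by simpa using hU
    subst this
    simp
  | cons d ds ih =>
    intro U g f hU hf
    rw [assignDegrees_cons cap d ds (nonempty_of_card_eq_cons hU), PMF.mem_support_bind_iff] at hf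
    obtain ⟨u, hu, hf⟩ := hf
    rw [PMF.mem_support_uniformOfFinset_iff] at hu
    have huU := candidates_subset _ _ _ hu
    obtain ⟨h1, h2⟩ := ih _ _ _ (card_erase_of_card_eq_cons huU hU) hf
    refine ⟨fun v hv => ?_, ?_⟩
    · rw [h1 v (fun h => hv (Finset.mem_of_mem_erase h)),
        Function.update_of_ne (fun h : v = u => hv (by rw [h]; exact huU))]
    · have hu' : f u = d := by rw [h1 u (Finset.notMem_erase _ _), Function.update_self]
      rw [← Multiset.cons_erase (Finset.mem_def.1 huU), Multiset.map_cons, ← Finset.erase_val, h2,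
        hu', Multiset.cons_coe]

variable [Fintype V]

/-- The number of nodes that admit the degree `l`. -/
noncomputable def slots (cap : V → ℝ) (l : ℕ) : ℕ := (Finset.univ.filter fun u => (l : ℝ) ≤ cap u).card

theorem slots_antitone (cap : V → ℝ) : Antitone (slots cap) := fun _ _ h =>
  Finset.card_le_card fun u hu => by
    simp only [Finset.mem_filter, Finset.mem_univ, true_and] at hu ⊢
    exact (Nat.cast_le.2 h).trans hu

/-- If every assigned node admits the degree `d`, then `slots d - t` of the unassigned nodes do,
where `t` is the number of assigned nodes. -/
theorem card_filter_eq_slots_sub [DecidableEq V] {cap : V → ℝ} {U : Finset V} {d : ℕ}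
    (h : ∀ u ∉ U, (d : ℝ) ≤ cap u) :
    (U.filter fun u => (d : ℝ) ≤ cap u).card = slots cap d - Uᶜ.card := by
  have : (U.filter fun u => (d : ℝ) ≤ cap u) =
      (Finset.univ.filter fun u => (d : ℝ) ≤ cap u) \ Uᶜ := by
    ext u
    simp [and_comm]
  rw [this, Finset.card_sdiff_of_subset, slots]
  intro u hu
  simpa using h u (by simpa using hu)

end Assign

/-- The product `∏ (V(dᵢ) - t - i)`, with truncated subtraction, over the entries `d₀, d₁, …` of a list: when `t` nodes are
already assigned and `V d` nodes admit the degree `d`, this is the number of ways to assign the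
degrees of a non-increasing list one after the other. -/
def choiceProd (V : ℕ → ℕ) : ℕ → List ℕ → ℕ
  | _, [] => 1
  | t, d :: ds => (V d - t) * choiceProd V (t + 1) ds

section Assign

variable {V : Type} [DecidableEq V] [Fintype V]

theorem card_compl_erase {U : Finset V} {u : V} (hu : u ∈ U) :
    (U.erase u)ᶜ.card = Uᶜ.card + 1 := by
  rw [Finset.compl_erase, Finset.card_insert_of_notMem (by simpa using hu)]

/-- The probability that the assignment of a non-increasing list of degrees results in `f`: each
of the orders in which `f` can arise has the same probability. -/
theorem assignDegrees_apply (cap : V → ℝ) (ds : List ℕ) :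
    ∀ (U : Finset V) (g f : V → ℕ), ds.Pairwise (· ≥ ·) → U.card = ds.length →
      (∀ u ∉ U, ∀ d ∈ ds, (d : ℝ) ≤ cap u) → (∀ u ∈ U, (f u : ℝ) ≤ cap u) →
      (∀ u ∉ U, f u = g u) → U.val.map f = ds →
      assignDegrees cap ds U g f =
        countFact (ds : Multiset ℕ) / choiceProd (slots cap) Uᶜ.card ds := by
  induction ds with
  | nil =>
    intro U g f _ hU _ _ hg _
    have : U = ∅ := by simpa using hU
    subst this
    have : f = g := funext fun u => hg u (by simp)
    subst this
    simp [assignDegrees, countFact, choiceProd]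
  | cons d ds ih =>
    intro U g f hsort hU hcap hf hg hmap
    have hne := nonempty_of_card_eq_cons hU
    rw [List.pairwise_cons] at hsort
    have hd : ∃ u ∈ U, f u = d := by
      have : d ∈ U.val.map f := by rw [hmap]; simp
      simpa using this
    have hA : (U.filter fun u => (d : ℝ) ≤ cap u).Nonempty := by
      obtain ⟨u, hu, rfl⟩ := hd
      exact ⟨u, Finset.mem_filter.2 ⟨hu, hf u hu⟩⟩
    have hcand : candidates cap d U = U.filter fun u => (d : ℝ) ≤ cap u := if_pos hA
    have hcard : (candidates cap d U).card = slots cap d - Uᶜ.card := by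
      rw [hcand, card_filter_eq_slots_sub fun u hu => hcap u hu d (by simp)]
    rw [assignDegrees_cons cap d ds hne, PMF.bind_apply, tsum_eq_sum (s := candidates cap d U)
      (fun u hu => by rw [PMF.uniformOfFinset_apply_of_notMem _ hu, zero_mul])]
    -- Only the choice of a node `u` with `f u = d` can result in `f`.
    have step : ∀ u ∈ candidates cap d U,
        PMF.uniformOfFinset _ (candidates_nonempty cap d hne) u *
          assignDegrees cap ds (U.erase u) (Function.update g u d) f =
        if f u = d then ((candidates cap d U).card : ℝ≥0∞)⁻¹ *
          (countFact (ds : Multiset ℕ) / choiceProd (slots cap) (Uᶜ.card + 1) ds) else 0 := by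
      intro u hu
      have huU := candidates_subset _ _ _ hu
      rw [PMF.uniformOfFinset_apply_of_mem _ hu]
      split_ifs with hfu
      · rw [ih (U.erase u) (Function.update g u d) f hsort.2 (card_erase_of_card_eq_cons huU hU),
          card_compl_erase huU]
        · intro v hv e he
          by_cases hvu : v = u
          · subst hvu
            rw [hcand, Finset.mem_filter] at hu
            exact (Nat.cast_le.2 (hsort.1 e he)).trans hu.2
          · exact hcap v (fun h => hv (Finset.mem_erase.2 ⟨hvu, h⟩)) e (by simp [he])
        · exact fun v hv => hf v (Finset.mem_of_mem_erase hv)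
        · intro v hv
          by_cases hvu : v = u
          · subst hvu; rw [hfu, Function.update_self]
          · rw [Function.update_of_ne hvu, hg v (fun h => hv (Finset.mem_erase.2 ⟨hvu, h⟩))]
        · rw [← Multiset.cons_erase (Finset.mem_def.1 huU), Multiset.map_cons, hfu,
            ← Multiset.cons_coe, Multiset.cons_inj_right] at hmap
          rw [Finset.erase_val, hmap]
      · rw [(PMF.apply_eq_zero_iff _ _).2, mul_zero]
        intro hs
        refine hfu ?_
        rw [(map_eq_of_mem_support_assignDegrees cap ds _ _ _
          (card_erase_of_card_eq_cons huU hU) hs).1 u (Finset.notMem_erase _ _),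
          Function.update_self]
    -- The candidates with `f u = d` are all the nodes of `U` with this degree, as `f ≤ cap`.
    have hnum : ((candidates cap d U).filter fun u => f u = d).card =
        (ds : Multiset ℕ).count d + 1 := by
      have e : ((candidates cap d U).filter fun u => f u = d) = U.filter fun u => d = f u := by
        ext u
        rw [hcand]
        simp only [Finset.mem_filter]
        exact ⟨fun h => ⟨h.1.1, h.2.symm⟩, fun h => ⟨⟨h.1, h.2 ▸ hf u h.1⟩, h.2.symm⟩⟩
      rw [e, ← Multiset.count_cons_self, Multiset.cons_coe, ← hmap, Multiset.count_map]
      rfl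
    rw [Finset.sum_congr rfl step, ← Finset.sum_filter, Finset.sum_const, hnum, choiceProd,
      ← Multiset.cons_coe, countFact_cons, ← hcard, nsmul_eq_mul, Nat.cast_mul, Nat.cast_mul,
      div_eq_mul_inv, div_eq_mul_inv, ENNReal.mul_inv (Or.inr (ENNReal.natCast_ne_top _))
        (Or.inl (ENNReal.natCast_ne_top _))]
    ring

/-- If sufficiently many nodes admit the degrees above the minimum `δ`, then the assignment never
gets stuck, and the degrees given to the nodes are admitted by them. -/
theorem le_cap_of_mem_support_assignDegrees (cap : V → ℝ) (δ : ℕ) (hδ : ∀ u, (δ : ℝ) ≤ cap u)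
    (ds : List ℕ) :
    ∀ (U : Finset V) (g f : V → ℕ), ds.Pairwise (· ≥ ·) → (∀ d ∈ ds, δ ≤ d) →
      U.card = ds.length →
      (∀ d ∈ ds, d ≠ δ → Uᶜ.card + ds.countP (· ≠ δ) ≤ slots cap d) →
      f ∈ (assignDegrees cap ds U g).support → ∀ u ∈ U, (f u : ℝ) ≤ cap u := by
  induction ds with
  | nil =>
    intro U g f _ _ hU _ _
    have : U = ∅ := by simpa using hU
    subst this
    simp
  | cons d ds ih =>
    intro U g f hsort hmin hU hslack hf
    have hne := nonempty_of_card_eq_cons hU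
    rw [List.pairwise_cons] at hsort
    have hA : (U.filter fun u => (d : ℝ) ≤ cap u).Nonempty := by
      by_cases hd : d = δ
      · subst hd
        simpa [hδ] using hne
      · have h1 := hslack d (by simp) hd
        rw [List.countP_cons_of_pos (by simpa using hd)] at h1
        by_contra hcon
        rw [Finset.not_nonempty_iff_eq_empty, Finset.filter_eq_empty_iff] at hcon
        have : slots cap d ≤ Uᶜ.card := Finset.card_le_card fun u hu => by
          simp only [Finset.mem_filter, Finset.mem_univ, true_and] at hu
          rw [Finset.mem_compl]
          exact fun hu' => hcon hu' hu
        omega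
    have hcand : candidates cap d U = U.filter fun u => (d : ℝ) ≤ cap u := if_pos hA
    rw [assignDegrees_cons cap d ds hne, PMF.mem_support_bind_iff] at hf
    obtain ⟨u, hu, hf⟩ := hf
    rw [PMF.mem_support_uniformOfFinset_iff] at hu
    have huU := candidates_subset _ _ _ hu
    have hcard := card_erase_of_card_eq_cons huU hU
    have hrec := ih _ _ _ hsort.2 (fun e he => hmin e (by simp [he])) hcard (by
      intro e he heδ
      have hdδ : d ≠ δ := fun h => heδ (le_antisymm (h ▸ hsort.1 e he) (hmin e (by simp [he])))
      have := hslack e (by simp [he]) heδ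
      rw [List.countP_cons_of_pos (by simpa using hdδ)] at this
      rw [card_compl_erase huU]
      omega) hf
    intro v hv
    by_cases hvu : v = u
    · subst hvu
      rw [(map_eq_of_mem_support_assignDegrees cap ds _ _ _ hcard hf).1 v (Finset.notMem_erase _ _),
        Function.update_self]
      rw [hcand, Finset.mem_filter] at hu
      exact hu.2
    · exact hrec v (Finset.mem_erase.2 ⟨hvu, hv⟩)

end Assign

/-! ### Comparison of the numbers of choices -/

/-- Raising the entries of a list reduces the number of choices. -/
theorem choiceProd_anti {V : ℕ → ℕ} (hV : Antitone V) {l l' : List ℕ}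
    (h : List.Forall₂ (· ≤ ·) l l') (t : ℕ) : choiceProd V t l' ≤ choiceProd V t l := by
  induction h generalizing t with
  | nil => exact le_rfl
  | cons h _ ih => exact Nat.mul_le_mul (Nat.sub_le_sub_right (hV h) _) (ih _)

theorem choiceProd_pos {V : ℕ → ℕ} {δ : ℕ} {l : List ℕ} (hsort : l.Pairwise (· ≥ ·))
    (hmin : ∀ d ∈ l, δ ≤ d) (t : ℕ) (ht : t + l.length ≤ V δ)
    (hV : ∀ d ∈ l, d ≠ δ → t + l.countP (· ≠ δ) ≤ V d) : 0 < choiceProd V t l := by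
  induction l generalizing t with
  | nil => exact Nat.one_pos
  | cons d l ih =>
    rw [List.pairwise_cons] at hsort
    simp only [List.length_cons] at ht
    refine Nat.mul_pos ?_ (ih hsort.2 (fun e he => hmin e (by simp [he])) _ (by omega) ?_)
    · by_cases hd : d = δ
      · subst hd; omega
      · have := hV d (by simp) hd
        rw [List.countP_cons_of_pos (by simpa using hd)] at this
        omega
    · intro e he heδ
      have hdδ : d ≠ δ := fun h => heδ (le_antisymm (h ▸ hsort.1 e he) (hmin e (by simp [he])))
      have := hV e (by simp [he]) heδ
      rw [List.countP_cons_of_pos (by simpa using hdδ)] at this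
      omega

/-- Raising the entries of a list reduces the number of choices at most by an exponential factor.
Steps at which the minimum `δ` is assigned are not affected, and at the other steps there are at
least `K` choices. -/
theorem choiceProd_le_mul_exp {V : ℕ → ℕ} (hV : Antitone V) {δ : ℕ} {K : ℝ} (hK : 0 < K)
    {l l' : List ℕ} (h : List.Forall₂ (· ≤ ·) l l') (hsort : l'.Pairwise (· ≥ ·))
    (hmin : ∀ d ∈ l, δ ≤ d) (t : ℕ)
    (hslack : ∀ d ∈ l', d ≠ δ → ((t + l'.countP (· ≠ δ) : ℕ) : ℝ) + K ≤ V d) :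
    (choiceProd V t l : ℝ) ≤ choiceProd V t l' *
      Real.exp (((l.map fun d => (V d : ℝ)).sum - (l'.map fun d => (V d : ℝ)).sum) / K) := by
  induction h generalizing t with
  | nil => simp [choiceProd]
  | @cons d d' l l' hd hl ih =>
    rw [List.pairwise_cons] at hsort
    have hdmin : δ ≤ d := hmin d (by simp)
    have hrec := ih hsort.2 (fun e he => hmin e (by simp [he])) (t + 1) (by
      intro e he heδ
      have hdδ : d' ≠ δ := fun h => by
        have h1 : e ≤ d' := hsort.1 e he
        have h2 : δ ≤ e := by
          obtain ⟨i, hi, rfl⟩ := List.getElem_of_mem he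
          have := (List.forall₂_iff_get.1 hl).2 i (by rw [hl.length_eq]; exact hi) hi
          exact (hmin _ (List.mem_cons_of_mem _ (List.get_mem _ _))).trans this
        exact heδ (le_antisymm (h ▸ h1) h2)
      have := hslack e (by simp [he]) heδ
      rw [List.countP_cons_of_pos (by simpa using hdδ)] at this
      push_cast at this ⊢
      linarith)
    have hhead : ((V d - t : ℕ) : ℝ) ≤
        (V d' - t : ℕ) * Real.exp (((V d : ℝ) - V d') / K) := by
      by_cases hdδ : d' = δ
      · have : d = d' := le_antisymm hd (hdδ ▸ hdmin)
        rw [this]; simp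
      · have h1 := hslack d' (by simp) hdδ
        have h0 : (0 : ℝ) ≤ ((d' :: l').countP (· ≠ δ) : ℕ) := Nat.cast_nonneg _
        have hVd : (V d' : ℝ) ≤ V d := by exact_mod_cast hV hd
        push_cast at h1
        have ht' : t ≤ V d' := by
          have : (t : ℝ) ≤ V d' := by linarith
          exact_mod_cast this
        rw [Nat.cast_sub (ht'.trans (hV hd)), Nat.cast_sub ht']
        have hx : 0 ≤ ((V d : ℝ) - V d') / K := div_nonneg (by linarith) hK.le
        have hKle : K ≤ (V d' : ℝ) - t := by linarith
        calc (V d : ℝ) - t = ((V d' : ℝ) - t) + K * (((V d : ℝ) - V d') / K) := by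
              field_simp; ring
          _ ≤ ((V d' : ℝ) - t) + ((V d' : ℝ) - t) * (((V d : ℝ) - V d') / K) := by gcongr
          _ = ((V d' : ℝ) - t) * (((V d : ℝ) - V d') / K + 1) := by ring
          _ ≤ _ := by
            gcongr
            · linarith
            · exact Real.add_one_le_exp _
    simp only [choiceProd, List.map_cons, List.sum_cons]
    push_cast
    calc ((V d - t : ℕ) : ℝ) * (choiceProd V (t + 1) l : ℝ)
        ≤ ((V d' - t : ℕ) * Real.exp (((V d : ℝ) - V d') / K)) * (choiceProd V (t + 1) l' *
          Real.exp (((l.map fun d => (V d : ℝ)).sum - (l'.map fun d => (V d : ℝ)).sum) / K)) := by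
          gcongr
      _ = _ := by
        rw [show ((V d : ℝ) + (l.map fun d => (V d : ℝ)).sum -
            (V d' + (l'.map fun d => (V d : ℝ)).sum)) / K = ((V d : ℝ) - V d') / K +
            ((l.map fun d => (V d : ℝ)).sum - (l'.map fun d => (V d : ℝ)).sum) / K by ring,
          Real.exp_add]
        ring

theorem forall₂_orderedInsert_cons {k b : ℕ} (hkb : k ≤ b) {l : List ℕ}
    (hsort : (b :: l).Pairwise (· ≥ ·)) :
    List.Forall₂ (· ≤ ·) (l.orderedInsert (· ≥ ·) k) (b :: l) := by
  induction l generalizing b with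
  | nil => simpa using hkb
  | cons c l ih =>
    rw [List.pairwise_cons] at hsort
    rw [List.orderedInsert_cons]
    split_ifs with h
    · exact List.Forall₂.cons hkb (List.forall₂_refl _)
    · exact List.Forall₂.cons (hsort.1 c (by simp)) (ih (not_le.1 h).le hsort.2)

theorem forall₂_orderedInsert {k k' : ℕ} (hk : k ≤ k') {l : List ℕ}
    (hsort : l.Pairwise (· ≥ ·)) :
    List.Forall₂ (· ≤ ·) (l.orderedInsert (· ≥ ·) k) (l.orderedInsert (· ≥ ·) k') := by
  induction l with
  | nil => simpa using hk
  | cons b l ih =>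
    have hs := List.pairwise_cons.1 hsort
    simp only [List.orderedInsert_cons]
    split_ifs with h h' h'
    · exact List.Forall₂.cons hk (List.forall₂_refl _)
    · exact absurd (le_trans h hk) h'
    · exact List.Forall₂.cons h' (forall₂_orderedInsert_cons (not_le.1 h).le hsort)
    · exact List.Forall₂.cons le_rfl (ih hs.2)

/-! ### The law of the degrees of all nodes -/

section Assign

variable {V : Type} [DecidableEq V] [Fintype V]

/-- The law of the degrees of all nodes, when i.i.d. degrees with law `p` are sorted and then
assigned. -/
noncomputable def iidAssignment (p : PMF ℕ) (cap : V → ℝ) : PMF (V → ℕ) :=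
  (iidPMF p (Fintype.card V)).bind fun x =>
    assignDegrees cap ((List.ofFn x).insertionSort (· ≥ ·)) Finset.univ fun _ => 0

theorem eq_insertionSort_of_coe_eq {l ds : List ℕ} (hsort : ds.Pairwise (· ≥ ·))
    (h : (l : Multiset ℕ) = ds) : l.insertionSort (· ≥ ·) = ds :=
  List.Perm.eq_of_pairwise' (List.pairwise_insertionSort (r := (· ≥ ·)) l) hsort
    ((List.perm_insertionSort _ l).trans (Multiset.coe_eq_coe.1 h))

/-- The law of the degrees of all nodes has an explicit density with respect to the product of
the laws `p`: it is inversely proportional to the number of choices available in the course of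
the assignment. -/
theorem iidAssignment_apply (p : PMF ℕ) (cap : V → ℝ) (f : V → ℕ) (hf : ∀ u, (f u : ℝ) ≤ cap u)
    (ds : List ℕ) (hsort : ds.Pairwise (· ≥ ·)) (hds : Finset.univ.val.map f = ds) :
    iidAssignment p cap f =
      (Fintype.card V).factorial * (∏ v, p (f v)) * (choiceProd (slots cap) 0 ds : ℝ≥0∞)⁻¹ := by
  have hlen : ds.length = Fintype.card V := by
    rw [← Multiset.coe_card, ← hds, Multiset.card_map]; rfl
  -- A sample `x` contributes if and only if it is a reordering of `ds`, and then its contribution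
  -- does not depend on `x`; the number of reorderings cancels the number of orders of assignment.
  have step : ∀ x : Fin (Fintype.card V) → ℕ, iidPMF p (Fintype.card V) x *
      assignDegrees cap ((List.ofFn x).insertionSort (· ≥ ·)) Finset.univ (fun _ => 0) f =
      (if (↑(List.ofFn x) : Multiset ℕ) = ds then (1 : ℝ≥0∞) else 0) *
        ((∏ v, p (f v)) * (countFact (ds : Multiset ℕ) / choiceProd (slots cap) 0 ds)) := by
    intro x
    split_ifs with h
    · rw [eq_insertionSort_of_coe_eq hsort h, one_mul,
        assignDegrees_apply cap ds _ _ f hsort (by rw [Finset.card_univ, hlen]) (by simp)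
          (fun u _ => hf u) (by simp) hds]
      congr 2
      · rw [iidPMF_apply]
        have h2 : ((↑(List.ofFn x) : Multiset ℕ).map p).prod =
          ((Finset.univ.val.map f).map p).prod := by rw [h, hds]
        rw [Multiset.map_coe, Multiset.prod_coe, List.map_ofFn, List.prod_ofFn,
          Multiset.map_map] at h2
        exact h2
      · simp
    · rw [zero_mul, (PMF.apply_eq_zero_iff (assignDegrees _ _ _ _) _).2, mul_zero]
      intro hs
      have := (map_eq_of_mem_support_assignDegrees cap _ _ _ _ (by simp) hs).2
      rw [hds] at this
      exact h (by rw [this]; exact Multiset.coe_eq_coe.2 (List.perm_insertionSort _ _).symm)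
  rw [iidAssignment, PMF.bind_apply, tsum_congr step, ENNReal.tsum_mul_right,
    ← tsum_orderings_mul_countFact _ (ds : Multiset ℕ) (by simpa using hlen), div_eq_mul_inv]
  ring

/-- Degrees that have positive probability are possible values of the distribution, and they are
admitted by the nodes if the minimum `δ` is taken often enough. -/
theorem mem_support_iidAssignment (p : PMF ℕ) (cap : V → ℝ) (f : V → ℕ)
    (hf : f ∈ (iidAssignment p cap).support) {δ : ℕ} (hp : ∀ k ∈ p.support, δ ≤ k)
    (hδ : ∀ u, (δ : ℝ) ≤ cap u)
    (hslack : ∀ d ∈ p.support, d ≠ δ → (Finset.univ.filter fun v => f v ≠ δ).card ≤ slots cap d) :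
    ∀ u, f u ∈ p.support ∧ (f u : ℝ) ≤ cap u := by
  rw [iidAssignment, PMF.mem_support_bind_iff] at hf
  obtain ⟨x, hx, hf⟩ := hf
  have hmap := (map_eq_of_mem_support_assignDegrees cap _ _ _ _ (by simp) hf).2
  rw [PMF.mem_support_iff, iidPMF_apply, Finset.prod_ne_zero_iff] at hx
  have hperm : Finset.univ.val.map f = (↑(List.ofFn x) : Multiset ℕ) := by
    rw [hmap]; exact Multiset.coe_eq_coe.2 (List.perm_insertionSort _ _)
  have hmem : ∀ k, k ∈ List.ofFn x → k ∈ p.support := by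
    intro k hk
    rw [List.mem_ofFn] at hk
    obtain ⟨i, rfl⟩ := hk
    exact hx i (Finset.mem_univ _)
  have hcount : ((List.ofFn x).insertionSort (· ≥ ·)).countP (· ≠ δ) =
      (Finset.univ.filter fun v => f v ≠ δ).card := by
    rw [← Multiset.coe_countP, ← hmap, Multiset.countP_map]
    rfl
  have hcap := le_cap_of_mem_support_assignDegrees cap δ hδ _ Finset.univ _ f
    (List.pairwise_insertionSort (r := (· ≥ ·)) _)
    (fun d hd => hp d (hmem d (by simpa using hd))) (by simp) (fun d hd hdδ => by
      rw [hcount]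
      simpa using hslack d (hmem d (by simpa using hd)) hdδ) hf
  refine fun u => ⟨hmem _ ?_, hcap u (Finset.mem_univ _)⟩
  have : f u ∈ Finset.univ.val.map f := Multiset.mem_map_of_mem f (Finset.mem_univ_val u)
  rwa [hperm, Multiset.mem_coe] at this

end Assign

/-! ### Comparison of laws on an interval -/

open Classical in
theorem tsum_indicator_ofReal {I : Finset ℕ} {w : ℕ → ℝ} (hw : ∀ k ∈ I, 0 ≤ w k)
    {q : ℕ → ℝ≥0∞} (hq : ∀ k, q k = if k ∈ I then ENNReal.ofReal (w k) else 0) (A : Set ℕ) :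
    ∑' k, A.indicator q k = ENNReal.ofReal (∑ k ∈ I with k ∈ A, w k) := by
  rw [tsum_eq_sum (s := I.filter (· ∈ A)), ENNReal.ofReal_sum_of_nonneg
    fun k hk => hw k (Finset.mem_filter.1 hk).1]
  · refine Finset.sum_congr rfl fun k hk => ?_
    rw [Finset.mem_filter] at hk
    rw [Set.indicator_of_mem hk.2, hq, if_pos hk.1]
  · intro k hk
    rw [Finset.mem_filter, not_and] at hk
    by_cases hA : k ∈ A
    · rw [Set.indicator_of_mem hA, hq, if_neg fun h => hk h hA]
    · rw [Set.indicator_of_notMem hA]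

theorem tsum_ofReal {I : Finset ℕ} {w : ℕ → ℝ} (hw : ∀ k ∈ I, 0 ≤ w k)
    {q : ℕ → ℝ≥0∞} (hq : ∀ k, q k = if k ∈ I then ENNReal.ofReal (w k) else 0) :
    ∑' k, q k = ENNReal.ofReal (∑ k ∈ I, w k) := by
  classical
  simpa using tsum_indicator_ofReal hw hq Set.univ

open Classical in
/-- The constant `T` is necessarily the sum of the weights `v`, as `p` has total mass `1`. -/
theorem toOuterMeasure_eq_ofReal_div {I : Finset ℕ} {v : ℕ → ℝ} {T : ℝ} (hv : ∀ k ∈ I, 0 ≤ v k)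
    (hT : 0 < T) {p : PMF ℕ} (hp : ∀ k, p k = if k ∈ I then ENNReal.ofReal (v k / T) else 0)
    (A : Set ℕ) :
    0 < ∑ k ∈ I, v k ∧
      p.toOuterMeasure A = ENNReal.ofReal ((∑ k ∈ I with k ∈ A, v k) / ∑ k ∈ I, v k) := by
  have h0 : ∀ k ∈ I, 0 ≤ v k / T := fun k hk => div_nonneg (hv k hk) hT.le
  have hTv : ∑ k ∈ I, v k = T := by
    have h1 := tsum_ofReal h0 hp
    rw [p.tsum_coe, ← Finset.sum_div, eq_comm, ENNReal.ofReal_eq_one, div_eq_one_iff_eq hT.ne']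
      at h1
    exact h1
  rw [hTv]
  refine ⟨hT, ?_⟩
  rw [PMF.toOuterMeasure_apply, tsum_indicator_ofReal h0 hp, Finset.sum_div]

open Classical in
/-- Weights that are larger relative to `v` at larger numbers have a stochastically larger
normalisation. -/
theorem sum_mul_sum_le_of_monotoneOn {I : Finset ℕ} {v r : ℕ → ℝ} (hv : ∀ k ∈ I, 0 ≤ v k)
    (hr : MonotoneOn r I) {A : Set ℕ} (hA : IsUpperSet A) :
    (∑ k ∈ I with k ∈ A, v k) * ∑ k ∈ I, v k * r k ≤
      (∑ k ∈ I with k ∈ A, v k * r k) * ∑ k ∈ I, v k := by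
  rw [← Finset.sum_filter_add_sum_filter_not I (· ∈ A) fun k => v k * r k,
    ← Finset.sum_filter_add_sum_filter_not I (· ∈ A) v, mul_add, mul_add]
  refine add_le_add (mul_comm _ _).le ?_
  rw [Finset.sum_mul_sum, Finset.sum_mul_sum]
  -- Each `a` in the upper set `A` exceeds each `b` outside of it, so `r b ≤ r a`.
  refine Finset.sum_le_sum fun a ha => Finset.sum_le_sum fun b hb => ?_
  rw [Finset.mem_filter] at ha hb
  have hba : b ≤ a := by
    by_contra h
    exact hb.2 (hA (not_le.1 h).le ha.2)
  have h1 := hr hb.1 ha.1 hba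
  have h2 := mul_nonneg (hv a ha.1) (hv b hb.1)
  nlinarith

open Classical in
/-- If the ratio of the weights `v k * r k` to the weights `v k` grows at most by the factor
`exp (ε q)`, where `q` is at most the relative weight of the minimum `δ`, then the growth is
made up for by reducing the weight of `δ` by the factor `1 - ε`. -/
theorem sum_mul_sum_le_of_le_exp {δ Δ : ℕ} {v r : ℕ → ℝ} {ε q : ℝ} (hδ : δ ≤ Δ)
    (hv : ∀ k ∈ Finset.Icc δ Δ, 0 < v k)
    (hr : MonotoneOn r (Finset.Icc δ Δ : Finset ℕ)) (hr0 : 0 < r δ) (hε : 0 ≤ ε)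
    (hq : q * ∑ k ∈ Finset.Icc δ Δ, v k ≤ v δ) (hexp : r Δ ≤ r δ * Real.exp (ε * q))
    {A : Set ℕ} (hA : IsUpperSet A) :
    (∑ k ∈ Finset.Icc δ Δ with k ∈ A, v k * r k) *
        ∑ k ∈ Finset.Icc δ Δ, (1 - if k = δ then ε else 0) * v k ≤
      (∑ k ∈ Finset.Icc δ Δ with k ∈ A, (1 - if k = δ then ε else 0) * v k) *
        ∑ k ∈ Finset.Icc δ Δ, v k * r k := by
  have hδmem : δ ∈ Finset.Icc δ Δ := Finset.mem_Icc.2 ⟨le_rfl, hδ⟩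
  have hΔmem : Δ ∈ Finset.Icc δ Δ := Finset.mem_Icc.2 ⟨hδ, le_rfl⟩
  by_cases hδA : δ ∈ A
  · have : (Finset.Icc δ Δ).filter (· ∈ A) = Finset.Icc δ Δ :=
      Finset.filter_true_of_mem fun k hk => hA (Finset.mem_Icc.1 hk).1 hδA
    rw [this, mul_comm]
  rw [← Finset.sum_filter_add_sum_filter_not (Finset.Icc δ Δ) (· ∈ A) fun k => v k * r k,
    ← Finset.sum_filter_add_sum_filter_not (Finset.Icc δ Δ) (· ∈ A)
      fun k => (1 - if k = δ then ε else 0) * v k, mul_add, mul_add]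
  refine add_le_add (mul_comm _ _).le ?_
  have e1 : ∑ k ∈ Finset.Icc δ Δ with k ∈ A, (1 - if k = δ then ε else 0) * v k =
      ∑ k ∈ Finset.Icc δ Δ with k ∈ A, v k := by
    refine Finset.sum_congr rfl fun k hk => ?_
    rw [if_neg (fun h : k = δ => hδA (h ▸ (Finset.mem_filter.1 hk).2)), sub_zero, one_mul]
  have hδf : δ ∈ (Finset.Icc δ Δ).filter (· ∉ A) := Finset.mem_filter.2 ⟨hδmem, hδA⟩
  set b := ∑ k ∈ Finset.Icc δ Δ with k ∉ A, v k with hb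
  have e2 : ∑ k ∈ Finset.Icc δ Δ with k ∉ A, (1 - if k = δ then ε else 0) * v k =
      b - ε * v δ := by
    simp only [sub_mul, one_mul, ite_mul, zero_mul, Finset.sum_sub_distrib]
    rw [Finset.sum_ite_eq', if_pos hδf]
  have hvδ := hv δ hδmem
  have hbpos : 0 < b := lt_of_lt_of_le hvδ
    (Finset.single_le_sum (f := v) (fun k hk => (hv k (Finset.mem_filter.1 hk).1).le) hδf)
  have hbW : b ≤ ∑ k ∈ Finset.Icc δ Δ, v k :=
    Finset.sum_le_sum_of_subset_of_nonneg (Finset.filter_subset _ _) fun k hk _ => (hv k hk).le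
  have hA0 : 0 ≤ ∑ k ∈ Finset.Icc δ Δ with k ∈ A, v k :=
    Finset.sum_nonneg fun k hk => (hv k (Finset.mem_filter.1 hk).1).le
  have h1 : ∑ k ∈ Finset.Icc δ Δ with k ∈ A, v k * r k ≤
      (∑ k ∈ Finset.Icc δ Δ with k ∈ A, v k) * r Δ := by
    rw [Finset.sum_mul]
    refine Finset.sum_le_sum fun k hk => ?_
    have hk := (Finset.mem_filter.1 hk).1
    exact mul_le_mul_of_nonneg_left (hr hk hΔmem (Finset.mem_Icc.1 hk).2) (hv k hk).le
  have h2 : b * r δ ≤ ∑ k ∈ Finset.Icc δ Δ with k ∉ A, v k * r k := by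
    rw [hb, Finset.sum_mul]
    refine Finset.sum_le_sum fun k hk => ?_
    have hk := (Finset.mem_filter.1 hk).1
    exact mul_le_mul_of_nonneg_left (hr hδmem hk (Finset.mem_Icc.1 hk).1) (hv k hk).le
  have hrΔ : 0 < r Δ := hr0.trans_le (hr hδmem hΔmem hδ)
  have hqb : q * b ≤ v δ := by
    rcases le_or_gt q 0 with h | h
    · exact (mul_nonpos_of_nonpos_of_nonneg h hbpos.le).trans hvδ.le
    · exact (mul_le_mul_of_nonneg_left hbW h.le).trans hq
  have h3 : r Δ * (b - ε * v δ) ≤ b * r δ := by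
    have h4 : b - ε * v δ ≤ b * Real.exp (-(ε * q)) := by
      have := Real.add_one_le_exp (-(ε * q))
      have h5 := mul_le_mul_of_nonneg_left hqb hε
      nlinarith
    calc r Δ * (b - ε * v δ) ≤ r Δ * (b * Real.exp (-(ε * q))) := by gcongr
      _ ≤ (r δ * Real.exp (ε * q)) * (b * Real.exp (-(ε * q))) := by gcongr
      _ = b * r δ * (Real.exp (ε * q) * Real.exp (-(ε * q))) := by ring
      _ = b * r δ := by rw [← Real.exp_add, add_neg_cancel, Real.exp_zero, mul_one]
  rw [e1, e2]
  rcases le_or_gt (b - ε * v δ) 0 with hneg | hpos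
  · refine le_trans (mul_nonpos_of_nonneg_of_nonpos ?_ hneg) (mul_nonneg hA0 ?_)
    · refine Finset.sum_nonneg fun k hk => ?_
      have hk := (Finset.mem_filter.1 hk).1
      exact mul_nonneg (hv k hk).le (hr0.le.trans (hr hδmem hk (Finset.mem_Icc.1 hk).1))
    · exact (mul_nonneg hbpos.le hr0.le).trans h2
  · calc _ ≤ ((∑ k ∈ Finset.Icc δ Δ with k ∈ A, v k) * r Δ) * (b - ε * v δ) := by gcongr
      _ = (∑ k ∈ Finset.Icc δ Δ with k ∈ A, v k) * (r Δ * (b - ε * v δ)) := by ring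
      _ ≤ (∑ k ∈ Finset.Icc δ Δ with k ∈ A, v k) * (b * r δ) := by gcongr
      _ ≤ _ := by gcongr

theorem tpl_apply {γ : ℝ} {δ Δ : ℕ} (h0 : 0 < δ) (h : δ ≤ Δ) (k : ℕ) :
    tpl γ δ Δ k = if k ∈ Finset.Icc δ Δ then
      ENNReal.ofReal (powInt γ k (k + 1) / powInt γ δ (Δ + 1)) else 0 := by
  rw [tpl, dif_pos ⟨h0, h⟩, PMF.ofFinset_apply, tplProb]
  split_ifs <;> simp

theorem perturbedTPL_apply {γ : ℝ} {δ Δ : ℕ} {ε : ℝ} (h0 : 0 < δ) (h : δ ≤ Δ) (hε0 : 0 ≤ ε)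
    (hε1 : ε < 1) (k : ℕ) :
    perturbedTPL γ δ Δ ε k = if k ∈ Finset.Icc δ Δ then
      ENNReal.ofReal (((1 - if k = δ then ε else 0) * powInt γ k (k + 1)) /
        ((1 - ε) * powInt γ δ (δ + 1) + powInt γ (δ + 1) (Δ + 1))) else 0 := by
  rw [perturbedTPL, dif_pos ⟨⟨h0, h⟩, hε0, hε1⟩, PMF.ofFinset_apply, perturbedProb]
  split_ifs <;> simp

theorem powInt_nat_pos (γ : ℝ) {k : ℕ} (hk : 0 < k) : 0 < powInt γ k (k + 1) :=
  powInt_pos γ (by exact_mod_cast hk) (lt_add_one _)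

theorem powInt_total_pos (γ : ℝ) {δ Δ : ℕ} (h0 : 0 < δ) (h : δ ≤ Δ) :
    0 < powInt γ δ (Δ + 1) :=
  powInt_pos γ (by exact_mod_cast h0) (by exact_mod_cast Nat.lt_succ_of_le h)

theorem perturbed_total_pos (γ : ℝ) {δ Δ : ℕ} {ε : ℝ} (h0 : 0 < δ) (h : δ ≤ Δ) (hε : ε < 1) :
    0 < (1 - ε) * powInt γ δ (δ + 1) + powInt γ (δ + 1) (Δ + 1) := by
  refine add_pos_of_pos_of_nonneg (mul_pos (by linarith) (powInt_nat_pos γ h0)) ?_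
  have hle : ((δ : ℝ) + 1) ≤ Δ + 1 := by
    have : (δ : ℝ) ≤ Δ := by exact_mod_cast h
    linarith
  rcases hle.eq_or_lt with he | hl
  · rw [he]; simp [powInt]
  · exact (powInt_pos γ (by positivity) hl).le

theorem support_tpl {γ : ℝ} {δ Δ : ℕ} (h0 : 0 < δ) (h : δ ≤ Δ) (k : ℕ) :
    k ∈ (tpl γ δ Δ).support ↔ δ ≤ k ∧ k ≤ Δ := by
  rw [PMF.mem_support_iff, tpl_apply h0 h, ← Finset.mem_Icc]
  split_ifs with hk
  · have hk0 : 0 < k := h0.trans_le (Finset.mem_Icc.1 hk).1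
    simp [hk, div_pos (powInt_nat_pos γ hk0) (powInt_total_pos γ h0 h)]
  · simp [hk]

/-- The law with weights proportional to `powInt γ k (k + 1) * r k`, where `r` is increasing, is
stochastically bounded from below by the truncated power law. -/
theorem tpl_mul_tsum_le {γ : ℝ} {δ Δ : ℕ} (h0 : 0 < δ) (h : δ ≤ Δ) {c : ℝ} (hc : 0 ≤ c)
    {r : ℕ → ℝ} (hr : MonotoneOn r (Finset.Icc δ Δ : Finset ℕ)) (hr0 : 0 < r δ)
    {q : ℕ → ℝ≥0∞} (hq : ∀ k, q k = if k ∈ Finset.Icc δ Δ then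
      ENNReal.ofReal (c * (powInt γ k (k + 1) * r k)) else 0)
    {A : Set ℕ} (hA : IsUpperSet A) :
    (tpl γ δ Δ).toOuterMeasure A * ∑' k, q k ≤ ∑' k, A.indicator q k := by
  classical
  have hpos : ∀ k ∈ Finset.Icc δ Δ, 0 < powInt γ k (k + 1) := fun k hk =>
    powInt_nat_pos γ (h0.trans_le (Finset.mem_Icc.1 hk).1)
  have hw : ∀ k ∈ Finset.Icc δ Δ, 0 ≤ c * (powInt γ k (k + 1) * r k) := fun k hk =>
    mul_nonneg hc (mul_nonneg (hpos k hk).le (hr0.le.trans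
      (hr (Finset.mem_Icc.2 ⟨le_rfl, h⟩) hk (Finset.mem_Icc.1 hk).1)))
  obtain ⟨hT, hp⟩ := toOuterMeasure_eq_ofReal_div (fun k hk => (hpos k hk).le)
    (powInt_total_pos γ h0 h) (tpl_apply h0 h) A
  rw [hp, tsum_ofReal hw hq, tsum_indicator_ofReal hw hq, ← ENNReal.ofReal_mul (div_nonneg
    (Finset.sum_nonneg fun k hk => (hpos k (Finset.mem_filter.1 hk).1).le) hT.le)]
  refine ENNReal.ofReal_le_ofReal ?_
  rw [div_mul_eq_mul_div, div_le_iff₀ hT, ← Finset.mul_sum, ← Finset.mul_sum, mul_left_comm,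
    mul_assoc]
  exact mul_le_mul_of_nonneg_left (sum_mul_sum_le_of_monotoneOn (fun k hk => (hpos k hk).le) hr hA)
    hc

/-- The law with weights proportional to `powInt γ k (k + 1) * r k`, where `r` is increasing, but
only slightly, is stochastically bounded from above by the perturbed truncated power law. -/
theorem tsum_le_perturbedTPL_mul {γ : ℝ} {δ Δ : ℕ} (h0 : 0 < δ) (h : δ ≤ Δ) {c : ℝ} (hc : 0 ≤ c)
    {r : ℕ → ℝ} (hr : MonotoneOn r (Finset.Icc δ Δ : Finset ℕ)) (hr0 : 0 < r δ)
    {q : ℕ → ℝ≥0∞} (hq : ∀ k, q k = if k ∈ Finset.Icc δ Δ then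
      ENNReal.ofReal (c * (powInt γ k (k + 1) * r k)) else 0)
    {ε p₀ : ℝ} (hε0 : 0 ≤ ε) (hε1 : ε < 1)
    (hp₀ : p₀ * powInt γ δ (Δ + 1) ≤ powInt γ δ (δ + 1))
    (hexp : r Δ ≤ r δ * Real.exp (ε * p₀))
    {A : Set ℕ} (hA : IsUpperSet A) :
    ∑' k, A.indicator q k ≤ (perturbedTPL γ δ Δ ε).toOuterMeasure A * ∑' k, q k := by
  classical
  have hpos : ∀ k ∈ Finset.Icc δ Δ, 0 < powInt γ k (k + 1) := fun k hk =>
    powInt_nat_pos γ (h0.trans_le (Finset.mem_Icc.1 hk).1)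
  have hw : ∀ k ∈ Finset.Icc δ Δ, 0 ≤ c * (powInt γ k (k + 1) * r k) := fun k hk =>
    mul_nonneg hc (mul_nonneg (hpos k hk).le (hr0.le.trans
      (hr (Finset.mem_Icc.2 ⟨le_rfl, h⟩) hk (Finset.mem_Icc.1 hk).1)))
  have hv : ∀ k ∈ Finset.Icc δ Δ, 0 ≤ (1 - if k = δ then ε else 0) * powInt γ k (k + 1) :=
    fun k hk => mul_nonneg (by split_ifs <;> linarith) (hpos k hk).le
  obtain ⟨hT, hp⟩ := toOuterMeasure_eq_ofReal_div hv
    (perturbed_total_pos γ h0 h hε1) (perturbedTPL_apply h0 h hε0 hε1) A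
  rw [hp, tsum_ofReal hw hq, tsum_indicator_ofReal hw hq, ← ENNReal.ofReal_mul (div_nonneg
    (Finset.sum_nonneg fun k hk => hv k (Finset.mem_filter.1 hk).1) hT.le)]
  refine ENNReal.ofReal_le_ofReal ?_
  rw [div_mul_eq_mul_div, le_div_iff₀ hT, ← Finset.mul_sum, ← Finset.mul_sum, mul_left_comm,
    mul_assoc]
  exact mul_le_mul_of_nonneg_left (sum_mul_sum_le_of_le_exp h hpos hr hr0 hε0
    (by rwa [powInt_sum γ h0 h]) hexp hA) hc

/-! ### The degree of a single node, given all the others -/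

section SingleNode

variable {V : Type} [DecidableEq V] [Fintype V]

theorem map_update_univ (f : V → ℕ) (u : V) (k : ℕ) :
    Finset.univ.val.map (Function.update f u k) = k ::ₘ (Finset.univ.erase u).val.map f := by
  rw [← Multiset.cons_erase (Finset.mem_univ_val u), Multiset.map_cons, Function.update_self,
    ← Finset.erase_val]
  congr 1
  exact Multiset.map_congr rfl fun v hv =>
    Function.update_of_ne (Finset.ne_of_mem_erase (Finset.mem_def.2 hv)) _ _

/-- Given the degrees of all other nodes, the law of the degree of the node `u` has weights
proportional to `powInt γ k (k + 1) * r k`, where `r` is increasing, and grows only slightly if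
almost all nodes admit the maximum `Δ` admitted by `u`. The slack `hK` says that the minimum `δ` is
taken by so many of the other nodes that at least `K` choices are left whenever a degree above `δ`
is assigned. -/
theorem exists_weights_iidAssignment_update {γ : ℝ} {δ M : ℕ} (hδ : 0 < δ) (hM : δ ≤ M)
    {cap : V → ℝ} (hcap : ∀ v, (δ : ℝ) ≤ cap v) (f : V → ℕ) (u : V) {K : ℝ} (hK0 : 0 < K)
    (hK : ∀ d, d ≤ M →
      ((Finset.univ.filter fun v => v = u ∨ f v ≠ δ).card : ℝ) + K ≤ slots cap d)
    {Δ : ℕ} (hΔ : ∀ k : ℕ, k ≤ Δ ↔ k ≤ M ∧ (k : ℝ) ≤ cap u) :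
    ∃ (c : ℝ) (r : ℕ → ℝ), 0 ≤ c ∧ MonotoneOn r (Finset.Icc δ Δ : Finset ℕ) ∧ 0 < r δ ∧
      r Δ ≤ r δ * Real.exp (((Fintype.card V : ℝ) - slots cap Δ) / K) ∧
      ∀ k, iidAssignment (tpl γ δ M) cap (Function.update f u k) =
        if k ∈ Finset.Icc δ Δ then ENNReal.ofReal (c * (powInt γ k (k + 1) * r k)) else 0 := by
  have hδΔ : δ ≤ Δ := (hΔ δ).2 ⟨hM, hcap u⟩
  have hslotsδ : slots cap δ = Fintype.card V := by
    rw [slots, Finset.filter_true_of_mem (fun v _ => hcap v), Finset.card_univ]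
  have hcount : ∀ k, (Finset.univ.filter fun v => Function.update f u k v ≠ δ).card ≤
      (Finset.univ.filter fun v => v = u ∨ f v ≠ δ).card := fun k =>
    Finset.card_le_card fun v hv => by
      simp only [Finset.mem_filter, Finset.mem_univ, true_and] at hv ⊢
      by_cases h : v = u
      · exact Or.inl h
      · rw [Function.update_of_ne h] at hv
        exact Or.inr hv
  have hzero : ∀ k, iidAssignment (tpl γ δ M) cap (Function.update f u k) ≠ 0 →
      ∀ v, (δ ≤ Function.update f u k v ∧ Function.update f u k v ≤ M) ∧
        (Function.update f u k v : ℝ) ≤ cap v := by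
    intro k hk v
    rw [← support_tpl hδ hM (γ := γ)]
    refine mem_support_iidAssignment (tpl γ δ M) cap _ hk
      (fun j hj => ((support_tpl hδ hM _).1 hj).1) hcap (fun d hd _ => ?_) v
    refine (hcount k).trans ?_
    have := hK d ((support_tpl hδ hM _).1 hd).2
    have h2 : ((Finset.univ.filter fun v => v = u ∨ f v ≠ δ).card : ℝ) ≤ slots cap d := by linarith
    exact_mod_cast h2
  -- If the degree of some other node is impossible, then all the masses vanish.
  by_cases hval : ∀ v, v ≠ u → (δ ≤ f v ∧ f v ≤ M) ∧ (f v : ℝ) ≤ cap v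
  swap
  · refine ⟨0, fun _ => 1, le_rfl, fun _ _ _ _ _ => le_rfl, one_pos, ?_, fun k => ?_⟩
    · rw [one_mul]
      refine Real.one_le_exp (div_nonneg (sub_nonneg.2 ?_) hK0.le)
      rw [← hslotsδ]
      exact_mod_cast slots_antitone cap hδΔ
    · rw [zero_mul, ENNReal.ofReal_zero, ite_self]
      by_contra h
      refine hval fun v hv => ?_
      have := hzero k h v
      rwa [Function.update_of_ne hv] at this
  -- The sorted degrees are those of the other nodes with `k` inserted.
  set L : List ℕ := ((Finset.univ.erase u).val.map f).toList.insertionSort (· ≥ ·) with hL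
  have hLsort : L.Pairwise (· ≥ ·) := List.pairwise_insertionSort (r := (· ≥ ·)) _
  have hLcoe : (L : Multiset ℕ) = (Finset.univ.erase u).val.map f := by
    rw [← Multiset.coe_toList ((Finset.univ.erase u).val.map f)]
    exact Multiset.coe_eq_coe.2 (List.perm_insertionSort _ _)
  set ds : ℕ → List ℕ := fun k => L.orderedInsert (· ≥ ·) k with hds
  have hdsort : ∀ k, (ds k).Pairwise (· ≥ ·) := fun k => hLsort.orderedInsert k L
  have hperm : ∀ k, (ds k).Perm (k :: L) := fun k => List.perm_orderedInsert _ _ _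
  have hdcoe : ∀ k, Finset.univ.val.map (Function.update f u k) = ds k := fun k => by
    rw [map_update_univ, ← hLcoe, Multiset.cons_coe]
    exact Multiset.coe_eq_coe.2 (hperm k).symm
  have hmem : ∀ k d, d ∈ ds k → d = k ∨ (δ ≤ d ∧ d ≤ M) := by
    intro k d hd
    rw [(hperm k).mem_iff, List.mem_cons] at hd
    refine hd.imp id fun h => ?_
    rw [← Multiset.mem_coe, hLcoe, Multiset.mem_map] at h
    obtain ⟨v, hv, rfl⟩ := h
    exact (hval v (Finset.ne_of_mem_erase (Finset.mem_def.2 hv))).1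
  have hlen : ∀ k, (ds k).length = Fintype.card V := fun k => by
    rw [← Multiset.coe_card, ← hdcoe, Multiset.card_map]; rfl
  have hcountP : ∀ k, (ds k).countP (· ≠ δ) ≤
      (Finset.univ.filter fun v => v = u ∨ f v ≠ δ).card := fun k => by
    rw [← Multiset.coe_countP, ← hdcoe, Multiset.countP_map]
    exact hcount k
  have hmin : ∀ k, δ ≤ k → ∀ d ∈ ds k, δ ≤ d := fun k hk d hd => by
    rcases hmem k d hd with rfl | h
    · exact hk
    · exact h.1
  have hmax : ∀ k, k ≤ Δ → ∀ d ∈ ds k, d ≤ M := fun k hk d hd => by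
    rcases hmem k d hd with rfl | h
    · exact ((hΔ d).1 hk).1
    · exact h.2
  have hslack : ∀ k, k ≤ Δ → ∀ d ∈ ds k, d ≠ δ →
      ((0 + (ds k).countP (· ≠ δ) : ℕ) : ℝ) + K ≤ slots cap d := by
    intro k hk d hd _
    have h1 := hK d (hmax k hk d hd)
    have h2 : ((ds k).countP (· ≠ δ) : ℝ) ≤
      (Finset.univ.filter fun v => v = u ∨ f v ≠ δ).card := by exact_mod_cast hcountP k
    push_cast
    linarith
  have hDpos : ∀ k ∈ Finset.Icc δ Δ, 0 < choiceProd (slots cap) 0 (ds k) := by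
    intro k hk
    rw [Finset.mem_Icc] at hk
    refine choiceProd_pos (δ := δ) (hdsort k) (hmin k hk.1) 0 (by rw [hlen, hslotsδ, zero_add])
      fun d hd hdδ => ?_
    have := hslack k hk.2 d hd hdδ
    have h2 : ((0 + (ds k).countP (· ≠ δ) : ℕ) : ℝ) ≤ slots cap d := by linarith
    exact_mod_cast h2
  have hδI : δ ∈ Finset.Icc δ Δ := Finset.mem_Icc.2 ⟨le_rfl, hδΔ⟩
  have hΔI : Δ ∈ Finset.Icc δ Δ := Finset.mem_Icc.2 ⟨hδΔ, le_rfl⟩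
  refine ⟨(Fintype.card V).factorial * (∏ v ∈ Finset.univ.erase u, tpl γ δ M (f v)).toReal /
      powInt γ δ (M + 1), fun k => (choiceProd (slots cap) 0 (ds k) : ℝ)⁻¹, ?_, ?_, ?_, ?_, ?_⟩
  · exact div_nonneg (by positivity) (powInt_total_pos γ hδ hM).le
  · intro k hk k' hk' hkk'
    exact inv_anti₀ (by exact_mod_cast hDpos k' hk')
      (by exact_mod_cast choiceProd_anti (slots_antitone cap) (forall₂_orderedInsert hkk' hLsort) 0)
  · exact inv_pos.2 (by exact_mod_cast hDpos δ hδI)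
  · have h1 := choiceProd_le_mul_exp (slots_antitone cap) hK0
      (forall₂_orderedInsert hδΔ hLsort) (hdsort Δ) (hmin δ le_rfl) 0 (hslack Δ le_rfl)
    -- The two lists differ, as multisets, in one entry only, so the exponent telescopes.
    have hsum : ∀ k, ((ds k).map fun d => (slots cap d : ℝ)).sum =
        slots cap k + (L.map fun d => (slots cap d : ℝ)).sum := fun k => by
      rw [((hperm k).map _).sum_eq, List.map_cons, List.sum_cons]
    have h2 := hsum δ
    have h3 := hsum Δ
    simp only [hds] at h2 h3
    rw [h2, h3, add_sub_add_right_eq_sub, hslotsδ] at h1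
    have p1 : (0 : ℝ) < choiceProd (slots cap) 0 (ds δ) := by exact_mod_cast hDpos δ hδI
    have p2 : (0 : ℝ) < choiceProd (slots cap) 0 (ds Δ) := by exact_mod_cast hDpos Δ hΔI
    simp only
    rw [inv_mul_eq_div, inv_eq_one_div, div_le_div_iff₀ p2 p1, one_mul, mul_comm]
    exact h1
  · intro k
    split_ifs with hk
    · have hk' := Finset.mem_Icc.1 hk
      rw [iidAssignment_apply (tpl γ δ M) cap _ (fun v => ?_) (ds k) (hdsort k) (hdcoe k)]
      · rw [← Finset.mul_prod_erase _ _ (Finset.mem_univ u), Function.update_self,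
          Finset.prod_congr rfl (fun v hv => by
            rw [Function.update_of_ne (Finset.ne_of_mem_erase hv)] :
            ∀ v ∈ Finset.univ.erase u, tpl γ δ M (Function.update f u k v) = tpl γ δ M (f v)),
          tpl_apply hδ hM k, if_pos (Finset.mem_Icc.2 ⟨hk'.1, ((hΔ k).1 hk'.2).1⟩)]
        have hfin : (∏ v ∈ Finset.univ.erase u, tpl γ δ M (f v)) ≠ ⊤ :=
          ENNReal.prod_ne_top fun v _ => PMF.apply_ne_top _ _
        have hk0 : 0 < k := hδ.trans_le hk'.1
        have hT := powInt_total_pos γ hδ hM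
        have hw := powInt_nat_pos γ hk0
        have hD : (0 : ℝ) < choiceProd (slots cap) 0 (ds k) := by exact_mod_cast hDpos k hk
        rw [← ENNReal.ofReal_natCast, ← ENNReal.ofReal_natCast, ← ENNReal.ofReal_inv_of_pos hD,
          ← ENNReal.ofReal_toReal hfin, ← ENNReal.ofReal_mul (by positivity),
          ← ENNReal.ofReal_mul (by positivity), ← ENNReal.ofReal_mul (by positivity)]
        rw [ENNReal.toReal_ofReal ENNReal.toReal_nonneg]
        congr 1
        field_simp
      · by_cases hv : v = u
        · subst hv
          rw [Function.update_self]
          exact ((hΔ k).1 hk'.2).2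
        · rw [Function.update_of_ne hv]
          exact (hval v hv).2
    · by_contra h
      have := hzero k h u
      rw [Function.update_self] at this
      exact hk (Finset.mem_Icc.2 ⟨this.1.1, (hΔ k).2 ⟨this.1.2, this.2⟩⟩)

end SingleNode

/-! ### The degrees in one community, given all other degrees -/

section Community

variable {C : List ℕ} (j : Fin C.length)

/-- The degrees of all nodes, split into those in the community `j` (as `commDegrees j` lists them)
and the others. -/
def splitCommunity : (Node C → ℕ) ≃ (Fin (C.get j) → ℕ) × ({v : Node C // v.1 ≠ j} → ℕ) where
  toFun f := (commDegrees j f, fun v => f v)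
  invFun w v := if h : v.1 = j then w.1 (h ▸ v.2) else w.2 ⟨v, h⟩
  left_inv f := by
    funext v
    obtain ⟨i, a⟩ := v
    by_cases h : i = j
    · subst h; simp [commDegrees]
    · simp [h]
  right_inv w := by
    obtain ⟨x, y⟩ := w
    refine Prod.ext ?_ ?_
    · funext i; simp [commDegrees]
    · funext v; simp [v.2]

theorem commDegrees_splitCommunity_symm (x : Fin (C.get j) → ℕ)
    (y : {v : Node C // v.1 ≠ j} → ℕ) : commDegrees j ((splitCommunity j).symm (x, y)) = x :=
  congrArg Prod.fst ((splitCommunity j).apply_symm_apply (x, y))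

theorem splitCommunity_symm_update (x : Fin (C.get j) → ℕ) (y : {v : Node C // v.1 ≠ j} → ℕ)
    (i : Fin (C.get j)) (k : ℕ) :
    (splitCommunity j).symm (Function.update x i k, y) =
      Function.update ((splitCommunity j).symm (x, y)) ⟨j, i⟩ k := by
  rw [Equiv.symm_apply_eq]
  refine Prod.ext ?_ ?_
  · funext a
    have := congrFun (commDegrees_splitCommunity_symm j x y) a
    simp only [splitCommunity, Equiv.coe_fn_mk, commDegrees] at this ⊢
    by_cases h : a = i
    · subst h; simp
    · have h' : (⟨j, a⟩ : Node C) ≠ ⟨j, i⟩ := fun e => h (by simpa using e)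
      rw [Function.update_of_ne h, Function.update_of_ne h']
      exact this.symm
  · funext v
    have h' : (v : Node C) ≠ ⟨j, i⟩ := fun e => v.2 (by rw [e])
    have := congrFun (congrArg Prod.snd ((splitCommunity j).apply_symm_apply (x, y))) v
    simp only [splitCommunity, Equiv.coe_fn_mk] at this ⊢
    rw [Function.update_of_ne h']
    exact this.symm

/-- Comparison of the degrees in the community `j`, conditionally on `E`, with an i.i.d. sequence,
where `R` is `≤` or `≥`. It is essential that `E` does not depend on the degrees in the
community. -/
theorem iidPMF_comparison_commDegrees {R : ℝ≥0∞ → ℝ≥0∞ → Prop} (hrefl : ∀ a, R a a)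
    (htrans : ∀ a b c, R a b → R b c → R a c) (hmul : ∀ a b c, R a b → R (c * a) (c * b))
    (hsum : ∀ (ι : Type) (f g : ι → ℝ≥0∞), (∀ i, R (f i) (g i)) → R (∑' i, f i) (∑' i, g i))
    (p : PMF ℕ) (μ : PMF (Node C → ℕ)) (E : Set (Node C → ℕ)) (hE : ∃ f ∈ E, f ∈ μ.support)
    (hEu : ∀ (f : Node C → ℕ) (i : Fin (C.get j)) (k : ℕ),
      Function.update f ⟨j, i⟩ k ∈ E ↔ f ∈ E)
    (hμ : ∀ f ∈ E, ∀ (i : Fin (C.get j)) (A : Set ℕ), IsUpperSet A →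
      R (∑' k, A.indicator (fun k => μ (Function.update f ⟨j, i⟩ k)) k)
        (p.toOuterMeasure A * ∑' k, μ (Function.update f ⟨j, i⟩ k)))
    (U : Set (Fin (C.get j) → ℕ)) (hU : IsUpperSet U) :
    R (((μ.filter E hE).map (commDegrees j)).toOuterMeasure U)
      ((iidPMF p (C.get j)).toOuterMeasure U) := by
  set N := ∑' f, E.indicator μ f with hN
  have hN0 : N ≠ 0 := by
    obtain ⟨f, hfE, hf⟩ := hE
    intro h
    have := ENNReal.tsum_eq_zero.1 h f
    rw [Set.indicator_of_mem hfE] at this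
    exact hf this
  have hNtop : N ≠ ⊤ := PMF.tsum_coe_indicator_ne_top μ E
  -- The unnormalised law of the degrees in the community, on the event `E`.
  set m : (Fin (C.get j) → ℕ) → ℝ≥0∞ :=
    fun x => ∑' y, E.indicator μ ((splitCommunity j).symm (x, y)) with hm
  have hNm : N = ∑' x, m x := by
    rw [hN, ← (splitCommunity j).symm.tsum_eq, ENNReal.tsum_prod']
  have hUm : ((μ.filter E hE).map (commDegrees j)).toOuterMeasure U =
      N⁻¹ * ∑' x, U.indicator m x := by
    rw [PMF.toOuterMeasure_map_apply, PMF.toOuterMeasure_apply,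
      ← (splitCommunity j).symm.tsum_eq, ENNReal.tsum_prod', ← ENNReal.tsum_mul_left]
    refine tsum_congr fun x => ?_
    by_cases hx : x ∈ U
    · rw [Set.indicator_of_mem hx, hm, ← ENNReal.tsum_mul_left]
      refine tsum_congr fun y => ?_
      rw [Set.indicator_of_mem (by
        rwa [Set.mem_preimage, commDegrees_splitCommunity_symm]), PMF.filter_apply, mul_comm]
    · rw [Set.indicator_of_notMem hx, mul_zero]
      refine ENNReal.tsum_eq_zero.2 fun y => ?_
      rw [Set.indicator_of_notMem (by
        rwa [Set.mem_preimage, commDegrees_splitCommunity_symm])]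
  have key := iidPMF_comparison hrefl htrans hmul hsum p (C.get j) m (by
    intro x i A hA
    have hupd : ∀ k, m (Function.update x i k) =
        ∑' y, E.indicator μ (Function.update ((splitCommunity j).symm (x, y)) ⟨j, i⟩ k) :=
      fun k => tsum_congr fun y => by rw [splitCommunity_symm_update]
    have l : ∑' k, A.indicator (fun k => m (Function.update x i k)) k = ∑' y, ∑' k, A.indicator
        (fun k => E.indicator μ
          (Function.update ((splitCommunity j).symm (x, y)) ⟨j, i⟩ k)) k := by
      rw [ENNReal.tsum_comm]
      refine tsum_congr fun k => ?_
      by_cases hk : k ∈ A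
      · simp only [Set.indicator_of_mem hk, hupd]
      · simp only [Set.indicator_of_notMem hk, tsum_zero]
    simp only [hupd] at l ⊢
    have r : ∑' k, ∑' y, E.indicator μ
          (Function.update ((splitCommunity j).symm (x, y)) ⟨j, i⟩ k) = ∑' y, ∑' k,
        E.indicator μ (Function.update ((splitCommunity j).symm (x, y)) ⟨j, i⟩ k) :=
      ENNReal.tsum_comm
    rw [l, r, ← ENNReal.tsum_mul_left]
    refine hsum _ _ _ fun y => ?_
    by_cases hy : (splitCommunity j).symm (x, y) ∈ E
    · have : ∀ k, E.indicator μ (Function.update ((splitCommunity j).symm (x, y)) ⟨j, i⟩ k) =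
          μ (Function.update ((splitCommunity j).symm (x, y)) ⟨j, i⟩ k) := fun k =>
        Set.indicator_of_mem ((hEu _ _ _).2 hy) _
      simp only [this]
      exact hμ _ hy i A hA
    · have : ∀ k, E.indicator μ (Function.update ((splitCommunity j).symm (x, y)) ⟨j, i⟩ k) = 0 :=
        fun k => Set.indicator_of_notMem (fun h => hy ((hEu _ _ _).1 h)) _
      simp only [this, Set.indicator_zero, tsum_zero, mul_zero]
      exact hrefl 0) U hU
  rw [hUm]
  have h2 := hmul _ _ N⁻¹ key
  rwa [← hNm, mul_left_comm, ENNReal.inv_mul_cancel hN0 hNtop, mul_one] at h2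

open Classical in
/-- If the minimum `δ` is taken at least `a` times outside of the community `j`, then the degrees
in that community are sandwiched between the two i.i.d. sequences. -/
theorem stochLE_iidAssignment {γ : ℝ} {δ M : ℕ} (hδ : 0 < δ) (hM : δ ≤ M)
    {cap : Node C → ℝ} (hcap : ∀ v, (δ : ℝ) ≤ cap v) {a : ℕ} {K : ℝ} (hK0 : 0 < K)
    (hK : ∀ d, d ≤ M → (Fintype.card (Node C) : ℝ) - a + K ≤ slots cap d)
    {Δ : ℕ} (hΔ : ∀ (i : Fin (C.get j)) (k : ℕ), k ≤ Δ ↔ k ≤ M ∧ (k : ℝ) ≤ cap ⟨j, i⟩)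
    {ε p₀ : ℝ} (hε0 : 0 ≤ ε) (hε1 : ε < 1)
    (hp₀ : p₀ * powInt γ δ (Δ + 1) ≤ powInt γ δ (δ + 1))
    (hexp : ((Fintype.card (Node C) : ℝ) - slots cap Δ) / K ≤ ε * p₀)
    {E : Set (Node C → ℕ)}
    (hEdef : E = {f | a ≤ (Finset.univ.filter fun v : Node C => v.1 ≠ j ∧ f v = δ).card})
    (hE : ∃ f ∈ E, f ∈ (iidAssignment (tpl γ δ M) cap).support) :
    StochLE (iidPMF (tpl γ δ Δ) (C.get j))
        (((iidAssignment (tpl γ δ M) cap).filter E hE).map (commDegrees j)) ∧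
      StochLE (((iidAssignment (tpl γ δ M) cap).filter E hE).map (commDegrees j))
        (iidPMF (perturbedTPL γ δ Δ ε) (C.get j)) := by
  have hEu : ∀ (f : Node C → ℕ) (i : Fin (C.get j)) (k : ℕ),
      Function.update f ⟨j, i⟩ k ∈ E ↔ f ∈ E := by
    intro f i k
    have : (Finset.univ.filter fun v : Node C => v.1 ≠ j ∧ Function.update f ⟨j, i⟩ k v = δ) =
        Finset.univ.filter fun v : Node C => v.1 ≠ j ∧ f v = δ := by
      refine Finset.filter_congr fun v _ => and_congr_right fun hv => ?_
      rw [Function.update_of_ne fun e => hv (by rw [e])]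
    rw [hEdef, Set.mem_ofPred_eq, Set.mem_ofPred_eq, this]
  have hKf : ∀ f ∈ E, ∀ (i : Fin (C.get j)) (d : ℕ), d ≤ M →
      ((Finset.univ.filter fun v : Node C => v = ⟨j, i⟩ ∨ f v ≠ δ).card : ℝ) + K ≤
        slots cap d := by
    intro f hf i d hd
    refine le_trans ?_ (hK d hd)
    rw [hEdef, Set.mem_ofPred_eq] at hf
    have hdisj : Disjoint (Finset.univ.filter fun v : Node C => v = ⟨j, i⟩ ∨ f v ≠ δ)
        (Finset.univ.filter fun v : Node C => v.1 ≠ j ∧ f v = δ) := by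
      rw [Finset.disjoint_filter]
      rintro v _ (rfl | h) ⟨h1, h2⟩
      · exact h1 rfl
      · exact h h2
    have hle := Finset.card_le_univ (Finset.disjUnion _ _ hdisj)
    rw [Finset.card_disjUnion] at hle
    have h3 : ((Finset.univ.filter fun v : Node C => v = ⟨j, i⟩ ∨ f v ≠ δ).card : ℝ) + a ≤
        Fintype.card (Node C) := by exact_mod_cast (Nat.add_le_add_left hf _).trans hle
    linarith
  constructor
  · intro U hU
    refine iidPMF_comparison_commDegrees (R := (· ≥ ·)) j (fun _ => le_rfl)
      (fun _ _ _ h h' => le_trans h' h) (fun _ _ c h => mul_le_mul_right h c)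
      (fun _ _ _ h => ENNReal.tsum_le_tsum h) _ _ E hE hEu (fun f hf i A hA => ?_) U hU
    obtain ⟨c, r, hc, hr, hr0, -, hq⟩ := exists_weights_iidAssignment_update hδ hM hcap f
      ⟨j, i⟩ hK0 (hKf f hf i) (hΔ i) (γ := γ)
    exact tpl_mul_tsum_le hδ ((hΔ i δ).2 ⟨hM, hcap _⟩) hc hr hr0 hq hA
  · intro U hU
    refine iidPMF_comparison_commDegrees (R := (· ≤ ·)) j (fun _ => le_rfl) (fun _ _ _ => le_trans)
      (fun _ _ c h => mul_le_mul_right h c) (fun _ _ _ h => ENNReal.tsum_le_tsum h) _ _ E hE hEu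
      (fun f hf i A hA => ?_) U hU
    obtain ⟨c, r, hc, hr, hr0, hrexp, hq⟩ := exists_weights_iidAssignment_update hδ hM hcap f
      ⟨j, i⟩ hK0 (hKf f hf i) (hΔ i) (γ := γ)
    exact tsum_le_perturbedTPL_mul hδ ((hΔ i δ).2 ⟨hM, hcap _⟩) hc hr hr0 hq hε0 hε1 hp₀
      (hrexp.trans (by gcongr)) hA

end Community

/-! ### The parity alteration -/

/-- The parity alteration replaces one occurrence of the maximum `D`, the last one, by `D - 1`. -/
theorem exists_orderedInsert_pred_eq (D : ℕ) (l : List ℕ) (h : (D :: l).Pairwise (· ≥ ·)) :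
    ∃ l₁ l₂, D :: l = l₁ ++ D :: l₂ ∧ l.orderedInsert (· ≥ ·) (D - 1) = l₁ ++ (D - 1) :: l₂ ∧
      ∀ e ∈ l₁, e = D := by
  induction l with
  | nil => exact ⟨[], [], by simp⟩
  | cons b l ih =>
    by_cases hb : D - 1 ≥ b
    · exact ⟨[], b :: l, rfl, by rw [List.orderedInsert_cons_of_le (r := (· ≥ ·)) l hb]; rfl,
        by simp⟩
    · have hbD : b = D := by
        have : D ≥ b := (List.pairwise_cons.1 h).1 b (by simp)
        omega
      subst hbD
      obtain ⟨l₁, l₂, h1, h2, h3⟩ := ih (List.pairwise_cons.1 h).2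
      refine ⟨b :: l₁, l₂, by rw [h1]; rfl, ?_, ?_⟩
      · rw [List.orderedInsert_of_not_le (r := (· ≥ ·)) l hb, h2]; rfl
      · simpa using h3

theorem parityAdjust_eq (l : List ℕ) (h : l.Pairwise (· ≥ ·)) :
    parityAdjust l = l ∨ ∃ l₁ D l₂, l = l₁ ++ D :: l₂ ∧ parityAdjust l = l₁ ++ (D - 1) :: l₂ ∧
      (∀ e ∈ l₁, e = D) ∧ ∀ e ∈ l, e ≤ D := by
  unfold parityAdjust
  split_ifs with hl
  · exact Or.inl rfl
  · cases l with
    | nil => exact Or.inl rfl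
    | cons D ds =>
      right
      obtain ⟨l₁, l₂, h1, h2, h3⟩ := exists_orderedInsert_pred_eq D ds h
      refine ⟨l₁, D, l₂, h1, ?_, h3, ?_⟩
      · rw [← h2]
        simp only [List.insertionSort_cons]
        rw [List.Pairwise.insertionSort_eq (r := (· ≥ ·)) (List.pairwise_cons.1 h).2]
      · intro e he
        rcases List.mem_cons.1 he with rfl | he
        · exact le_rfl
        · exact (List.pairwise_cons.1 h).1 e he

/-- The averages over two nested sets of two functions with values in `[0, 1]` that agree outside
of `W`. -/
theorem abs_average_sub_average_le {V : Type} [DecidableEq V] {X Y W : Finset V} (hXY : X ⊆ Y)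
    (hX : X.Nonempty) {h h' : V → ℝ} (h0 : ∀ u, 0 ≤ h u) (h1 : ∀ u, h u ≤ 1)
    (h0' : ∀ u, 0 ≤ h' u) (h1' : ∀ u, h' u ≤ 1) (hW : ∀ u ∉ W, h u = h' u) :
    |(∑ u ∈ X, h u) / X.card - (∑ u ∈ Y, h' u) / Y.card| ≤
      ((W.card : ℝ) + (Y \ X).card) / X.card := by
  have hx : (0 : ℝ) < X.card := by exact_mod_cast hX.card_pos
  have hY : (Y.card : ℝ) = X.card + (Y \ X).card := by
    rw [← Nat.cast_add, add_comm, Finset.card_sdiff_add_card_eq_card hXY]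
  set x : ℝ := (X.card : ℝ)
  set s : ℝ := ((Y \ X).card : ℝ) with hs
  have hs0 : 0 ≤ s := Nat.cast_nonneg _
  have e1 : |∑ u ∈ X, h u - ∑ u ∈ X, h' u| ≤ W.card := by
    rw [← Finset.sum_sub_distrib]
    refine (Finset.abs_sum_le_sum_abs _ _).trans ?_
    calc ∑ u ∈ X, |h u - h' u| ≤ ∑ u ∈ X, if u ∈ W then (1 : ℝ) else 0 := by
          refine Finset.sum_le_sum fun u _ => ?_
          split_ifs with hu
          · rw [abs_le]; constructor <;> linarith [h0 u, h1 u, h0' u, h1' u]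
          · rw [hW u hu]; simp
      _ = ((X.filter (· ∈ W)).card : ℝ) := by rw [Finset.sum_boole]
      _ ≤ W.card := by
          exact_mod_cast Finset.card_le_card fun u hu => (Finset.mem_filter.1 hu).2
  have hsplit : ∑ u ∈ Y, h' u = ∑ u ∈ X, h' u + ∑ u ∈ Y \ X, h' u := by
    rw [add_comm, Finset.sum_sdiff hXY]
  have ht0 : 0 ≤ ∑ u ∈ X, h' u := Finset.sum_nonneg fun u _ => h0' u
  have ht1 : ∑ u ∈ X, h' u ≤ x := by
    simpa using Finset.sum_le_sum (s := X) fun u _ => h1' u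
  have hr0 : 0 ≤ ∑ u ∈ Y \ X, h' u := Finset.sum_nonneg fun u _ => h0' u
  have hr1 : ∑ u ∈ Y \ X, h' u ≤ s := by
    simpa using Finset.sum_le_sum (s := Y \ X) fun u _ => h1' u
  rw [hsplit, hY]
  set t := ∑ u ∈ X, h' u
  set r := ∑ u ∈ Y \ X, h' u
  have e2 : |t / x - (t + r) / (x + s)| ≤ s / x := by
    have : t / x - (t + r) / (x + s) = (t * s - r * x) / (x * (x + s)) := by
      field_simp; ring
    rw [this, abs_div, abs_of_pos (by positivity : 0 < x * (x + s)),
      div_le_div_iff₀ (by positivity) hx]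
    have h2 : |t * s - r * x| ≤ x * s := by
      rw [abs_le]
      constructor <;> nlinarith [mul_nonneg ht0 hs0, mul_nonneg hr0 hx.le]
    have h3 := mul_le_mul_of_nonneg_right h2 hx.le
    nlinarith [mul_nonneg hs0 hs0, mul_nonneg (mul_nonneg hs0 hs0) hx.le]
  have e3 : |(∑ u ∈ X, h u) / x - t / x| ≤ W.card / x := by
    rw [← sub_div, abs_div, abs_of_pos hx]
    gcongr
  calc _ ≤ |(∑ u ∈ X, h u) / x - t / x| + |t / x - (t + r) / (x + s)| := abs_sub_le _ _ _
    _ ≤ W.card / x + s / x := add_le_add e3 e2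
    _ = _ := by rw [← add_div]

section Assign

variable {V : Type}

theorem toOuterMeasure_ne_top {α : Type*} (p : PMF α) (B : Set α) : p.toOuterMeasure B ≠ ⊤ := by
  rw [PMF.toOuterMeasure_apply]
  exact PMF.tsum_coe_indicator_ne_top p B

theorem toOuterMeasure_le_one {α : Type*} (p : PMF α) (B : Set α) : p.toOuterMeasure B ≤ 1 :=
  (p.toOuterMeasure.mono (Set.subset_univ B)).trans
    ((PMF.toOuterMeasure_apply_eq_one_iff p _).2 (Set.subset_univ _)).le

theorem toReal_uniform_bind {α : Type*} {X : Finset V} (hX : X.Nonempty) (q : V → PMF α)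
    (B : Set α) :
    (((PMF.uniformOfFinset X hX).bind q).toOuterMeasure B).toReal =
      (∑ u ∈ X, ((q u).toOuterMeasure B).toReal) / X.card := by
  rw [PMF.toOuterMeasure_bind_apply, tsum_eq_sum (s := X)
    (fun u hu => by rw [PMF.uniformOfFinset_apply_of_notMem _ hu, zero_mul]),
    ENNReal.toReal_sum (fun u _ => ENNReal.mul_ne_top (PMF.apply_ne_top _ _)
      (toOuterMeasure_ne_top _ _)), Finset.sum_div]
  refine Finset.sum_congr rfl fun u hu => ?_
  rw [PMF.uniformOfFinset_apply_of_mem _ hu, ENNReal.toReal_mul, ENNReal.toReal_inv,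
    ENNReal.toReal_natCast, mul_comm, div_eq_mul_inv]

theorem toReal_toOuterMeasure_le_one {α : Type*} (p : PMF α) (B : Set α) :
    (p.toOuterMeasure B).toReal ≤ 1 :=
  ENNReal.toReal_le_of_le_ofReal zero_le_one (by simpa using toOuterMeasure_le_one p B)

variable [DecidableEq V]

/-- The degrees assigned so far matter for an event about the degrees of the nodes in `W` only
through the degrees of these nodes. -/
theorem assignDegrees_congr (cap : V → ℝ) {W : Finset V} {B : Set (V → ℕ)}
    (hB : ∀ f f' : V → ℕ, (∀ v ∈ W, f v = f' v) → (f ∈ B ↔ f' ∈ B)) (ds : List ℕ) :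
    ∀ (U : Finset V) (g g' : V → ℕ), U.card = ds.length → (∀ v ∈ W, g v = g' v) →
      (assignDegrees cap ds U g).toOuterMeasure B =
        (assignDegrees cap ds U g').toOuterMeasure B := by
  induction ds with
  | nil =>
    intro U g g' _ hg
    simp only [assignDegrees, PMF.toOuterMeasure_pure_apply]
    by_cases h : g ∈ B
    · rw [if_pos h, if_pos ((hB g g' hg).1 h)]
    · rw [if_neg h, if_neg fun h' => h ((hB g g' hg).2 h')]
  | cons d ds ih =>
    intro U g g' hU hg
    have hne := nonempty_of_card_eq_cons hU
    rw [assignDegrees_cons cap d ds hne, assignDegrees_cons cap d ds hne,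
      PMF.toOuterMeasure_bind_apply, PMF.toOuterMeasure_bind_apply]
    refine tsum_congr fun u => ?_
    by_cases hu : u ∈ candidates cap d U
    · rw [ih _ _ (Function.update g' u d)
        (card_erase_of_card_eq_cons (candidates_subset _ _ _ hu) hU)]
      intro v hv
      by_cases hvu : v = u
      · subst hvu; simp
      · simp [Function.update_of_ne hvu, hg v hv]
    · rw [PMF.uniformOfFinset_apply_of_notMem _ hu, zero_mul, zero_mul]

variable [Fintype V]

/-- Replacing one entry `D` of the list by `D - 1` hardly affects the degrees of the nodes
in `W`: the node to which it is assigned can be taken to be the same in both cases, unless it is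
one of the few nodes that do not admit `D`, and it rarely belongs to `W`. -/
theorem abs_assignDegrees_pred_sub_le (cap : V → ℝ) {W : Finset V} {B : Set (V → ℕ)}
    (hB : ∀ f f' : V → ℕ, (∀ v ∈ W, f v = f' v) → (f ∈ B ↔ f' ∈ B)) {K : ℕ} (hK : 0 < K)
    (D : ℕ) (l₂ l₁ : List ℕ) :
    ∀ (U : Finset V) (g : V → ℕ), U.card = (l₁ ++ D :: l₂).length →
      l₁.length + K ≤ (U.filter fun u => (D : ℝ) ≤ cap u).card →
      |((assignDegrees cap (l₁ ++ D :: l₂) U g).toOuterMeasure B).toReal -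
          ((assignDegrees cap (l₁ ++ (D - 1) :: l₂) U g).toOuterMeasure B).toReal| ≤
        ((W.card : ℝ) + (Finset.univ.filter fun u => ¬ (D : ℝ) ≤ cap u).card) / K := by
  induction l₁ with
  | nil =>
    intro U g hU hKU
    rw [List.nil_append] at hU
    rw [List.length_nil, zero_add] at hKU
    have hne := nonempty_of_card_eq_cons hU
    have hsub : (U.filter fun u => (D : ℝ) ≤ cap u) ⊆
        U.filter fun u => ((D - 1 : ℕ) : ℝ) ≤ cap u := fun u hu => by
      rw [Finset.mem_filter] at hu ⊢
      exact ⟨hu.1, (Nat.cast_le.2 (Nat.sub_le D 1)).trans hu.2⟩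
    have hX : (U.filter fun u => (D : ℝ) ≤ cap u).Nonempty := Finset.card_pos.1 (by omega)
    have e1 : candidates cap D U = U.filter fun u => (D : ℝ) ≤ cap u := if_pos hX
    have e2 : candidates cap (D - 1) U = U.filter fun u => ((D - 1 : ℕ) : ℝ) ≤ cap u :=
      if_pos (hX.mono hsub)
    rw [List.nil_append, List.nil_append, assignDegrees_cons cap D l₂ hne,
      assignDegrees_cons cap (D - 1) l₂ hne, toReal_uniform_bind, toReal_uniform_bind]
    rw [← e1] at hKU
    have hKU' : (K : ℝ) ≤ (candidates cap D U).card := by exact_mod_cast hKU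
    have hK' : (0 : ℝ) < K := by exact_mod_cast hK
    rw [Finset.sum_congr rfl (g := fun u => if u ∈ U then ((assignDegrees cap l₂ (U.erase u)
        (Function.update g u D)).toOuterMeasure B).toReal else 0)
      (fun u hu => by rw [if_pos (candidates_subset _ _ _ hu)]),
      Finset.sum_congr (s₁ := candidates cap (D - 1) U) rfl (g := fun u => if u ∈ U then
        ((assignDegrees cap l₂ (U.erase u)
        (Function.update g u (D - 1))).toOuterMeasure B).toReal else 0)
      (fun u hu => by rw [if_pos (candidates_subset _ _ _ hu)])]
    refine (abs_average_sub_average_le (W := W) (by rw [e1, e2]; exact hsub)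
      (candidates_nonempty cap D hne) ?_ ?_ ?_ ?_ ?_).trans ?_
    · intro u; split_ifs <;> simp
    · intro u; split_ifs
      · exact toReal_toOuterMeasure_le_one _ _
      · simp
    · intro u; split_ifs <;> simp
    · intro u; split_ifs
      · exact toReal_toOuterMeasure_le_one _ _
      · simp
    · intro u hu
      split_ifs with huU
      · rw [assignDegrees_congr cap hB l₂ _ _ (Function.update g u (D - 1))
          (card_erase_of_card_eq_cons huU hU)]
        intro v hv
        have hvu : v ≠ u := fun e => hu (e ▸ hv)
        rw [Function.update_of_ne hvu, Function.update_of_ne hvu]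
      · rfl
    · gcongr
      rw [e1, e2]
      intro u hu
      simp only [Finset.mem_sdiff, Finset.mem_filter, Finset.mem_univ, true_and] at hu ⊢
      exact fun h => hu.2 ⟨hu.1.1, h⟩
  | cons e l₁ ih =>
    intro U g hU hKU
    rw [List.cons_append] at hU
    have hne := nonempty_of_card_eq_cons hU
    rw [List.cons_append, List.cons_append, assignDegrees_cons cap e _ hne,
      assignDegrees_cons cap e _ hne, toReal_uniform_bind, toReal_uniform_bind, ← sub_div,
      ← Finset.sum_sub_distrib]
    have hpos : (0 : ℝ) < (candidates cap e U).card := by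
      exact_mod_cast (candidates_nonempty cap e hne).card_pos
    rw [abs_div, abs_of_pos hpos, div_le_iff₀ hpos]
    refine (Finset.abs_sum_le_sum_abs _ _).trans ?_
    rw [mul_comm, ← nsmul_eq_mul]
    refine Finset.sum_le_card_nsmul _ _ _ fun u hu => ?_
    have huU := candidates_subset _ _ _ hu
    refine ih _ _ (card_erase_of_card_eq_cons huU hU) ?_
    have := Finset.pred_card_le_card_erase (s := U.filter fun u => (D : ℝ) ≤ cap u) (a := u)
    rw [← Finset.filter_erase] at this
    simp only [List.length_cons] at hKU
    omega

/-- For a given list with sufficiently many entries `δ`, the parity alteration hardly affects the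
degrees of the nodes in `W`. The list `δ, …, δ` is excluded, since then the altered degree would be
assigned when hardly any choice is left. -/
theorem abs_parityAdjust_sub_le (cap : V → ℝ) {W : Finset V} {B : Set (V → ℕ)}
    (hB : ∀ f f' : V → ℕ, (∀ v ∈ W, f v = f' v) → (f ∈ B ↔ f' ∈ B)) {K S : ℕ} (hK : 0 < K)
    {l : List ℕ} (hsort : l.Pairwise (· ≥ ·)) (hlen : l.length = Fintype.card V) {δ M : ℕ}
    (hmin : ∀ d ∈ l, δ ≤ d) (hmax : ∀ d ∈ l, d ≤ M) (hne : ∃ d ∈ l, d ≠ δ)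
    (hslots : l.countP (· ≠ δ) + K ≤ slots cap M)
    (hS : (Finset.univ.filter fun u => ¬ (M : ℝ) ≤ cap u).card ≤ S) :
    |((assignDegrees cap l Finset.univ fun _ => 0).toOuterMeasure B).toReal -
        ((assignDegrees cap (parityAdjust l) Finset.univ fun _ => 0).toOuterMeasure B).toReal| ≤
      ((W.card : ℝ) + S) / K := by
  have hK' : (0 : ℝ) < K := by exact_mod_cast hK
  rcases parityAdjust_eq l hsort with h | ⟨l₁, D, l₂, h1, h2, h3, h4⟩
  · rw [h, sub_self, abs_zero]
    positivity
  · have hDM : D ≤ M := hmax D (by rw [h1]; simp)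
    have hDδ : D ≠ δ := by
      obtain ⟨d, hd, hdδ⟩ := hne
      have := h4 d hd
      have := hmin d hd
      omega
    have hcount : l₁.length ≤ l.countP (· ≠ δ) := by
      have e : l₁.countP (· ≠ δ) = l₁.length :=
        List.countP_eq_length.2 fun e he => by simpa [h3 e he] using hDδ
      rw [← e, h1, List.countP_append]
      exact Nat.le_add_right _ _
    rw [h2]
    conv_lhs => rw [h1]
    refine (abs_assignDegrees_pred_sub_le cap hB hK D l₂ l₁ _ _
      (by rw [← h1, hlen, Finset.card_univ]) ?_).trans ?_
    · have := slots_antitone cap hDM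
      rw [slots, slots] at this
      rw [slots] at hslots
      omega
    · gcongr
      refine le_trans (Finset.card_le_card fun u hu => ?_) hS
      simp only [Finset.mem_filter, Finset.mem_univ, true_and, not_le] at hu ⊢
      exact hu.trans_le (Nat.cast_le.2 hDM)

/-- The law of the degrees of all nodes, when i.i.d. degrees with law `p` are sorted, altered for
parity and then assigned. -/
noncomputable def parityAssignment (p : PMF ℕ) (cap : V → ℝ) : PMF (V → ℕ) :=
  (iidPMF p (Fintype.card V)).bind fun x =>
    assignDegrees cap (parityAdjust ((List.ofFn x).insertionSort (· ≥ ·))) Finset.univ fun _ => 0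

/-- Two mixtures whose components are `ρ`-close outside of the set `bad`. -/
theorem bind_toOuterMeasure_le_of_forall_notMem {α β : Type} (p : PMF α) (q q' : α → PMF β)
    (B : Set β) (bad : Set α) {ρ : ℝ} (h0 : 0 ≤ ρ)
    (h : ∀ x ∈ p.support, x ∉ bad →
      ((q x).toOuterMeasure B).toReal ≤ ((q' x).toOuterMeasure B).toReal + ρ) :
    (p.bind q).toOuterMeasure B ≤
      (p.bind q').toOuterMeasure B + (ENNReal.ofReal ρ + p.toOuterMeasure bad) := by
  rw [PMF.toOuterMeasure_bind_apply, PMF.toOuterMeasure_bind_apply, p.toOuterMeasure_apply bad]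
  have : ENNReal.ofReal ρ = ∑' x, p x * ENNReal.ofReal ρ := by
    rw [ENNReal.tsum_mul_right, p.tsum_coe, one_mul]
  rw [this, ← ENNReal.tsum_add, ← ENNReal.tsum_add]
  refine ENNReal.tsum_le_tsum fun x => ?_
  by_cases hx : x ∈ p.support
  swap
  · rw [(p.apply_eq_zero_iff x).2 hx, zero_mul]; exact zero_le
  by_cases hb : x ∈ bad
  · rw [Set.indicator_of_mem hb]
    calc p x * (q x).toOuterMeasure B ≤ p x * 1 := by gcongr; exact toOuterMeasure_le_one _ _
      _ = p x := mul_one _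
      _ ≤ _ := by rw [← add_assoc]; exact le_add_self
  · rw [Set.indicator_of_notMem hb, add_zero, ← mul_add]
    gcongr
    rw [← ENNReal.ofReal_toReal (toOuterMeasure_ne_top (q x) B),
      ← ENNReal.ofReal_toReal (toOuterMeasure_ne_top (q' x) B),
      ← ENNReal.ofReal_add ENNReal.toReal_nonneg h0]
    exact ENNReal.ofReal_le_ofReal (h x hx hb)

open Classical in
/-- The laws of the degrees of the nodes in `W` with and without the parity alteration are close
to each other. -/
theorem parityAssignment_close {p : PMF ℕ} {cap : V → ℝ} {W : Finset V} {B : Set (V → ℕ)}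
    (hB : ∀ f f' : V → ℕ, (∀ v ∈ W, f v = f' v) → (f ∈ B ↔ f' ∈ B)) {K S a : ℕ} (hK : 0 < K)
    {δ M : ℕ} (hp : ∀ k ∈ p.support, δ ≤ k ∧ k ≤ M) (ha : a ≤ Fintype.card V)
    (hslots : Fintype.card V - a + K ≤ slots cap M)
    (hS : (Finset.univ.filter fun u => ¬ (M : ℝ) ≤ cap u).card ≤ S) :
    (parityAssignment p cap).toOuterMeasure B ≤ (iidAssignment p cap).toOuterMeasure B +
        (ENNReal.ofReal (((W.card : ℝ) + S) / K) + (iidPMF p (Fintype.card V)).toOuterMeasure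
          {x | (Finset.univ.filter fun i => x i = δ).card < a ∨ ∀ i, x i = δ}) ∧
      (iidAssignment p cap).toOuterMeasure B ≤ (parityAssignment p cap).toOuterMeasure B +
        (ENNReal.ofReal (((W.card : ℝ) + S) / K) + (iidPMF p (Fintype.card V)).toOuterMeasure
          {x | (Finset.univ.filter fun i => x i = δ).card < a ∨ ∀ i, x i = δ}) := by
  have key : ∀ x ∈ (iidPMF p (Fintype.card V)).support,
      x ∉ {x : Fin (Fintype.card V) → ℕ |
        (Finset.univ.filter fun i => x i = δ).card < a ∨ ∀ i, x i = δ} →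
      |((assignDegrees cap ((List.ofFn x).insertionSort (· ≥ ·)) Finset.univ
          fun _ => 0).toOuterMeasure B).toReal -
        ((assignDegrees cap (parityAdjust ((List.ofFn x).insertionSort (· ≥ ·))) Finset.univ
          fun _ => 0).toOuterMeasure B).toReal| ≤ ((W.card : ℝ) + S) / K := by
    intro x hx hb
    rw [Set.mem_ofPred_eq, not_or, not_lt, not_forall] at hb
    rw [PMF.mem_support_iff, iidPMF_apply, Finset.prod_ne_zero_iff] at hx
    have hmem : ∀ d ∈ (List.ofFn x).insertionSort (· ≥ ·), δ ≤ d ∧ d ≤ M := by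
      intro d hd
      rw [List.mem_insertionSort, List.mem_ofFn] at hd
      obtain ⟨i, rfl⟩ := hd
      exact hp _ (hx i (Finset.mem_univ _))
    refine abs_parityAdjust_sub_le cap hB hK (List.pairwise_insertionSort (r := (· ≥ ·)) _)
      (by simp) (fun d hd => (hmem d hd).1) (fun d hd => (hmem d hd).2) ?_ ?_ hS
    · obtain ⟨i, hi⟩ := hb.2
      exact ⟨x i, by rw [List.mem_insertionSort]; exact (List.mem_ofFn' x _).2 ⟨i, rfl⟩, hi⟩
    · refine le_trans (Nat.add_le_add_right ?_ K) hslots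
      rw [(List.perm_insertionSort (· ≥ ·) (List.ofFn x)).countP_eq]
      have e : (List.ofFn x).countP (· ≠ δ) = (Finset.univ.filter fun i => ¬ x i = δ).card := by
        have : (↑(List.ofFn x) : Multiset ℕ) = Finset.univ.val.map x := by
          rw [Fin.univ_val_map]
        rw [← Multiset.coe_countP, this, Multiset.countP_map]
        rfl
      have hsum := Finset.card_filter_add_card_filter_not (s := (Finset.univ :
        Finset (Fin (Fintype.card V)))) (fun i => x i = δ)
      rw [Finset.card_univ, Fintype.card_fin] at hsum
      rw [e]
      omega
  have hρ : 0 ≤ ((W.card : ℝ) + S) / K := by positivity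
  constructor
  · refine bind_toOuterMeasure_le_of_forall_notMem _ _ _ B _ hρ fun x hx hb => ?_
    have := (abs_le.1 (key x hx hb)).1
    linarith
  · refine bind_toOuterMeasure_le_of_forall_notMem _ _ _ B _ hρ fun x hx hb => ?_
    have := (abs_le.1 (key x hx hb)).2
    linarith

end Assign

/-! ### The sandwich for given communities -/

theorem filter_toOuterMeasure_mul {α : Type} (μ : PMF α) (E : Set α)
    (hE : ∃ f ∈ E, f ∈ μ.support) (B : Set α) :
    (μ.filter E hE).toOuterMeasure B * μ.toOuterMeasure E = μ.toOuterMeasure (B ∩ E) := by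
  have h0 : ∑' f, E.indicator μ f ≠ 0 := by
    obtain ⟨f, hfE, hf⟩ := hE
    intro h
    have := ENNReal.tsum_eq_zero.1 h f
    rw [Set.indicator_of_mem hfE] at this
    exact hf this
  rw [PMF.toOuterMeasure_apply, PMF.toOuterMeasure_apply, PMF.toOuterMeasure_apply,
    ← ENNReal.tsum_mul_right]
  refine tsum_congr fun f => ?_
  by_cases hB : f ∈ B
  · rw [Set.indicator_of_mem hB, PMF.filter_apply, mul_assoc,
      ENNReal.inv_mul_cancel h0 (PMF.tsum_coe_indicator_ne_top μ E), mul_one]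
    by_cases hf : f ∈ E
    · rw [Set.indicator_of_mem hf, Set.indicator_of_mem (show f ∈ B ∩ E from ⟨hB, hf⟩)]
    · rw [Set.indicator_of_notMem hf, Set.indicator_of_notMem fun h : f ∈ B ∩ E => hf h.2]
  · rw [Set.indicator_of_notMem hB, zero_mul, Set.indicator_of_notMem fun h : f ∈ B ∩ E => hB h.1]

theorem toOuterMeasure_add_compl {α : Type} (μ : PMF α) (E : Set α) :
    μ.toOuterMeasure E + μ.toOuterMeasure Eᶜ = 1 := by
  rw [PMF.toOuterMeasure_apply, PMF.toOuterMeasure_apply, ← ENNReal.tsum_add, ← μ.tsum_coe]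
  exact tsum_congr fun f => by rw [← Pi.add_apply, Set.indicator_self_add_compl]

theorem toOuterMeasure_le_filter_add {α : Type} (μ : PMF α) (E : Set α)
    (hE : ∃ f ∈ E, f ∈ μ.support) (B : Set α) :
    μ.toOuterMeasure B ≤ (μ.filter E hE).toOuterMeasure B + μ.toOuterMeasure Eᶜ := by
  calc μ.toOuterMeasure B ≤ μ.toOuterMeasure (B ∩ E ∪ Eᶜ) :=
        μ.toOuterMeasure.mono fun f hf => by
          by_cases h : f ∈ E
          · exact Or.inl ⟨hf, h⟩
          · exact Or.inr h
    _ ≤ μ.toOuterMeasure (B ∩ E) + μ.toOuterMeasure Eᶜ := MeasureTheory.measure_union_le _ _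
    _ ≤ _ := by
      rw [← filter_toOuterMeasure_mul μ E hE]
      gcongr
      exact mul_le_of_le_one_right' (toOuterMeasure_le_one _ _)

theorem filter_toOuterMeasure_le_add {α : Type} (μ : PMF α) (E : Set α)
    (hE : ∃ f ∈ E, f ∈ μ.support) (B : Set α) :
    (μ.filter E hE).toOuterMeasure B ≤ μ.toOuterMeasure B + μ.toOuterMeasure Eᶜ := by
  calc (μ.filter E hE).toOuterMeasure B
      = (μ.filter E hE).toOuterMeasure B * (μ.toOuterMeasure E + μ.toOuterMeasure Eᶜ) := by
        rw [toOuterMeasure_add_compl, mul_one]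
    _ = μ.toOuterMeasure (B ∩ E) + (μ.filter E hE).toOuterMeasure B * μ.toOuterMeasure Eᶜ := by
        rw [mul_add, filter_toOuterMeasure_mul]
    _ ≤ _ := by
      gcongr
      · exact Set.inter_subset_left
      · exact mul_le_of_le_one_left' (toOuterMeasure_le_one _ _)

/-- The number of nodes in communities of size at most `m`. -/
def smallMass (m : ℕ) (C : List ℕ) : ℕ := (C.map fun c => if c ≤ m then c else 0).sum

theorem card_filter_node (C : List ℕ) (Q : ℕ → Prop) [DecidablePred Q] :
    (Finset.univ.filter fun u : Node C => Q (C.get u.1)).card =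
      (C.map fun c => if Q c then c else 0).sum := by
  rw [Finset.card_filter, Fintype.sum_sigma, ← Fin.sum_univ_fun_getElem]
  refine Finset.sum_congr rfl fun j _ => ?_
  by_cases h : Q C[(j : ℕ)] <;> simp [h]

theorem card_node (C : List ℕ) : Fintype.card (Node C) = C.sum := by
  simp

theorem card_community {C : List ℕ} (j : Fin C.length) :
    (Finset.univ.filter fun v : Node C => v.1 = j).card = C.get j := by
  rw [Finset.card_filter, Fintype.sum_sigma, Finset.sum_eq_single j]
  · simp
  · intro i _ hi
    simp [hi]
  · simp

theorem phi_mem_Icc {n : ℕ} {C : List ℕ} (hC : C.sum = n) : 0 ≤ phi n C ∧ phi n C ≤ 1 := by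
  have hsum : ∑ j : Fin C.length, (C.get j : ℝ) = n := by
    rw [← hC, ← Nat.cast_sum]
    congr 1
    simp
  have hle : ∀ j : Fin C.length, (C.get j : ℝ) ≤ n := fun j => by
    rw [← hsum]
    exact Finset.single_le_sum (f := fun j => (C.get j : ℝ)) (fun i _ => Nat.cast_nonneg _)
      (Finset.mem_univ j)
  have hsq : ∑ j : Fin C.length, (C.get j : ℝ) ^ 2 ≤ (n : ℝ) ^ 2 := by
    calc ∑ j : Fin C.length, (C.get j : ℝ) ^ 2 ≤ ∑ j : Fin C.length, (C.get j : ℝ) * n :=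
          Finset.sum_le_sum fun j _ => by
            rw [sq]; exact mul_le_mul_of_nonneg_left (hle j) (Nat.cast_nonneg _)
      _ = (n : ℝ) ^ 2 := by rw [← Finset.sum_mul, hsum, sq]
  have h0 : 0 ≤ ∑ j : Fin C.length, (C.get j : ℝ) ^ 2 := Finset.sum_nonneg fun j _ => sq_nonneg _
  unfold phi
  constructor
  · rw [sub_nonneg, one_div, inv_mul_eq_div]
    exact div_le_one_of_le₀ hsq (sq_nonneg _)
  · have : 0 ≤ 1 / (n : ℝ) ^ 2 * ∑ j : Fin C.length, (C.get j : ℝ) ^ 2 := by positivity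
    linarith

/-- An event that follows from a property of the multiset of all degrees fails with at most the
probability that the sampled degrees do not have the property. -/
theorem iidAssignment_compl_le {V : Type} [DecidableEq V] [Fintype V] (p : PMF ℕ) (cap : V → ℝ)
    (E : Set (V → ℕ)) (bad : Set (Fin (Fintype.card V) → ℕ))
    (h : ∀ x ∉ bad, ∀ f : V → ℕ, Finset.univ.val.map f = (↑(List.ofFn x) : Multiset ℕ) → f ∈ E) :
    (iidAssignment p cap).toOuterMeasure Eᶜ ≤
      (iidPMF p (Fintype.card V)).toOuterMeasure bad := by
  rw [iidAssignment, PMF.toOuterMeasure_bind_apply, (iidPMF _ _).toOuterMeasure_apply bad]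
  refine ENNReal.tsum_le_tsum fun x => ?_
  by_cases hx : x ∈ bad
  · rw [Set.indicator_of_mem hx]
    exact mul_le_of_le_one_right' (toOuterMeasure_le_one _ _)
  · rw [Set.indicator_of_notMem hx, (PMF.toOuterMeasure_apply_eq_zero_iff _ _).2, mul_zero]
    rw [Set.disjoint_compl_right_iff_subset]
    intro f hf
    refine h x hx f ?_
    rw [(map_eq_of_mem_support_assignDegrees cap _ _ _ _ (by simp) hf).2]
    exact Multiset.coe_eq_coe.2 (List.perm_insertionSort _ _)

namespace ABCDParams

variable (P : ABCDParams)

theorem assignment_rawDegrees_eq {n : ℕ} {C : List ℕ} (hC : C.sum = n) :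
    P.assignment n (P.rawDegrees n) C = iidAssignment (tpl P.γ P.δ (P.maxDeg n))
      fun u : Node C => P.cap n C (C.get u.1) := by
  have hcard : Fintype.card (Node C) = n := (card_node C).trans hC
  rw [assignment, rawDegrees, PMF.bind_map, iidAssignment]
  generalize tpl P.γ P.δ (P.maxDeg n) = p
  generalize (fun u : Node C => P.cap n C (C.get u.1)) = cap
  subst hcard
  rfl

theorem assignment_degrees_eq {n : ℕ} {C : List ℕ} (hC : C.sum = n) :
    P.assignment n (P.degrees n) C = parityAssignment (tpl P.γ P.δ (P.maxDeg n))
      fun u : Node C => P.cap n C (C.get u.1) := by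
  have hcard : Fintype.card (Node C) = n := (card_node C).trans hC
  rw [assignment, degrees, rawDegrees, PMF.bind_map, PMF.bind_map, parityAssignment]
  generalize tpl P.γ P.δ (P.maxDeg n) = p
  generalize (fun u : Node C => P.cap n C (C.get u.1)) = cap
  subst hcard
  rfl

variable {P}

theorem sub_one_le_cap (hξ0 : 0 < P.ξ) (hξ1 : P.ξ < 1) {n : ℕ} {C : List ℕ} (hC : C.sum = n)
    {z : ℕ} (hz : 1 ≤ z) : (z : ℝ) - 1 ≤ P.cap n C z := by
  obtain ⟨h0, h1⟩ := phi_mem_Icc hC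
  have hz' : (1 : ℝ) ≤ z := by exact_mod_cast hz
  have h2 : P.ξ * phi n C ≤ P.ξ * 1 := mul_le_mul_of_nonneg_left h1 hξ0.le
  have h3 : 0 ≤ P.ξ * phi n C := mul_nonneg hξ0.le h0
  rw [cap, le_div_iff₀ (by linarith)]
  nlinarith

theorem le_deltaZ_iff {n : ℕ} {C : List ℕ} {z : ℕ} (h : 0 ≤ P.cap n C z) (k : ℕ) :
    k ≤ P.deltaZ n C z ↔ k ≤ P.maxDeg n ∧ (k : ℝ) ≤ P.cap n C z := by
  have h2 : 0 ≤ (n : ℝ) ^ P.ζ := by positivity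
  rw [deltaZ, maxDeg, Nat.le_floor_iff (le_min h h2), Nat.le_floor_iff h2, le_min_iff, and_comm]

open Classical in
/-- The sandwich for given communities. Here `b` is a lower bound for the number of nodes with
the minimum degree, which holds up to probability `t`, `Z` is an upper bound for the community
sizes, `S` is an upper bound for the number of nodes that do not admit all degrees, and `K` is a lower bound for the number of
choices whenever a degree above the minimum is assigned. -/
theorem sandwich_of_bounds (hδ : 0 < P.δ) (hs : P.δ < P.s) (hξ0 : 0 < P.ξ) (hξ1 : P.ξ < 1)
    {n : ℕ} (hM : P.δ ≤ P.maxDeg n) (hε0 : 0 ≤ P.eps n) (hε1 : P.eps n < 1)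
    {p₀ : ℝ} (hp₀ : ∀ Δ : ℕ, P.δ ≤ Δ → p₀ * powInt P.γ P.δ (Δ + 1) ≤ powInt P.γ P.δ (P.δ + 1))
    {a b K Z : ℕ} (hK : 0 < K) (hab : a + Z ≤ b) (hbn : b ≤ n)
    {r t : ℝ} (ht0 : 0 ≤ t) (hr1 : r < 1)
    (hbad : (iidPMF (tpl P.γ P.δ (P.maxDeg n)) n).toOuterMeasure
      {x | (Finset.univ.filter fun i => x i = P.δ).card < b ∨ ∀ i, x i = P.δ} ≤ ENNReal.ofReal t)
    {C : List ℕ} (hC : C.sum = n) (hCs : ∀ c ∈ C, P.s ≤ c) (hCZ : ∀ c ∈ C, c ≤ Z)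
    {S : ℕ} (hS : smallMass (P.maxDeg n) C ≤ S) (hSK : S + K ≤ a)
    (hSε : (S : ℝ) / K ≤ P.eps n * p₀) (hr : ((Z : ℝ) + S) / K + 2 * t ≤ r)
    (j : Fin C.length) : P.SandwichRaw n r C j ∧ P.SandwichAltered n r C j := by
  have hcard : Fintype.card (Node C) = n := (card_node C).trans hC
  set cap : Node C → ℝ := fun u => P.cap n C (C.get u.1) with hcapdef
  have hsize : ∀ i : Fin C.length, P.s ≤ C.get i := fun i => hCs _ (List.get_mem _ _)
  have hcapge : ∀ u : Node C, (C.get u.1 : ℝ) - 1 ≤ cap u := fun u =>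
    sub_one_le_cap hξ0 hξ1 hC (by have := hsize u.1; omega)
  have hcap : ∀ u, (P.δ : ℝ) ≤ cap u := fun u => by
    have h1 : ((P.δ + 1 : ℕ) : ℝ) ≤ C.get u.1 := by
      exact_mod_cast (Nat.succ_le_of_lt hs).trans (hsize u.1)
    have := hcapge u
    push_cast at h1
    linarith
  have hΔ : ∀ (i : Fin (C.get j)) (k : ℕ),
      k ≤ P.deltaZ n C (C.get j) ↔ k ≤ P.maxDeg n ∧ (k : ℝ) ≤ cap ⟨j, i⟩ := fun i k =>
    le_deltaZ_iff ((Nat.cast_nonneg P.δ).trans (hcap ⟨j, i⟩)) k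
  have hnot : (Finset.univ.filter fun u => ¬ (P.maxDeg n : ℝ) ≤ cap u).card ≤ S := by
    refine le_trans (Finset.card_le_card (t := Finset.univ.filter fun u : Node C =>
      C.get u.1 ≤ P.maxDeg n) fun u hu => ?_) ((card_filter_node C _).le.trans hS)
    simp only [Finset.mem_filter, Finset.mem_univ, true_and, not_le] at hu ⊢
    have h1 : (C.get u.1 : ℝ) < P.maxDeg n + 1 := by have := hcapge u; linarith
    have h2 : C.get u.1 < P.maxDeg n + 1 := by exact_mod_cast h1
    omega
  have hslotsM : n ≤ slots cap (P.maxDeg n) + S := by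
    have := Finset.card_filter_add_card_filter_not (s := (Finset.univ : Finset (Node C)))
      fun u => (P.maxDeg n : ℝ) ≤ cap u
    rw [Finset.card_univ, hcard] at this
    rw [slots]
    omega
  have hslots : ∀ d, d ≤ P.maxDeg n → n ≤ slots cap d + S := fun d hd =>
    hslotsM.trans (Nat.add_le_add_right (slots_antitone cap hd) _)
  have hz0 : 0 < C.get j := by have := hsize j; omega
  have hδΔ : P.δ ≤ P.deltaZ n C (C.get j) := (hΔ ⟨0, hz0⟩ _).2 ⟨hM, hcap _⟩
  have hΔM : P.deltaZ n C (C.get j) ≤ P.maxDeg n := ((hΔ ⟨0, hz0⟩ _).1 le_rfl).1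
  have hK0 : (0 : ℝ) < K := by exact_mod_cast hK
  have hZj : C.get j ≤ Z := hCZ _ (List.get_mem _ _)
  have hKreal : ∀ d, d ≤ P.maxDeg n → (Fintype.card (Node C) : ℝ) - a + K ≤ slots cap d := by
    intro d hd
    have h1 : (n : ℝ) ≤ slots cap d + S := by exact_mod_cast hslots d hd
    have h2 : (S : ℝ) + K ≤ a := by exact_mod_cast hSK
    rw [hcard]
    linarith
  have hexp : ((Fintype.card (Node C) : ℝ) - slots cap (P.deltaZ n C (C.get j))) / K ≤
      P.eps n * p₀ := by
    refine le_trans ?_ hSε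
    have h1 : (n : ℝ) ≤ slots cap (P.deltaZ n C (C.get j)) + S := by exact_mod_cast hslots _ hΔM
    rw [hcard]
    gcongr
    linarith
  set μ := iidAssignment (tpl P.γ P.δ (P.maxDeg n)) cap with hμ
  set E : Set (Node C → ℕ) :=
    {f | a ≤ (Finset.univ.filter fun v : Node C => v.1 ≠ j ∧ f v = P.δ).card} with hEdef
  have hbad' : (iidPMF (tpl P.γ P.δ (P.maxDeg n)) (Fintype.card (Node C))).toOuterMeasure
      {x | (Finset.univ.filter fun i => x i = P.δ).card < b ∨ ∀ i, x i = P.δ} ≤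
        ENNReal.ofReal t := by
    have : ∀ N, n = N → (iidPMF (tpl P.γ P.δ (P.maxDeg n)) N).toOuterMeasure
        {x | (Finset.univ.filter fun i => x i = P.δ).card < b ∨ ∀ i, x i = P.δ} ≤
          ENNReal.ofReal t := by
      rintro N rfl
      convert hbad
    exact this _ hcard.symm
  have hEc : μ.toOuterMeasure Eᶜ ≤ ENNReal.ofReal t := by
    refine (iidAssignment_compl_le _ cap E _ fun x hx f hf => ?_).trans hbad'
    rw [Set.mem_ofPred_eq, not_or, not_lt] at hx
    have h1 : (Finset.univ.filter fun v => f v = P.δ).card =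
        (Finset.univ.filter fun i => x i = P.δ).card := by
      have e : (Finset.univ.val.map f).countP (· = P.δ) =
          (Finset.univ.val.map x).countP (· = P.δ) := by
        rw [hf, Fin.univ_val_map]
      rw [Multiset.countP_map, Multiset.countP_map] at e
      exact e
    have h2 : (Finset.univ.filter fun v => f v = P.δ) ⊆
        (Finset.univ.filter fun v : Node C => v.1 ≠ j ∧ f v = P.δ) ∪
          Finset.univ.filter fun v : Node C => v.1 = j := fun v hv => by
      simp only [Finset.mem_union, Finset.mem_filter, Finset.mem_univ, true_and] at hv ⊢
      by_cases h : v.1 = j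
      · exact Or.inr h
      · exact Or.inl ⟨h, hv⟩
    have h3 := (Finset.card_le_card h2).trans (Finset.card_union_le _ _)
    rw [card_community, h1] at h3
    rw [hEdef, Set.mem_ofPred_eq]
    have := hx.1
    omega
  have htr : t ≤ r := by
    have : 0 ≤ ((Z : ℝ) + S) / K := by positivity
    linarith
  have hE1 : 1 ≤ μ.toOuterMeasure E + ENNReal.ofReal t := by
    rw [← toOuterMeasure_add_compl μ E]
    gcongr
  have hE : ∃ f ∈ E, f ∈ μ.support := by
    by_contra hcon
    have h0 : μ.toOuterMeasure E = 0 :=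
      (PMF.toOuterMeasure_apply_eq_zero_iff _ _).2 (Set.disjoint_left.2 fun f h1 h2 =>
        hcon ⟨f, h2, h1⟩)
    rw [h0, zero_add, ENNReal.one_le_ofReal] at hE1
    linarith
  obtain ⟨hlow, hupp⟩ := stochLE_iidAssignment j hδ hM hcap hK0 hKreal hΔ hε0 hε1
    (hp₀ _ hδΔ) hexp hEdef hE
  have hraw : P.assignment n (P.rawDegrees n) C = μ := P.assignment_rawDegrees_eq hC
  have halt : P.assignment n (P.degrees n) C =
    parityAssignment (tpl P.γ P.δ (P.maxDeg n)) cap := P.assignment_degrees_eq hC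
  constructor
  · unfold SandwichRaw
    rw [hraw]
    refine ⟨E, hE, ?_, hlow, hupp⟩
    rw [tsub_le_iff_right]
    exact hE1.trans (by gcongr)
  · have hρ0 : 0 ≤ ((Z : ℝ) + S) / K := by positivity
    have hsum : ENNReal.ofReal t + (ENNReal.ofReal (((C.get j : ℝ) + S) / K) + ENNReal.ofReal t) ≤
        ENNReal.ofReal r := by
      rw [← ENNReal.ofReal_add (by positivity) ht0, ← ENNReal.ofReal_add ht0 (by positivity)]
      refine ENNReal.ofReal_le_ofReal (le_trans ?_ hr)
      have : ((C.get j : ℝ) + S) / K ≤ ((Z : ℝ) + S) / K := by gcongr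
      linarith
    have hclose := fun U : Set (Fin (C.get j) → ℕ) => parityAssignment_close
      (p := tpl P.γ P.δ (P.maxDeg n)) (cap := cap)
      (W := Finset.univ.filter fun v : Node C => v.1 = j) (B := commDegrees j ⁻¹' U)
      (fun f f' hff' => by
        have : commDegrees j f = commDegrees j f' :=
          funext fun i => hff' ⟨j, i⟩ (by simp)
        rw [Set.mem_preimage, Set.mem_preimage, this])
      (K := K) (S := S) (a := b) hK (fun k hk => (support_tpl hδ hM k).1 hk)
      (by rw [hcard]; exact hbn) (by rw [hcard]; omega) hnot
    simp only [card_community] at hclose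
    unfold SandwichAltered
    rw [halt]
    constructor
    · intro U hU
      have h1 := hlow U hU
      rw [PMF.toOuterMeasure_map_apply] at h1 ⊢
      calc _ ≤ _ := h1
        _ ≤ _ := filter_toOuterMeasure_le_add μ E hE _
        _ ≤ _ := add_le_add (hclose U).2 hEc
        _ ≤ _ := add_le_add (add_le_add le_rfl (add_le_add le_rfl hbad')) le_rfl
        _ ≤ _ := by
          rw [add_assoc, add_comm _ (ENNReal.ofReal t)]
          exact add_le_add le_rfl hsum
    · intro U hU
      have h1 := hupp U hU
      rw [PMF.toOuterMeasure_map_apply] at h1 ⊢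
      calc _ ≤ _ := (hclose U).1
        _ ≤ _ := add_le_add (toOuterMeasure_le_filter_add μ E hE _) (add_le_add le_rfl hbad')
        _ ≤ _ := add_le_add (add_le_add h1 hEc) le_rfl
        _ ≤ _ := by
          rw [add_assoc]
          exact add_le_add le_rfl hsum

end ABCDParams

/-! ### Community sizes -/

theorem smallMass_cons (m c : ℕ) (l : List ℕ) :
    smallMass m (c :: l) = (if c ≤ m then c else 0) + smallMass m l := by
  simp [smallMass]

theorem smallMass_perm (m : ℕ) {l l' : List ℕ} (h : l.Perm l') :
    smallMass m l = smallMass m l' := (h.map _).sum_eq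

/-- All that is needed about the increase of `r` randomly chosen sizes by `1`. -/
theorem mem_support_bumpRandom {r : ℕ} {l C : List ℕ} (h : C ∈ (bumpRandom r l).support) :
    (r ≤ l.length → C.sum = l.sum + r) ∧ (∀ m, smallMass m C ≤ smallMass m l + r) ∧
      ∀ a b, (∀ c ∈ l, a ≤ c ∧ c ≤ b) → ∀ c ∈ C, a ≤ c ∧ c ≤ b + 1 := by
  unfold bumpRandom at h
  split_ifs at h with hne
  · rw [PMF.mem_support_map_iff] at h
    obtain ⟨S, hS, rfl⟩ := h
    rw [PMF.mem_support_uniformOfFinset_iff, Finset.mem_powersetCard] at hS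
    have hcard : ∑ i : Fin l.length, (if i ∈ S then 1 else 0) = r := by
      rw [Finset.sum_boole, ← hS.2]
      simp
    refine ⟨fun _ => ?_, fun m => ?_, fun a b hab c hc => ?_⟩
    · rw [List.sum_ofFn, Finset.sum_add_distrib, hcard]
      simp
    · rw [smallMass, List.map_ofFn, List.sum_ofFn, ← hcard, smallMass,
        ← Fin.sum_univ_fun_getElem, ← Finset.sum_add_distrib]
      refine Finset.sum_le_sum fun i _ => ?_
      simp only [Function.comp, List.get_eq_getElem]
      split_ifs <;> omega
    · rw [List.mem_ofFn] at hc
      obtain ⟨i, rfl⟩ := hc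
      have := hab _ (List.get_mem l i)
      split_ifs <;> omega
  · rw [PMF.mem_support_pure_iff] at h
    subst h
    refine ⟨fun hr => absurd ?_ hne, fun m => Nat.le_add_right _ _, fun a b hab c hc => ?_⟩
    · exact Finset.powersetCard_nonempty.2 (by simpa using hr)
    · have := hab c hc
      omega

/-- The sampled communities cover exactly `n` nodes. The bound on `n` ensures that there are at least
`s` communities when the last one is deleted, so that its nodes can be distributed among the
others. -/
theorem mem_support_growCommunities {p : PMF ℕ} {s M : ℕ} (hs : 0 < s)
    (hp : ∀ c ∈ p.support, s ≤ c ∧ c ≤ M) {n : ℕ} (hn : s * (M + 1) ≤ n) :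
    ∀ (fuel rem : ℕ) (acc C : List ℕ), 0 < rem → rem ≤ fuel → acc.sum + rem = n →
      (∀ c ∈ acc, s ≤ c ∧ c ≤ M) → C ∈ (growCommunities p s fuel rem acc).support →
      C.sum = n ∧ ∀ c ∈ C, s ≤ c ∧ c ≤ M + 1 := by
  intro fuel
  induction fuel with
  | zero => intro rem acc C h1 h2; omega
  | succ fuel ih =>
    intro rem acc C h1 h2 hsum hacc hC
    rw [growCommunities, PMF.mem_support_bind_iff] at hC
    obtain ⟨c, hc, hC⟩ := hC
    have hc' := hp c hc
    split_ifs at hC with h3 h4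
    · refine ih (rem - c) (c :: acc) C (by omega) (by omega) ?_ ?_ hC
      · rw [List.sum_cons]; omega
      · intro d hd
        rcases List.mem_cons.1 hd with rfl | hd
        · exact hc'
        · exact hacc d hd
    · rw [PMF.mem_support_pure_iff] at hC
      subst hC
      refine ⟨by rw [List.sum_cons]; omega, fun d hd => ?_⟩
      rcases List.mem_cons.1 hd with rfl | hd
      · omega
      · have := hacc d hd
        omega
    · obtain ⟨b1, -, b3⟩ := mem_support_bumpRandom hC
      have hle : acc.sum ≤ acc.length * M := by
        have := List.sum_le_card_nsmul acc M fun c hc => (hacc c hc).2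
        simpa using this
      have hlen : rem ≤ acc.length := by
        have h5 : s * M < acc.length * M := by
          rw [mul_add, mul_one] at hn
          omega
        have := lt_of_mul_lt_mul_right h5 (Nat.zero_le M)
        omega
      exact ⟨by rw [b1 hlen, hsum], b3 s M hacc⟩

theorem tsum_bind_mul {α β : Type} (p : PMF α) (q : α → PMF β) (g : β → ℝ≥0∞) :
    ∑' b, (p.bind q) b * g b = ∑' a, p a * ∑' b, q a b * g b := by
  simp only [PMF.bind_apply, ← ENNReal.tsum_mul_right, ← ENNReal.tsum_mul_left]
  rw [ENNReal.tsum_comm]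
  simp only [mul_assoc]

theorem tsum_mul_le_of_forall_support {α : Type} (p : PMF α) (g : α → ℝ≥0∞) (x : ℝ≥0∞)
    (h : ∀ a ∈ p.support, g a ≤ x) : ∑' a, p a * g a ≤ x := by
  calc ∑' a, p a * g a ≤ ∑' a, p a * x := ENNReal.tsum_le_tsum fun a => by
        by_cases ha : a ∈ p.support
        · gcongr; exact h a ha
        · rw [(p.apply_eq_zero_iff a).2 ha, zero_mul, zero_mul]
    _ = x := by rw [ENNReal.tsum_mul_right, p.tsum_coe, one_mul]

/-- The expected number of nodes in small communities: each step in which a size `c` is sampled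
contributes at most `κ c` on average, and the sampled sizes add up to at most `rem + M`. -/
theorem tsum_growCommunities_mul_smallMass_le {p : PMF ℕ} {s M m : ℕ} {κ : ℝ≥0∞} (hκ : κ ≠ ⊤)
    (hp : ∀ c ∈ p.support, c ≤ M)
    (hκp : ∑' c, p c * ((if c ≤ m then c else 0 : ℕ) : ℝ≥0∞) ≤ κ * ∑' c, p c * (c : ℝ≥0∞)) :
    ∀ (fuel rem : ℕ) (acc : List ℕ),
      ∑' C, growCommunities p s fuel rem acc C * (smallMass m C : ℝ≥0∞) ≤
        smallMass m acc + (m + s : ℕ) + κ * (rem + M : ℕ) := by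
  have hfin : κ * ∑' c, p c * (c : ℝ≥0∞) ≠ ⊤ := by
    refine ENNReal.mul_ne_top hκ (ne_top_of_le_ne_top (ENNReal.natCast_ne_top M) ?_)
    exact tsum_mul_le_of_forall_support p _ _ fun c hc => by exact_mod_cast hp c hc
  intro fuel
  induction fuel with
  | zero =>
    intro rem acc
    refine tsum_mul_le_of_forall_support _ _ _ fun C hC => ?_
    rw [growCommunities, PMF.mem_support_pure_iff] at hC
    rw [hC, add_assoc]
    exact le_self_add
  | succ fuel ih =>
    intro rem acc
    rw [growCommunities, tsum_bind_mul]
    -- Adding `κ` times the mean of the next size to both sides avoids subtraction.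
    refine (ENNReal.add_le_add_iff_right hfin).1 ?_
    have hstep : ∀ c, p c * (∑' C, (if c < rem then growCommunities p s fuel (rem - c) (c :: acc)
        else if s ≤ rem then PMF.pure (rem :: acc) else bumpRandom rem acc : PMF (List ℕ)) C *
          (smallMass m C : ℝ≥0∞)) + κ * (p c * (c : ℝ≥0∞)) ≤
        p c * (smallMass m acc + (m + s : ℕ) + κ * (rem + M : ℕ)) +
          p c * ((if c ≤ m then c else 0 : ℕ) : ℝ≥0∞) := by
      intro c
      by_cases hc : c ∈ p.support
      swap
      · rw [(p.apply_eq_zero_iff c).2 hc]; simp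
      rw [mul_left_comm, ← mul_add, ← mul_add]
      refine mul_le_mul_right ?_ _
      have hcM := hp c hc
      by_cases h1 : c < rem
      · simp only [if_pos h1]
        refine (add_le_add (ih _ _) le_rfl).trans ?_
        rw [smallMass_cons, add_assoc _ (κ * _) (κ * _), ← mul_add, ← Nat.cast_add]
        have : ((rem - c + M : ℕ) : ℝ≥0∞) + c = (rem + M : ℕ) := by
          rw [← Nat.cast_add]
          congr 1
          omega
        rw [← Nat.cast_add, Nat.cast_add (rem - c + M) c, this]
        apply le_of_eq
        push_cast
        ring
      simp only [if_neg h1]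
      refine le_trans ?_ le_self_add
      refine add_le_add ?_ (mul_le_mul_right (by exact_mod_cast (by omega)) _)
      refine tsum_mul_le_of_forall_support _ _ _ fun C hC => ?_
      split_ifs at hC with h2
      · rw [PMF.mem_support_pure_iff] at hC
        rw [hC, smallMass_cons]
        have : (if rem ≤ m then rem else 0) ≤ m := by split_ifs <;> omega
        exact_mod_cast (by omega)
      · have := (mem_support_bumpRandom hC).2.1 m
        exact_mod_cast (by omega)
    calc _ = ∑' c, (p c * (∑' C, (if c < rem then growCommunities p s fuel (rem - c) (c :: acc)
            else if s ≤ rem then PMF.pure (rem :: acc) else bumpRandom rem acc : PMF (List ℕ)) C *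
          (smallMass m C : ℝ≥0∞)) + κ * (p c * (c : ℝ≥0∞))) := by
          rw [ENNReal.tsum_add, ENNReal.tsum_mul_left]
      _ ≤ _ := ENNReal.tsum_le_tsum hstep
      _ = (smallMass m acc + (m + s : ℕ) + κ * (rem + M : ℕ)) +
          ∑' c, p c * ((if c ≤ m then c else 0 : ℕ) : ℝ≥0∞) := by
          rw [ENNReal.tsum_add, ENNReal.tsum_mul_right, p.tsum_coe, one_mul]
      _ ≤ _ := by gcongr

/-- Markov's inequality. -/
theorem mul_toOuterMeasure_lt_le {α : Type} (p : PMF α) (g : α → ℕ) (T : ℕ) :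
    (T : ℝ≥0∞) * p.toOuterMeasure {x | T < g x} ≤ ∑' x, p x * (g x : ℝ≥0∞) := by
  rw [PMF.toOuterMeasure_apply, ← ENNReal.tsum_mul_left]
  refine ENNReal.tsum_le_tsum fun x => ?_
  by_cases h : T < g x
  · rw [Set.indicator_of_mem (by exact h), mul_comm]
    gcongr
  · rw [Set.indicator_of_notMem (by exact h), mul_zero]
    exact zero_le

namespace ABCDParams

/-- The probability that the communities violate the bounds used in `sandwich_of_bounds`. -/
theorem communities_bad_le {P : ABCDParams} (hs : 0 < P.s) {n : ℕ} (hM : P.s ≤ P.maxSize n)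
    (hn : P.s * (P.maxSize n + 1) ≤ n) {m T : ℕ} {κ : ℝ≥0∞} (hκ : κ ≠ ⊤)
    (hκp : ∑' c, tpl P.β P.s (P.maxSize n) c * ((if c ≤ m then c else 0 : ℕ) : ℝ≥0∞) ≤
      κ * ∑' c, tpl P.β P.s (P.maxSize n) c * (c : ℝ≥0∞)) :
    (T : ℝ≥0∞) * (P.communities n).toOuterMeasure
      {C | ¬ (C.sum = n ∧ (∀ c ∈ C, P.s ≤ c ∧ c ≤ P.maxSize n + 1) ∧ smallMass m C ≤ T)} ≤
      (m + P.s : ℕ) + κ * (n + P.maxSize n : ℕ) := by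
  set p := tpl P.β P.s (P.maxSize n) with hpdef
  have hp : ∀ c ∈ p.support, P.s ≤ c ∧ c ≤ P.maxSize n := fun c hc => (support_tpl hs hM c).1 hc
  have hn0 : 0 < n := lt_of_lt_of_le (Nat.mul_pos hs (Nat.succ_pos _)) hn
  refine le_trans ?_ ((mul_toOuterMeasure_lt_le (growCommunities p P.s n n []) (smallMass m)
    T).trans ((tsum_growCommunities_mul_smallMass_le hκ (fun c hc => (hp c hc).2) hκp n n
      []).trans (by simp [smallMass])))
  refine mul_le_mul_right ?_ _
  rw [communities, PMF.toOuterMeasure_map_apply]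
  refine PMF.toOuterMeasure_mono _ fun C hC => ?_
  have hsupp := mem_support_growCommunities hs hp hn n n [] C hn0 le_rfl (by simp) (by simp) hC.2
  have hperm := List.perm_insertionSort (· ≥ ·) C
  by_contra hcon
  refine hC.1 ⟨hperm.sum_eq.trans hsupp.1, fun c hc => hsupp.2 c (hperm.mem_iff.1 hc), ?_⟩
  rw [smallMass_perm m hperm]
  exact not_lt.1 hcon

end ABCDParams

/-! ### Estimates for truncated power laws -/

theorem powInt_eq {γ a b : ℝ} (hγ : γ ≠ 1) (ha : 0 < a) (hab : a ≤ b) :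
    powInt γ a b = (b ^ (1 - γ) - a ^ (1 - γ)) / (1 - γ) := by
  rw [powInt, integral_rpow]
  · rw [neg_add_eq_sub]
  · refine Or.inr ⟨fun h => hγ (by linarith), ?_⟩
    rw [Set.uIcc_of_le hab]
    exact fun h => absurd h.1 (not_le.2 ha)

theorem powInt_mono_right (γ : ℝ) {a b c : ℝ} (ha : 0 < a) (hab : a ≤ b) (hbc : b ≤ c) :
    powInt γ a b ≤ powInt γ a c := by
  have h : powInt γ a b + powInt γ b c = powInt γ a c :=
    intervalIntegral.integral_add_adjacent_intervals (powInt_integrable γ ha hab)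
      (powInt_integrable γ (ha.trans_le hab) hbc)
  have h2 : 0 ≤ powInt γ b c := intervalIntegral.integral_nonneg hbc fun x hx =>
    Real.rpow_nonneg ((ha.trans_le hab).le.trans hx.1) _
  linarith

/-- The minimum `δ` has a probability bounded away from `0`, uniformly in the truncation. -/
theorem exists_minimum_mass {γ : ℝ} (hγ : 1 < γ) {δ : ℕ} (hδ : 0 < δ) :
    ∃ p₀ : ℝ, 0 < p₀ ∧ ∀ Δ : ℕ, δ ≤ Δ → p₀ * powInt γ δ (Δ + 1) ≤ powInt γ δ (δ + 1) := by
  have hδ' : (0 : ℝ) < δ := by exact_mod_cast hδ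
  have hc : 0 < (δ : ℝ) ^ (1 - γ) / (γ - 1) := div_pos (Real.rpow_pos_of_pos hδ' _) (by linarith)
  have hA := powInt_nat_pos γ hδ
  refine ⟨powInt γ δ (δ + 1) / ((δ : ℝ) ^ (1 - γ) / (γ - 1)), div_pos hA hc, fun Δ hΔ => ?_⟩
  have hle : (δ : ℝ) ≤ (Δ : ℝ) + 1 := by
    have : (δ : ℝ) ≤ Δ := by exact_mod_cast hΔ
    linarith
  have hT : powInt γ δ (Δ + 1) ≤ (δ : ℝ) ^ (1 - γ) / (γ - 1) := by
    rw [powInt_eq hγ.ne' hδ' hle, ← neg_div_neg_eq, neg_sub, neg_sub]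
    have : 0 ≤ ((Δ : ℝ) + 1) ^ (1 - γ) := by positivity
    gcongr
    linarith
  rw [div_mul_eq_mul_div, div_le_iff₀ hc]
  exact mul_le_mul_of_nonneg_left hT hA.le

theorem tpl_minimum (γ : ℝ) {δ Δ : ℕ} (hδ : 0 < δ) (h : δ ≤ Δ) :
    tpl γ δ Δ δ = ENNReal.ofReal (powInt γ δ (δ + 1) / powInt γ δ (Δ + 1)) := by
  rw [tpl_apply hδ h, if_pos (Finset.mem_Icc.2 ⟨le_rfl, h⟩)]

/-- The probability of the minimum `δ` is bounded away from `1` if the truncation is above `δ`. -/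
theorem exists_minimum_mass_lt_one (γ : ℝ) {δ : ℕ} (hδ : 0 < δ) :
    ∃ p₁ : ℝ, 0 ≤ p₁ ∧ p₁ < 1 ∧ ∀ Δ : ℕ, δ + 1 ≤ Δ → tpl γ δ Δ δ ≤ ENNReal.ofReal p₁ := by
  have hδ' : (0 : ℝ) < δ := by exact_mod_cast hδ
  have hA := powInt_nat_pos γ hδ
  have hadd : powInt γ δ (δ + 1) + powInt γ (δ + 1) (δ + 1 + 1) = powInt γ δ (δ + 1 + 1) :=
    intervalIntegral.integral_add_adjacent_intervals
      (powInt_integrable γ hδ' (by linarith)) (powInt_integrable γ (by linarith) (by linarith))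
  have hB : 0 < powInt γ ((δ : ℝ) + 1) (δ + 1 + 1) := powInt_pos γ (by linarith) (by linarith)
  have hT : 0 < powInt γ δ ((δ : ℝ) + 1 + 1) := by linarith
  refine ⟨powInt γ δ (δ + 1) / powInt γ δ (δ + 1 + 1), (div_pos hA hT).le,
    (div_lt_one hT).2 (by linarith), fun Δ hΔ => ?_⟩
  rw [tpl_minimum γ hδ (by omega)]
  refine ENNReal.ofReal_le_ofReal ?_
  have : (δ : ℝ) + 1 ≤ Δ := by exact_mod_cast hΔ
  exact div_le_div_of_nonneg_left hA.le hT
    (powInt_mono_right γ hδ' (by linarith) (by linarith))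

/-- The perturbed truncated power law differs from the original one by a factor `1 + O(ε)`. -/
theorem abs_perturbedTPL_sub_tpl_le {γ : ℝ} {δ Δ k : ℕ} {ε : ℝ} (hδ : 0 < δ) (hk : δ ≤ k)
    (hkΔ : k ≤ Δ) (hε0 : 0 ≤ ε) (hε : ε ≤ 1 / 2) :
    |(perturbedTPL γ δ Δ ε k).toReal - (tpl γ δ Δ k).toReal| ≤ 2 * ε * (tpl γ δ Δ k).toReal := by
  have hδΔ := hk.trans hkΔ
  have hmem : k ∈ Finset.Icc δ Δ := Finset.mem_Icc.2 ⟨hk, hkΔ⟩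
  have hw := powInt_nat_pos γ (hδ.trans_le hk)
  have hA := powInt_nat_pos γ hδ
  have hT := powInt_total_pos γ hδ hδΔ
  have hT' := perturbed_total_pos γ hδ hδΔ (ε := ε) (by linarith)
  have hle : ((δ : ℝ) + 1) ≤ Δ + 1 := by
    have : (δ : ℝ) ≤ Δ := by exact_mod_cast hδΔ
    linarith
  have hδ' : (0 : ℝ) < δ := by exact_mod_cast hδ
  have hadd : powInt γ δ (δ + 1) + powInt γ (δ + 1) (Δ + 1) = powInt γ δ (Δ + 1) :=
    intervalIntegral.integral_add_adjacent_intervals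
      (powInt_integrable γ hδ' (by linarith)) (powInt_integrable γ (by linarith) hle)
  have hAT : powInt γ δ (δ + 1) ≤ powInt γ δ (Δ + 1) := powInt_mono_right γ hδ' (by linarith) hle
  have hi : 0 ≤ (if k = δ then ε else 0) ∧ (if k = δ then ε else 0) ≤ ε := by
    split_ifs <;> constructor <;> linarith
  set i := if k = δ then ε else 0 with hidef
  rw [perturbedTPL_apply hδ hδΔ hε0 (by linarith), tpl_apply hδ hδΔ, if_pos hmem, if_pos hmem,
    ENNReal.toReal_ofReal (div_nonneg (mul_nonneg (by linarith [hi.2]) hw.le) hT'.le),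
    ENNReal.toReal_ofReal (div_nonneg hw.le hT.le)]
  have hQ : (1 - ε) * powInt γ δ (δ + 1) + powInt γ (δ + 1) (Δ + 1) =
      powInt γ δ (Δ + 1) - ε * powInt γ δ (δ + 1) := by linarith
  rw [hQ] at hT' ⊢
  set A := powInt γ δ (δ + 1)
  set T := powInt γ δ (Δ + 1)
  set w := powInt γ k (k + 1)
  have e : (1 - i) * w / (T - ε * A) - w / T = (ε * A - i * T) / (T - ε * A) * (w / T) := by
    field_simp
    ring
  rw [e, abs_mul, abs_of_nonneg (div_nonneg hw.le hT.le)]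
  refine mul_le_mul_of_nonneg_right ?_ (div_nonneg hw.le hT.le)
  rw [abs_div, abs_of_pos hT', div_le_iff₀ hT', abs_le]
  have h1 : ε * A ≤ ε * T := mul_le_mul_of_nonneg_left hAT hε0
  have h2 : i * T ≤ ε * T := mul_le_mul_of_nonneg_right hi.2 hT.le
  have h3 : 0 ≤ i * T := mul_nonneg hi.1 hT.le
  have h4 : 0 ≤ ε * A := mul_nonneg hε0 hA.le
  have h5 : 2 * ε * (ε * A) ≤ ε * T := by
    have : 2 * ε * (ε * A) ≤ 1 * (ε * A) := mul_le_mul_of_nonneg_right (by linarith) h4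
    linarith
  constructor <;> nlinarith

/-! ### Concentration of the number of nodes of minimum degree -/

open Classical in
/-- A lower tail estimate for the number of occurrences of `δ`, by the exponential moment
`E exp (-count)`. -/
theorem iidPMF_count_lt_le {p : PMF ℕ} {δ : ℕ} {p₀ : ℝ} (hp₀ : 0 ≤ p₀)
    (hp : ENNReal.ofReal p₀ ≤ p δ) (n b : ℕ) :
    (iidPMF p n).toOuterMeasure {x | (Finset.univ.filter fun i => x i = δ).card < b} ≤
      ENNReal.ofReal (Real.exp (b - n * (p₀ / 2))) := by
  have he : Real.exp (-1) ≤ 1 / 2 := by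
    rw [Real.exp_neg, inv_eq_one_div]
    have := Real.add_one_le_exp 1
    exact one_div_le_one_div_of_le (by norm_num) (by linarith)
  set g : ℕ → ℝ≥0∞ := fun a => if a = δ then ENNReal.ofReal (Real.exp (-1)) else 1 with hg
  have hsingle : ∑' a, p a * g a ≤ ENNReal.ofReal (Real.exp (-(p₀ / 2))) := by
    have h1 : ∑' a, p a * g a + p δ * ENNReal.ofReal (1 - Real.exp (-1)) = 1 := by
      rw [← tsum_ite_eq δ (fun _ => p δ * ENNReal.ofReal (1 - Real.exp (-1))), ← ENNReal.tsum_add,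
        ← p.tsum_coe]
      refine tsum_congr fun a => ?_
      by_cases ha : a = δ
      · subst ha
        simp only [hg, if_true]
        rw [← mul_add, ← ENNReal.ofReal_add (Real.exp_pos _).le (by linarith), add_sub_cancel,
          ENNReal.ofReal_one, mul_one]
      · simp [hg, ha]
    have h2 : ENNReal.ofReal (p₀ / 2) ≤ p δ * ENNReal.ofReal (1 - Real.exp (-1)) := by
      calc ENNReal.ofReal (p₀ / 2) ≤ ENNReal.ofReal (p₀ * (1 - Real.exp (-1))) :=
            ENNReal.ofReal_le_ofReal (by nlinarith)
        _ = ENNReal.ofReal p₀ * ENNReal.ofReal (1 - Real.exp (-1)) := ENNReal.ofReal_mul hp₀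
        _ ≤ _ := by gcongr
    have h3 : ∑' a, p a * g a + ENNReal.ofReal (p₀ / 2) ≤ 1 := by
      rw [← h1]; gcongr
    refine (ENNReal.le_sub_of_add_le_right ENNReal.ofReal_ne_top h3).trans ?_
    rw [← ENNReal.ofReal_one, ← ENNReal.ofReal_sub _ (by positivity)]
    refine ENNReal.ofReal_le_ofReal ?_
    have := Real.add_one_le_exp (-(p₀ / 2))
    linarith
  have hmarkov : ENNReal.ofReal (Real.exp (-(b : ℝ))) * (iidPMF p n).toOuterMeasure
      {x | (Finset.univ.filter fun i => x i = δ).card < b} ≤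
        ∑' x, iidPMF p n x * ∏ i, g (x i) := by
    rw [PMF.toOuterMeasure_apply, ← ENNReal.tsum_mul_left]
    refine ENNReal.tsum_le_tsum fun x => ?_
    by_cases hx : (Finset.univ.filter fun i => x i = δ).card < b
    · rw [Set.indicator_of_mem (by exact hx), mul_comm]
      refine mul_le_mul_right ?_ _
      have : ∏ i, g (x i) = ENNReal.ofReal (Real.exp
          (-((Finset.univ.filter fun i => x i = δ).card : ℝ))) := by
        simp only [hg]
        rw [Finset.prod_ite, Finset.prod_const, Finset.prod_const_one, mul_one,
          ← ENNReal.ofReal_pow (Real.exp_pos _).le, ← Real.exp_nat_mul, mul_neg_one]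
      rw [this]
      refine ENNReal.ofReal_le_ofReal (Real.exp_le_exp.2 (neg_le_neg ?_))
      exact_mod_cast hx.le
    · rw [Set.indicator_of_notMem (by exact hx), mul_zero]
      exact zero_le
  rw [tsum_iidPMF_mul_prod] at hmarkov
  have h4 := hmarkov.trans (pow_le_pow_left' hsingle n)
  rw [← ENNReal.ofReal_pow (Real.exp_pos _).le, ← Real.exp_nat_mul] at h4
  have h5 := mul_le_mul_right h4 (ENNReal.ofReal (Real.exp (b : ℝ)))
  rw [← mul_assoc, ← ENNReal.ofReal_mul (Real.exp_pos _).le, ← Real.exp_add, add_neg_cancel,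
    Real.exp_zero, ENNReal.ofReal_one, one_mul, ← ENNReal.ofReal_mul (Real.exp_pos _).le,
    ← Real.exp_add] at h5
  rw [show (b : ℝ) - n * (p₀ / 2) = b + n * -(p₀ / 2) by ring]
  exact h5

open Classical in
/-- The degrees for which the comparison of the models fails: too few of them, or all of them, are
equal to the minimum. -/
theorem iidPMF_bad_le {p : PMF ℕ} {δ : ℕ} {p₀ p₁ : ℝ} (hp₀ : 0 ≤ p₀) (hp₁ : 0 ≤ p₁)
    (hp : ENNReal.ofReal p₀ ≤ p δ) (hp' : p δ ≤ ENNReal.ofReal p₁) {n b : ℕ}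
    (hb : (b : ℝ) ≤ n * (p₀ / 4)) :
    (iidPMF p n).toOuterMeasure
      {x | (Finset.univ.filter fun i => x i = δ).card < b ∨ ∀ i, x i = δ} ≤
      ENNReal.ofReal (Real.exp (-(p₀ / 4)) ^ n + p₁ ^ n) := by
  rw [ENNReal.ofReal_add (by positivity) (by positivity)]
  refine (MeasureTheory.measure_union_le (μ := (iidPMF p n).toOuterMeasure)
    {x | (Finset.univ.filter fun i => x i = δ).card < b} {x | ∀ i, x i = δ}).trans
    (add_le_add ?_ ?_)
  · refine (iidPMF_count_lt_le hp₀ hp n b).trans (ENNReal.ofReal_le_ofReal ?_)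
    rw [← Real.exp_nat_mul]
    exact Real.exp_le_exp.2 (by linarith)
  · have : {x : Fin n → ℕ | ∀ i, x i = δ} = {fun _ => δ} := by
      ext x
      exact ⟨fun h => funext h, fun h i => congrFun h i⟩
    rw [this, PMF.toOuterMeasure_apply_singleton, iidPMF_apply, Finset.prod_const,
      Finset.card_univ, Fintype.card_fin, ENNReal.ofReal_pow hp₁]
    exact pow_le_pow_left' hp' n

/-! ### The share of the small communities -/

/-- On `[k, k + 1]` the functions `k * x ^ (-β)` and `x ^ (1 - β)` agree up to a factor `2`. -/
theorem mul_powInt_le {β : ℝ} {k : ℕ} (hk : 0 < k) :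
    (k : ℝ) * powInt β k (k + 1) ≤ powInt (β - 1) k (k + 1) ∧
      powInt (β - 1) k (k + 1) ≤ 2 * (k * powInt β k (k + 1)) := by
  have hk' : (0 : ℝ) < k := by exact_mod_cast hk
  have hk1 : (1 : ℝ) ≤ k := by exact_mod_cast hk
  have hle : (k : ℝ) ≤ k + 1 := by linarith
  have hI : ∀ γ : ℝ, IntervalIntegrable (fun x : ℝ => x ^ (-γ)) MeasureTheory.volume k (k + 1) :=
    fun γ => powInt_integrable γ hk' hle
  have hx : ∀ x ∈ Set.Icc (k : ℝ) (k + 1), x ^ (-(β - 1)) = x * x ^ (-β) := fun x hx => by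
    have hx0 : 0 < x := hk'.trans_le hx.1
    rw [show -(β - 1) = 1 + -β by ring, Real.rpow_add hx0, Real.rpow_one]
  constructor
  · rw [powInt, powInt, ← intervalIntegral.integral_const_mul]
    refine intervalIntegral.integral_mono_on hle ((hI β).const_mul _) (hI _) fun x hx' => ?_
    rw [hx x hx']
    exact mul_le_mul_of_nonneg_right hx'.1 (Real.rpow_nonneg (hk'.le.trans hx'.1) _)
  · rw [powInt, powInt, ← mul_assoc, ← intervalIntegral.integral_const_mul]
    refine intervalIntegral.integral_mono_on hle (hI _) ((hI β).const_mul _) fun x hx' => ?_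
    rw [hx x hx']
    exact mul_le_mul_of_nonneg_right (by linarith [hx'.2])
      (Real.rpow_nonneg (hk'.le.trans hx'.1) _)

theorem powInt_sub_one_eq {β : ℝ} (hβ : β < 2) {s m : ℕ} (hs : 0 < s) (hm : s ≤ m) :
    powInt (β - 1) s (m + 1) = (((m : ℝ) + 1) ^ (2 - β) - (s : ℝ) ^ (2 - β)) / (2 - β) := by
  have hsm : (s : ℝ) ≤ m := by exact_mod_cast hm
  rw [powInt_eq (by linarith) (by exact_mod_cast hs) (by linarith),
    show 1 - (β - 1) = 2 - β by ring]

/-- The mean of the community size restricted to sizes at most `m` is at most `κ` times its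
mean. -/
theorem tsum_tpl_small_le {β : ℝ} (hβ : β < 2) {s M m : ℕ} (hs : 0 < s) (hM : s ≤ M) {κ : ℝ}
    (hκ : 0 ≤ κ) (h : ((m : ℝ) + 1) ^ (2 - β) ≤
      κ * ((((M : ℝ) + 1) ^ (2 - β) - (s : ℝ) ^ (2 - β)) / 2)) :
    ∑' c, tpl β s M c * ((if c ≤ m then c else 0 : ℕ) : ℝ≥0∞) ≤
      ENNReal.ofReal κ * ∑' c, tpl β s M c * (c : ℝ≥0∞) := by
  have hT := powInt_total_pos β hs hM
  have hpos : ∀ k ∈ Finset.Icc s M, 0 < powInt β k (k + 1) := fun k hk =>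
    powInt_nat_pos β (hs.trans_le (Finset.mem_Icc.1 hk).1)
  have hθ : 0 < 2 - β := by linarith
  have conv : ∀ w : ℕ → ℕ, ∑' c, tpl β s M c * (w c : ℝ≥0∞) = ENNReal.ofReal
      (∑ k ∈ Finset.Icc s M, powInt β k (k + 1) / powInt β s (M + 1) * w k) := fun w => by
    refine tsum_ofReal (fun k hk => mul_nonneg (div_nonneg (hpos k hk).le hT.le)
      (Nat.cast_nonneg _)) fun k => ?_
    rw [tpl_apply hs hM]
    split_ifs with hk
    · rw [ENNReal.ofReal_mul (div_nonneg (hpos k hk).le hT.le), ENNReal.ofReal_natCast]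
    · rw [zero_mul]
  rw [conv, conv fun c => c, ← ENNReal.ofReal_mul hκ]
  refine ENNReal.ofReal_le_ofReal ?_
  simp only [div_mul_eq_mul_div]
  rw [← Finset.sum_div, ← Finset.sum_div, mul_div_assoc']
  refine div_le_div_of_nonneg_right ?_ hT.le
  have hright : (((M : ℝ) + 1) ^ (2 - β) - (s : ℝ) ^ (2 - β)) / (2 - β) ≤
      2 * ∑ k ∈ Finset.Icc s M, powInt β k (k + 1) * (k : ℝ) := by
    rw [← powInt_sub_one_eq hβ hs hM, ← powInt_sum _ hs hM, Finset.mul_sum]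
    refine Finset.sum_le_sum fun k hk => ?_
    rw [mul_comm (powInt β k (k + 1))]
    exact (mul_powInt_le (hs.trans_le (Finset.mem_Icc.1 hk).1)).2
  have hleft : ∑ k ∈ Finset.Icc s M, powInt β k (k + 1) * ((if k ≤ m then k else 0 : ℕ) : ℝ) ≤
      ((m : ℝ) + 1) ^ (2 - β) / (2 - β) := by
    rcases lt_or_ge m s with hms | hms
    · rw [Finset.sum_eq_zero]
      · positivity
      · intro k hk
        rw [if_neg (by have := (Finset.mem_Icc.1 hk).1; omega), Nat.cast_zero, mul_zero]
    · calc _ ≤ ∑ k ∈ Finset.Icc s M, if k ≤ m then powInt (β - 1) k (k + 1) else 0 := by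
            refine Finset.sum_le_sum fun k hk => ?_
            split_ifs
            · rw [mul_comm]
              exact (mul_powInt_le (hs.trans_le (Finset.mem_Icc.1 hk).1)).1
            · simp
        _ = ∑ k ∈ Finset.Icc s M with k ≤ m, powInt (β - 1) k (k + 1) := by
            rw [Finset.sum_filter]
        _ ≤ ∑ k ∈ Finset.Icc s m, powInt (β - 1) k (k + 1) := by
            refine Finset.sum_le_sum_of_subset_of_nonneg (fun k hk => ?_) fun k hk _ =>
              (powInt_nat_pos _ (hs.trans_le (Finset.mem_Icc.1 hk).1)).le
            rw [Finset.mem_filter, Finset.mem_Icc] at hk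
            exact Finset.mem_Icc.2 ⟨hk.1.1, hk.2⟩
        _ ≤ _ := by
            rw [powInt_sum _ hs hms, powInt_sub_one_eq hβ hs hms]
            have : 0 ≤ (s : ℝ) ^ (2 - β) := by positivity
            gcongr
            linarith
  calc _ ≤ ((m : ℝ) + 1) ^ (2 - β) / (2 - β) := hleft
    _ ≤ κ * ((((M : ℝ) + 1) ^ (2 - β) - (s : ℝ) ^ (2 - β)) / 2) / (2 - β) := by gcongr
    _ = κ * ((((M : ℝ) + 1) ^ (2 - β) - (s : ℝ) ^ (2 - β)) / (2 - β) / 2) := by ring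
    _ ≤ _ := by
      refine mul_le_mul_of_nonneg_left ?_ hκ
      linarith

/-! ### Asymptotics -/

theorem tendsto_natCast_rpow_zero {a : ℝ} (ha : a < 0) :
    Tendsto (fun n : ℕ => (n : ℝ) ^ a) atTop (𝓝 0) := by
  have := (tendsto_rpow_neg_atTop (neg_pos.2 ha)).comp tendsto_natCast_atTop_atTop
  simpa [Function.comp_def] using this

theorem tendsto_floor_natCast_rpow {a : ℝ} (ha : 0 < a) :
    Tendsto (fun n : ℕ => ⌊(n : ℝ) ^ a⌋₊) atTop atTop :=
  tendsto_nat_floor_atTop.comp ((tendsto_rpow_atTop ha).comp tendsto_natCast_atTop_atTop)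

namespace ABCDParams

variable {P : ABCDParams}

/-- A bound tending to `0` for the probability that some size is out of bounds, or that more than
`c ε(n) n` nodes belong to communities of size at most `n^ζ`. -/
theorem communities_bad_le_ofReal (hβ1 : 1 < P.β) (hβ2 : P.β < 2) (hs : 0 < P.s)
    (hζ : 0 < P.ζ) (hτ : P.ζ < P.τ) (hτ1 : P.τ < 1) {c : ℝ} (hc : 0 < c) {n : ℕ} (hn1 : 1 ≤ n)
    (hM : P.s ≤ P.maxSize n) (hn : P.s * (P.maxSize n + 1) ≤ n)
    (hsθ : (P.s : ℝ) ^ (2 - P.β) ≤ (n : ℝ) ^ (P.τ * (2 - P.β)) / 2)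
    (hlarge : 2 ≤ c * P.eps n * n) :
    (P.communities n).toOuterMeasure {C | ¬ (C.sum = n ∧
        (∀ d ∈ C, P.s ≤ d ∧ d ≤ P.maxSize n + 1) ∧
          smallMass (P.maxDeg n) C ≤ ⌊c * P.eps n * n⌋₊)} ≤
      ENNReal.ofReal (2 / c * ((n : ℝ) ^ (P.ζ - 1 + (P.τ - P.ζ) * (2 - P.β) / 2) +
        P.s * (n : ℝ) ^ ((P.τ - P.ζ) * (2 - P.β) / 2 - 1) + 16 * P.eps n)) := by
  have hn0 : (0 : ℝ) < n := by exact_mod_cast hn1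
  have hn1' : (1 : ℝ) ≤ n := by exact_mod_cast hn1
  have hθ0 : 0 < 2 - P.β := by linarith
  have hε0 : 0 < P.eps n := Real.rpow_pos_of_pos hn0 _
  have hmζ : (P.maxDeg n : ℝ) ≤ (n : ℝ) ^ P.ζ := Nat.floor_le (by positivity)
  have hMτ : (P.maxSize n : ℝ) ≤ (n : ℝ) ^ P.τ := Nat.floor_le (by positivity)
  have hMτ' : (n : ℝ) ^ P.τ ≤ (P.maxSize n : ℝ) + 1 := (Nat.lt_floor_add_one _).le
  have hMn : (P.maxSize n : ℝ) ≤ n := hMτ.trans (by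
    simpa using Real.rpow_le_rpow_of_exponent_le hn1' hτ1.le)
  have hζ1 : 1 ≤ (n : ℝ) ^ P.ζ := Real.one_le_rpow hn1' hζ.le
  have hκ : ((P.maxDeg n : ℝ) + 1) ^ (2 - P.β) ≤ 8 * P.eps n ^ 2 *
      ((((P.maxSize n : ℝ) + 1) ^ (2 - P.β) - (P.s : ℝ) ^ (2 - P.β)) / 2) := by
    have h1 : ((P.maxDeg n : ℝ) + 1) ^ (2 - P.β) ≤ 2 * (n : ℝ) ^ (P.ζ * (2 - P.β)) := by
      calc ((P.maxDeg n : ℝ) + 1) ^ (2 - P.β) ≤ (2 * (n : ℝ) ^ P.ζ) ^ (2 - P.β) := by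
            gcongr; linarith
        _ = 2 ^ (2 - P.β) * (n : ℝ) ^ (P.ζ * (2 - P.β)) := by
            rw [Real.mul_rpow (by norm_num) (by positivity), ← Real.rpow_mul hn0.le]
        _ ≤ 2 ^ (1 : ℝ) * (n : ℝ) ^ (P.ζ * (2 - P.β)) := by
            gcongr
            · norm_num
            · linarith
        _ = _ := by rw [Real.rpow_one]
    have h2 : (n : ℝ) ^ (P.τ * (2 - P.β)) ≤ ((P.maxSize n : ℝ) + 1) ^ (2 - P.β) := by
      rw [Real.rpow_mul hn0.le]
      gcongr
    have h3 : P.eps n ^ 2 * (n : ℝ) ^ (P.τ * (2 - P.β)) = (n : ℝ) ^ (P.ζ * (2 - P.β)) := by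
      rw [eps, ← Real.rpow_natCast, ← Real.rpow_mul hn0.le, ← Real.rpow_add hn0]
      congr 1
      push_cast
      ring
    calc _ ≤ 2 * (n : ℝ) ^ (P.ζ * (2 - P.β)) := h1
      _ = 8 * P.eps n ^ 2 * ((n : ℝ) ^ (P.τ * (2 - P.β)) / 2 / 2) := by rw [← h3]; ring
      _ ≤ _ := by
        gcongr
        linarith
  have hmain := communities_bad_le (P := P) hs hM hn (m := P.maxDeg n) (T := ⌊c * P.eps n * n⌋₊)
    ENNReal.ofReal_ne_top (tsum_tpl_small_le hβ2 hs hM (by positivity) hκ)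
  have hT : c * P.eps n * n / 2 ≤ (⌊c * P.eps n * n⌋₊ : ℝ) := by
    have := Nat.lt_floor_add_one (c * P.eps n * n)
    linarith
  have hX : 0 < c * P.eps n * n / 2 := by positivity
  have hY : ((P.maxDeg n + P.s : ℕ) : ℝ≥0∞) + ENNReal.ofReal (8 * P.eps n ^ 2) *
      ((n + P.maxSize n : ℕ) : ℝ≥0∞) ≤
        ENNReal.ofReal ((n : ℝ) ^ P.ζ + P.s + 16 * P.eps n ^ 2 * n) := by
    rw [← ENNReal.ofReal_natCast, ← ENNReal.ofReal_natCast, ← ENNReal.ofReal_mul (by positivity),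
      ← ENNReal.ofReal_add (by positivity) (by positivity)]
    refine ENNReal.ofReal_le_ofReal ?_
    push_cast
    have h4 : 8 * P.eps n ^ 2 * ((n : ℝ) + P.maxSize n) ≤ 8 * P.eps n ^ 2 * (n + n) := by gcongr
    linarith
  have heq : 2 / c * ((n : ℝ) ^ (P.ζ - 1 + (P.τ - P.ζ) * (2 - P.β) / 2) +
        P.s * (n : ℝ) ^ ((P.τ - P.ζ) * (2 - P.β) / 2 - 1) + 16 * P.eps n) =
      ((n : ℝ) ^ P.ζ + P.s + 16 * P.eps n ^ 2 * n) / (c * P.eps n * n / 2) := by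
    have e1 : (n : ℝ) ^ (P.ζ - 1 + (P.τ - P.ζ) * (2 - P.β) / 2) =
        (n : ℝ) ^ P.ζ / (n * P.eps n) := by
      rw [eps, ← Real.rpow_one_add' hn0.le (by nlinarith), ← Real.rpow_sub hn0]
      congr 1
      ring
    have e2 : (n : ℝ) ^ ((P.τ - P.ζ) * (2 - P.β) / 2 - 1) = 1 / (n * P.eps n) := by
      rw [eps, ← Real.rpow_one_add' hn0.le (by nlinarith), one_div, ← Real.rpow_neg hn0.le]
      congr 1
      ring
    rw [e1, e2]
    field_simp
  rw [heq, ENNReal.ofReal_div_of_pos hX, ENNReal.le_div_iff_mul_le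
    (Or.inl (ENNReal.ofReal_pos.2 hX).ne') (Or.inl ENNReal.ofReal_ne_top), mul_comm]
  refine le_trans ?_ (hmain.trans hY)
  gcongr
  rw [← ENNReal.ofReal_natCast]
  exact ENNReal.ofReal_le_ofReal hT

theorem tendsto_eps (hβ2 : P.β < 2) (hτ : P.ζ < P.τ) : Tendsto P.eps atTop (𝓝 0) :=
  tendsto_natCast_rpow_zero (by
    have := mul_pos (sub_pos.2 hτ) (sub_pos.2 hβ2)
    linarith)

end ABCDParams

theorem mainTheorem1 (P : ABCDParams)
    (hγ2 : 2 < P.γ) (hγ3 : P.γ < 3)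
    (hδ : 0 < P.δ)
    (hζ0 : 0 < P.ζ) (hζ1 : P.ζ ≤ 1 / (P.γ - 1))
    (hβ1 : 1 < P.β) (hβ2 : P.β < 2)
    (hs : P.δ < P.s)
    (hτζ : P.ζ < P.τ) (hτ1 : P.τ < 1)
    (hξ0 : 0 < P.ξ) (hξ1 : P.ξ < 1) :
    Tendsto P.eps atTop (𝓝 0) ∧
    ∃ η : ℕ → ℝ, Tendsto η atTop (𝓝 0) ∧
      (∀ᶠ n in atTop, ∀ Δ k : ℕ, P.δ ≤ k → k ≤ Δ →
        |(perturbedTPL P.γ P.δ Δ (P.eps n) k).toReal - (tpl P.γ P.δ Δ k).toReal| ≤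
          η n * (tpl P.γ P.δ Δ k).toReal) ∧
      Tendsto (fun n : ℕ => (P.communities n).toOuterMeasure
        {C | ∀ j : Fin C.length, P.SandwichRaw n (η n) C j ∧ P.SandwichAltered n (η n) C j})
        atTop (𝓝 1) := by
  have hε := P.tendsto_eps hβ2 hτζ
  refine ⟨hε, ?_⟩
  obtain ⟨p₀, hp₀, hp₀le⟩ := exists_minimum_mass (γ := P.γ) (by linarith) hδ
  obtain ⟨p₁, hp₁0, hp₁1, hp₁⟩ := exists_minimum_mass_lt_one P.γ hδ
  have hs0 : 0 < P.s := hδ.trans hs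
  have hp₀1 : p₀ ≤ 1 := by
    have h1 := hp₀le P.δ le_rfl
    have h2 := powInt_nat_pos P.γ hδ
    exact le_of_mul_le_mul_right (by linarith) h2
  -- At most `c ε n` nodes may be in small communities. With at least `K ≥ n p₀ / 8` choices, this
  -- makes the total growth of the weights at most `exp (c ε n / K) ≤ exp (ε p₀)`.
  set c : ℝ := p₀ ^ 2 / 8 with hcdef
  have hc : 0 < c := by positivity
  set t : ℕ → ℝ := fun n => Real.exp (-(p₀ / 4)) ^ n + p₁ ^ n with ht
  have ht0 : ∀ n, 0 ≤ t n := fun n => by positivity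
  have ht_tendsto : Tendsto t atTop (𝓝 0) := by
    have h1 := tendsto_pow_atTop_nhds_zero_of_lt_one (Real.exp_pos (-(p₀ / 4))).le
      (Real.exp_lt_one_iff.2 (by linarith))
    have h2 := tendsto_pow_atTop_nhds_zero_of_lt_one hp₁0 hp₁1
    simpa using h1.add h2
  have hτlim := tendsto_natCast_rpow_zero (a := P.τ - 1) (by linarith)
  have hinv := tendsto_natCast_rpow_zero (a := -1) (by norm_num)
  have hcε : Tendsto (fun n => c * P.eps n) atTop (𝓝 0) := by simpa using hε.const_mul c
  set ρ : ℕ → ℝ := fun n => (n : ℝ) ^ (P.τ - 1) + (n : ℝ) ^ (-1 : ℝ) + c * P.eps n with hρ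
  have hρlim : Tendsto ρ atTop (𝓝 0) := by simpa using (hτlim.add hinv).add hcε
  set η : ℕ → ℝ := fun n => 2 * P.eps n + (8 / p₀ * ρ n + 2 * t n) with hη
  have hηlim : Tendsto η atTop (𝓝 0) := by
    simpa using (hε.const_mul 2).add ((hρlim.const_mul (8 / p₀)).add (ht_tendsto.const_mul 2))
  have hε0 : ∀ n, 0 ≤ P.eps n := fun n => Real.rpow_nonneg (Nat.cast_nonneg n) _
  have hρ0 : ∀ n, 0 ≤ ρ n := fun n => add_nonneg (by positivity) (mul_nonneg hc.le (hε0 n))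
  have hεhalf : ∀ᶠ n in atTop, P.eps n ≤ 1 / 2 := hε.eventually_le_const (by norm_num)
  refine ⟨η, hηlim, ?_, ?_⟩
  · filter_upwards [hεhalf] with n hn Δ k hk hkΔ
    refine (abs_perturbedTPL_sub_tpl_le hδ hk hkΔ (hε0 n) hn).trans ?_
    refine mul_le_mul_of_nonneg_right ?_ ENNReal.toReal_nonneg
    have := mul_nonneg (div_pos (by norm_num : (0 : ℝ) < 8) hp₀).le (hρ0 n)
    have := ht0 n
    simp only [hη]
    linarith
  set e : ℝ := (P.τ - P.ζ) * (2 - P.β) / 2 with he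
  have he0 : 0 < e := by
    have := mul_pos (sub_pos.2 hτζ) (sub_pos.2 hβ2)
    linarith
  have he1 : e < (1 - P.ζ) / 2 := by
    have : (P.τ - P.ζ) * (2 - P.β) < (P.τ - P.ζ) * 1 :=
      mul_lt_mul_of_pos_left (by linarith) (sub_pos.2 hτζ)
    linarith
  set q : ℕ → ℝ := fun n => 2 / c * ((n : ℝ) ^ (P.ζ - 1 + e) + P.s * (n : ℝ) ^ (e - 1) +
    16 * P.eps n) with hq
  have hqlim : Tendsto q atTop (𝓝 0) := by
    have h1 := tendsto_natCast_rpow_zero (a := P.ζ - 1 + e) (by linarith)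
    have h2 := (tendsto_natCast_rpow_zero (a := e - 1) (by linarith)).const_mul (P.s : ℝ)
    have h3 := hε.const_mul 16
    simpa using ((h1.add h2).add h3).const_mul (2 / c)
  have hlower : Tendsto (fun n => 1 - ENNReal.ofReal (q n)) atTop (𝓝 1) := by
    have h1 : Tendsto (fun n => ENNReal.ofReal (q n)) atTop (𝓝 0) := by
      simpa using ENNReal.tendsto_ofReal hqlim
    have := ENNReal.Tendsto.sub (tendsto_const_nhds (x := (1 : ℝ≥0∞)) (f := atTop)) h1
      (Or.inl ENNReal.one_ne_top)
    simpa using this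
  -- `c ε n → ∞`, so rounding it down loses at most half of it.
  have hlarge : ∀ᶠ n : ℕ in atTop, 2 ≤ c * P.eps n * n := by
    have h1 : Tendsto (fun n : ℕ => (n : ℝ) ^ (1 - e)) atTop atTop :=
      (tendsto_rpow_atTop (by linarith)).comp tendsto_natCast_atTop_atTop
    filter_upwards [h1.eventually_ge_atTop (2 / c), eventually_ge_atTop 1] with n hn hn1
    have hn0 : (0 : ℝ) < n := by exact_mod_cast hn1
    have h2 : (n : ℝ) ^ (1 - e) = P.eps n * n := by
      rw [ABCDParams.eps, sub_eq_neg_add, Real.rpow_add hn0, Real.rpow_one]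
    rw [h2, div_le_iff₀ hc] at hn
    linarith
  have hsθ : ∀ᶠ n : ℕ in atTop,
      (P.s : ℝ) ^ (2 - P.β) ≤ (n : ℝ) ^ (P.τ * (2 - P.β)) / 2 := by
    have h1 : Tendsto (fun n : ℕ => (n : ℝ) ^ (P.τ * (2 - P.β))) atTop atTop :=
      (tendsto_rpow_atTop (mul_pos (hζ0.trans hτζ) (sub_pos.2 hβ2))).comp
        tendsto_natCast_atTop_atTop
    filter_upwards [h1.eventually_ge_atTop (2 * (P.s : ℝ) ^ (2 - P.β))] with n hn
    linarith
  have hrate : ∀ᶠ n : ℕ in atTop,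
      ρ n + 2 * (n : ℝ) ^ (-1 : ℝ) ≤ p₀ / 8 ∧ P.s * ρ n ≤ 1 := by
    have h1 : Tendsto (fun n => ρ n + 2 * (n : ℝ) ^ (-1 : ℝ)) atTop (𝓝 0) := by
      simpa using hρlim.add (hinv.const_mul 2)
    have h2 : Tendsto (fun n => P.s * ρ n) atTop (𝓝 0) := by
      simpa using hρlim.const_mul (P.s : ℝ)
    exact (h1.eventually_le_const (by linarith)).and (h2.eventually_le_const one_pos)
  refine tendsto_of_tendsto_of_tendsto_of_le_of_le' hlower tendsto_const_nhds ?_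
    (Eventually.of_forall fun n => toOuterMeasure_le_one _ _)
  filter_upwards [eventually_ge_atTop 1, hεhalf, hlarge, hsθ, hrate,
    (tendsto_floor_natCast_rpow hζ0).eventually_ge_atTop (P.δ + 1),
    (tendsto_floor_natCast_rpow (hζ0.trans hτζ)).eventually_ge_atTop P.s,
    hηlim.eventually_lt_const one_pos] with n hn1 hnε hnlarge hnsθ hnrate hnδ hns hnη
  have hn0 : (0 : ℝ) < n := by exact_mod_cast hn1
  have hnτ : (n : ℝ) ^ P.τ = n * (n : ℝ) ^ (P.τ - 1) := by
    rw [Real.rpow_sub_one hn0.ne']; field_simp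
  have hninv : (1 : ℝ) = n * (n : ℝ) ^ (-1 : ℝ) := by
    rw [Real.rpow_neg_one, mul_inv_cancel₀ hn0.ne']
  have hMτ : (P.maxSize n : ℝ) ≤ (n : ℝ) ^ P.τ := Nat.floor_le (by positivity)
  have hZ : ((P.maxSize n + 1 : ℕ) : ℝ) + c * P.eps n * n ≤ n * ρ n := by
    push_cast
    simp only [hρ]
    rw [mul_add, mul_add, ← hnτ, ← hninv]
    linarith
  have hcεn : 0 ≤ c * P.eps n * n := by linarith
  have hsn : P.s * (P.maxSize n + 1) ≤ n := by
    have h1 : ((P.s * (P.maxSize n + 1) : ℕ) : ℝ) ≤ n := by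
      rw [Nat.cast_mul]
      calc (P.s : ℝ) * ((P.maxSize n + 1 : ℕ) : ℝ) ≤ P.s * (n * ρ n) := by gcongr; linarith
        _ = n * (P.s * ρ n) := by ring
        _ ≤ n * 1 := by gcongr; exact hnrate.2
        _ = n := mul_one _
    exact_mod_cast h1
  refine le_trans ?_ (PMF.toOuterMeasure_mono _ (s := {C | ¬ (C.sum = n ∧
    (∀ d ∈ C, P.s ≤ d ∧ d ≤ P.maxSize n + 1) ∧
      smallMass (P.maxDeg n) C ≤ ⌊c * P.eps n * n⌋₊)}ᶜ) ?_)
  · rw [tsub_le_iff_right, ← toOuterMeasure_add_compl (P.communities n) {C | ¬ (C.sum = n ∧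
      (∀ d ∈ C, P.s ≤ d ∧ d ≤ P.maxSize n + 1) ∧
        smallMass (P.maxDeg n) C ≤ ⌊c * P.eps n * n⌋₊)}, add_comm]
    gcongr
    exact ABCDParams.communities_bad_le_ofReal hβ1 hβ2 hs0 hζ0 hτζ hτ1 hc hn1 hns hsn hnsθ hnlarge
  · rintro C ⟨hC, -⟩
    rw [Set.mem_compl_iff, Set.mem_ofPred_eq, not_not] at hC
    obtain ⟨hCsum, hCsize, hCsmall⟩ := hC
    intro j
    have hM : P.δ ≤ P.maxDeg n := (Nat.le_succ _).trans hnδ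
    have hSle : ((⌊c * P.eps n * n⌋₊ : ℕ) : ℝ) ≤ c * P.eps n * n := Nat.floor_le hcεn
    have hKge : (n : ℝ) * (p₀ / 8) ≤ (⌈(n : ℝ) * (p₀ / 8)⌉₊ : ℕ) := Nat.le_ceil _
    have hKpos : (0 : ℝ) < n * (p₀ / 8) := by positivity
    have hKpos' : (0 : ℝ) < (⌈(n : ℝ) * (p₀ / 8)⌉₊ : ℕ) := hKpos.trans_le hKge
    have hb : ((⌊(n : ℝ) * (p₀ / 4)⌋₊ : ℕ) : ℝ) ≤ n * (p₀ / 4) := Nat.floor_le (by positivity)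
    have hSKZ : ⌊c * P.eps n * n⌋₊ + ⌈(n : ℝ) * (p₀ / 8)⌉₊ + (P.maxSize n + 1) ≤
        ⌊(n : ℝ) * (p₀ / 4)⌋₊ := by
      have h1 := Nat.ceil_lt_add_one hKpos.le
      have h2 := Nat.lt_floor_add_one ((n : ℝ) * (p₀ / 4))
      have h3 := mul_le_mul_of_nonneg_left hnrate.1 hn0.le
      rw [mul_add, mul_left_comm, ← hninv] at h3
      have h4 : ((⌊c * P.eps n * n⌋₊ + ⌈(n : ℝ) * (p₀ / 8)⌉₊ + (P.maxSize n + 1) : ℕ) : ℝ) <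
          (⌊(n : ℝ) * (p₀ / 4)⌋₊ + 1 : ℕ) := by
        rw [Nat.cast_add, Nat.cast_add, Nat.cast_add ⌊(n : ℝ) * (p₀ / 4)⌋₊, Nat.cast_one]
        linarith
      exact Nat.lt_succ_iff.1 (by exact_mod_cast h4)
    refine ABCDParams.sandwich_of_bounds hδ hs hξ0 hξ1 hM (hε0 n) (by linarith) hp₀le
      (K := ⌈(n : ℝ) * (p₀ / 8)⌉₊) (S := ⌊c * P.eps n * n⌋₊) (Z := P.maxSize n + 1)
      (b := ⌊(n : ℝ) * (p₀ / 4)⌋₊) (a := ⌊(n : ℝ) * (p₀ / 4)⌋₊ - (P.maxSize n + 1)) (t := t n)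
      (by exact_mod_cast hKpos') (by omega) ?_ (ht0 n) hnη ?_ hCsum (fun d hd => (hCsize d hd).1)
      (fun d hd => (hCsize d hd).2) hCsmall (by omega) ?_ ?_ j
    · have : ((⌊(n : ℝ) * (p₀ / 4)⌋₊ : ℕ) : ℝ) ≤ n := by nlinarith
      exact_mod_cast this
    · refine iidPMF_bad_le hp₀.le hp₁0 ?_ (hp₁ (P.maxDeg n) hnδ) hb
      rw [tpl_minimum _ hδ hM]
      exact ENNReal.ofReal_le_ofReal
        ((le_div_iff₀ (powInt_total_pos _ hδ hM)).2 (hp₀le _ hM))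
    · rw [div_le_iff₀ hKpos']
      calc _ ≤ c * P.eps n * n := hSle
        _ = P.eps n * p₀ * (n * (p₀ / 8)) := by rw [hcdef]; ring
        _ ≤ _ := mul_le_mul_of_nonneg_left hKge (mul_nonneg (hε0 n) hp₀.le)
    · have h1 : (((P.maxSize n + 1 : ℕ) : ℝ) + (⌊c * P.eps n * n⌋₊ : ℕ)) /
          (⌈(n : ℝ) * (p₀ / 8)⌉₊ : ℕ) ≤ 8 / p₀ * ρ n := by
        rw [div_le_iff₀ hKpos']
        calc _ ≤ n * ρ n := by linarith
          _ = 8 / p₀ * ρ n * (n * (p₀ / 8)) := by field_simp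
          _ ≤ _ := mul_le_mul_of_nonneg_left hKge (mul_nonneg (by positivity) (hρ0 n))
      simp only [hη]
      have := hε0 n
      linarith
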